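/- Let $k$ be an algebraically closed field and let $G$ be a linearly reductive affine group scheme over $k$, i.e. an affine group scheme of finite type over $k$ such that pushforward of quasi-coherent sheaves along $BG\to\operatorname{Spec} k$ is exact. Let $\operatorname{Spec} A$ be a noetherian affine $k$-scheme with an action of $G$, and let $x\in\operatorname{Spec} A$ be a $k$-point fixed by $G$, with maximal ideal $\mathfrak m\subset A$. Suppose that the ring of invariants $A^G$ is a complete local ring. Let $\mathcal X=[\operatorname{Spec} A/G]$ be the quotient stack and, for $n\ge 0$, let $\mathcal X^{[n]}=[\operatorname{Spec}(A/\mathfrak m^{n+1})/G]\subseteq\mathcal X$ be the $n$th infinitesimal neighborhood of $x$, i.e. the closed substack defined by the $(n+1)$st power of the ideal sheaf of the residual gerbe $BG\subseteq\mathcal X$ of $x$. Then the natural restriction functor $$\operatorname{Coh}(\mathcal X)\longrightarrow \varprojlim_n \operatorname{Coh}\bigl(\mathcal X^{[n]}\bigr)$$ is an equivalence of categories. (Here $\operatorname{Coh}$ denotes the category of coherent sheaves, and an object of the limit is a family $\mathcal F_n\in\operatorname{Coh}(\mathcal X^{[n]})$, $n\ge0$, together with isomorphisms $\mathcal F_{n+1}|_{\mathcal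 X^{[n]}}\cong\mathcal F_n$; morphisms are compatible families of morphisms.) In other words, $\mathcal X$ is coherently complete along $BG$. -/

import Mathlib

open CategoryTheory Opposite TensorProduct

universe v v' u u'

noncomputable section

/-! ## Inverse limits of towers of categories -/

section Tower

variable {C : ℕ → Type u'} [∀ n, Category.{v'} (C n)]

/-- The (pseudo-)limit `lim_n C n` of a tower of categories `⋯ ⥤ C 2 ⥤ C 1 ⥤ C 0`: an object is a
family of objects `X n` of `C n` together with isomorphisms `F n (X (n + 1)) ≅ X n`. -/
structure TowerLimit (F : ∀ n, C (n + 1) ⥤ C n) where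
  /-- the members of the system -/
  obj (n : ℕ) : C n
  /-- the transition isomorphisms -/
  iso (n : ℕ) : (F n).obj (obj (n + 1)) ≅ obj n

namespace TowerLimit

variable {F : ∀ n, C (n + 1) ⥤ C n}

/-- A morphism of systems: a family of morphisms compatible with the transition isomorphisms. -/
@[ext]
structure Hom (X Y : TowerLimit F) where
  /-- the members of the family -/
  app (n : ℕ) : X.obj n ⟶ Y.obj n
  comm (n : ℕ) : (F n).map (app (n + 1)) ≫ (Y.iso n).hom = (X.iso n).hom ≫ app n

instance : Category (TowerLimit F) where
  Hom := Hom
  id X := { app := fun _ ↦ 𝟙 _, comm := by simp }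
  comp f g :=
    { app := fun n ↦ f.app n ≫ g.app n
      comm := fun n ↦ by
        rw [Functor.map_comp, Category.assoc, g.comm, ← Category.assoc, f.comm, Category.assoc] }

/-- The functor to the limit induced by functors `G n : D ⥤ C n` that are compatible with the
transition functors up to given isomorphisms. -/
def lift {D : Type u} [Category.{v} D] (G : ∀ n, D ⥤ C n) (e : ∀ n, G (n + 1) ⋙ F n ≅ G n) :
    D ⥤ TowerLimit F where
  obj X := { obj := fun n ↦ (G n).obj X, iso := fun n ↦ (e n).app X }
  map f := { app := fun n ↦ (G n).map f, comm := fun n ↦ (e n).hom.naturality f }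
  map_id X := Hom.ext (funext fun n ↦ (G n).map_id X)
  map_comp f g := Hom.ext (funext fun n ↦ (G n).map_comp f g)

end TowerLimit

end Tower

/-! ## Quasi-coherent and coherent modules on a stack

A stack is given by its category `C` of affine points `ξ : Spec R ⟶ 𝒳` and its structure sheaf `O`,
which sends `ξ` to `R`. By faithfully flat descent for modules, a quasi-coherent module on `𝒳`
is a rule that attaches to every affine point `ξ` an `R`-module, compatibly with base change. -/

section Modules

variable {C : Type u'} [Category.{v'} C] (O : Cᵒᵖ ⥤ CommRingCat.{u})

/-- Presheaves of modules over a presheaf of commutative rings. -/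
abbrev PMod := PresheafOfModules.{u} (O ⋙ forget₂ CommRingCat.{u} RingCat.{u})

variable {O} in
/-- The restriction map `M(ξ) → M(η)` of a presheaf of modules along a morphism of affine points
exhibits `M(η)` as the base change `O(η) ⊗ M(ξ)`. -/
def PMod.IsBaseChangeAt (M : PMod O) {X Y : Cᵒᵖ} (f : X ⟶ Y) : Prop :=
  letI : Algebra (O.obj X) (O.obj Y) := (O.map f).hom.toAlgebra
  letI : Module (O.obj X) (M.obj Y) := Module.compHom _ (O.map f).hom
  haveI : IsScalarTower (O.obj X) (O.obj Y) (M.obj Y) := ⟨fun a b m ↦ mul_smul (O.map f a) b m⟩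
  IsBaseChange (O.obj Y)
    ({ toFun := fun m ↦ M.map f m
       map_add' := fun a b ↦ map_add (M.map f).hom a b
       map_smul' := fun r m ↦ M.map_smul f r m } : M.obj X →ₗ[O.obj X] M.obj Y)

/-- Quasi-coherence: all restriction maps are base change maps. -/
def isQCoh : ObjectProperty (PMod O) := fun M ↦
  ∀ ⦃X Y : Cᵒᵖ⦄ (f : X ⟶ Y), M.IsBaseChangeAt f

/-- Coherence on a noetherian stack: quasi-coherent and of finite type. -/
def isCoh : ObjectProperty (PMod O) := fun M ↦
  isQCoh O M ∧ ∀ X : Cᵒᵖ, Module.Finite (O.obj X) (M.obj X)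

/-- The category of quasi-coherent modules. -/
abbrev QCoh := (isQCoh O).FullSubcategory

/-- The category of coherent modules on a noetherian stack. -/
abbrev Coh := (isCoh O).FullSubcategory

/-- Restriction of coherent modules along a functor `F` between categories of affine points. -/
def Coh.restrict {D : Type u'} [Category.{v'} D] (F : D ⥤ C) : Coh O ⥤ Coh (F.op ⋙ O) :=
  (isCoh (F.op ⋙ O)).lift ((isCoh O).ι ⋙ PresheafOfModules.pushforward₀OfCommRingCat F O)
    fun M ↦ ⟨fun _ _ f ↦ M.property.1 (F.op.map f), fun X ↦ M.property.2 (F.op.obj X)⟩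

/-- The structure morphism of the stack to the base is cohomologically affine: taking global
sections is exact on quasi-coherent modules. As global sections are left exact and a morphism of
quasi-coherent modules is an epimorphism if and only if it is surjective on every affine point,
this means that surjections stay surjective on global sections. -/
def IsCohomologicallyAffine : Prop :=
  ∀ ⦃M N : QCoh O⦄ (f : M ⟶ N), (∀ X : Cᵒᵖ, Function.Surjective (f.hom.app X)) →
    Function.Surjective (PresheafOfModules.sectionsMap f.hom)

end Modules

/-! ## Group actions on affine schemes and quotient stacks -/

section Group

variable (k H : Type u) [Field k] [CommRing H] [HopfAlgebra k H]

/-- A (right) action of the affine group scheme `G = Spec H` on the affine `k`-scheme `Spec A`, as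
the comorphism `A → A ⊗ H` of the action map `Spec A × G ⟶ Spec A`. -/
structure GAction (A : Type u) [CommRing A] [Algebra k A] where
  /-- the comorphism of the action map -/
  coact : A →ₐ[k] A ⊗[k] H
  coassoc : ((Algebra.TensorProduct.assoc k k k A H H).toAlgHom.comp
      (Algebra.TensorProduct.map coact (AlgHom.id k H))).comp coact =
    (Algebra.TensorProduct.map (AlgHom.id k A) (Bialgebra.comulAlgHom k H)).comp coact
  counit : ((Algebra.TensorProduct.rid k k A).toAlgHom.comp
      (Algebra.TensorProduct.map (AlgHom.id k A) (Bialgebra.counitAlgHom k H))).comp coact =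
    AlgHom.id k A

namespace GAction

/-- The trivial action of `G` on `Spec k`. -/
def trivial : GAction k H k where
  coact := Algebra.TensorProduct.includeLeft
  coassoc := by ext
  counit := by ext

variable {k H} {A : Type u} [CommRing A] [Algebra k A] (σ : GAction k H A)

/-- The ring of invariants `A^G`. -/
def invariants : Subalgebra k A :=
  AlgHom.equalizer σ.coact Algebra.TensorProduct.includeLeft

/-- The `k`-point `x` of `Spec A` is fixed by `G`: the orbit map `G ⟶ Spec A` of `x` is constant
with value `x`. -/
def IsFixed (x : A →ₐ[k] k) : Prop :=
  ((Algebra.TensorProduct.lid k H).toAlgHom.comp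
    (Algebra.TensorProduct.map x (AlgHom.id k H))).comp σ.coact = (Algebra.ofId k H).comp x

/-- For `P` an algebra over a `k`-algebra `R` with an action of `G` on `Spec P`: the morphism
`Spec P ⟶ Spec R` is a `G`-torsor, i.e. it is invariant, faithfully flat (and affine), and the
morphism `Spec P × G ⟶ Spec P ×_{Spec R} Spec P`, `(p, g) ↦ (p, p g)`, is an isomorphism. -/
structure IsTorsor (R : Type u) [CommRing R] [Algebra k R] {P : Type u} [CommRing P] [Algebra k P]
    [Algebra R P] [IsScalarTower k R P] (ρ : GAction k H P) : Prop where
  invariant (r : R) : ρ.coact (algebraMap R P r) = algebraMap R P r ⊗ₜ 1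
  faithfullyFlat : Module.FaithfullyFlat R P
  bijective : Function.Bijective (Algebra.TensorProduct.lift
    (Algebra.TensorProduct.includeLeft : P →ₐ[R] P ⊗[k] H)
    ({ ρ.coact with commutes' := invariant } : P →ₐ[R] P ⊗[k] H) (fun _ _ ↦ Commute.all _ _))

/-- An affine point `Spec R ⟶ [Spec A / G]` of the quotient stack: a `G`-torsor
`Spec P ⟶ Spec R` together with a `G`-equivariant morphism `Spec P ⟶ Spec A`. (All `G`-torsors
over an affine scheme are affine schemes, since `G` is affine.) -/
structure AffinePoint where
  R : Type u
  P : Type u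
  [commRingR : CommRing R]
  [algebraR : Algebra k R]
  [commRingP : CommRing P]
  [algebraP : Algebra k P]
  [algebraRP : Algebra R P]
  [isScalarTower : IsScalarTower k R P]
  /-- the action on the total space of the torsor -/
  act : GAction k H P
  isTorsor : act.IsTorsor R
  /-- the comorphism of `Spec P ⟶ Spec A` -/
  toP : A →ₐ[k] P
  equivariant : act.coact.comp toP =
    (Algebra.TensorProduct.map toP (AlgHom.id k H)).comp σ.coact

attribute [instance] AffinePoint.commRingR AffinePoint.algebraR AffinePoint.commRingP
  AffinePoint.algebraP AffinePoint.algebraRP AffinePoint.isScalarTower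

variable {σ} in
/-- A morphism of affine points: a morphism `Spec R_ξ ⟶ Spec R_η` of `k`-schemes covered by a
`G`-equivariant morphism of torsors over `Spec A`. (Such a square is automatically cartesian, as
every morphism of torsors is an isomorphism.) -/
@[ext]
structure AffinePoint.Hom (ξ η : σ.AffinePoint) where
  base : η.R →ₐ[k] ξ.R
  total : η.P →ₐ[k] ξ.P
  comm (r : η.R) : total (algebraMap η.R η.P r) = algebraMap ξ.R ξ.P (base r)
  equivariant : ξ.act.coact.comp total =
    (Algebra.TensorProduct.map total (AlgHom.id k H)).comp η.act.coact
  toP_comp : total.comp η.toP = ξ.toP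

/-- The quotient stack `[Spec A / G]`, as the category of its affine points. -/
instance : Category σ.AffinePoint where
  Hom := AffinePoint.Hom
  id ξ :=
    { base := AlgHom.id k _
      total := AlgHom.id k _
      comm := fun _ ↦ rfl
      equivariant := by simp
      toP_comp := rfl }
  comp f g :=
    { base := f.base.comp g.base
      total := f.total.comp g.total
      comm := fun r ↦ by simp [f.comm, g.comm]
      equivariant := by
        rw [← AlgHom.comp_assoc, f.equivariant, AlgHom.comp_assoc, g.equivariant,
          ← AlgHom.comp_assoc, ← Algebra.TensorProduct.map_comp, AlgHom.comp_id]
      toP_comp := by rw [AlgHom.comp_assoc, g.toP_comp, f.toP_comp] }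

/-- The structure sheaf of `[Spec A / G]`. -/
def structureSheaf : σ.AffinePointᵒᵖ ⥤ CommRingCat.{u} where
  obj ξ := CommRingCat.of ξ.unop.R
  map f := CommRingCat.ofHom (AffinePoint.Hom.base f.unop).toRingHom
  map_id _ := rfl
  map_comp _ _ := rfl

/-- For a (`G`-stable) ideal `I` of `A`, the closed substack `[V(I) / G]` of `[Spec A / G]`: the
affine points for which the morphism `Spec P ⟶ Spec A` factors through `V(I)`. -/
def closedSubstack (I : Ideal A) : ObjectProperty σ.AffinePoint := fun ξ ↦ ∀ a ∈ I, ξ.toP a = 0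

variable (x : A →ₐ[k] k)

/-- The `n`-th infinitesimal neighbourhood `𝒳^[n]` in `𝒳 = [Spec A / G]` of a fixed `k`-point `x`:
the closed substack defined by the `(n + 1)`-st power of the ideal of the residual gerbe `BG` of
`x`, i.e. of the maximal ideal of `A` at `x`. -/
def infNbhd (n : ℕ) : ObjectProperty σ.AffinePoint :=
  σ.closedSubstack (RingHom.ker x ^ (n + 1))

lemma infNbhd_le (n : ℕ) : σ.infNbhd x n ≤ σ.infNbhd x (n + 1) :=
  fun _ h a ha ↦ h a (Ideal.pow_le_pow_right (Nat.le_succ _) ha)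

/-- The structure sheaf of the `n`-th infinitesimal neighbourhood. -/
def infNbhdSheaf (n : ℕ) : (σ.infNbhd x n).FullSubcategoryᵒᵖ ⥤ CommRingCat.{u} :=
  (σ.infNbhd x n).ι.op ⋙ σ.structureSheaf

/-- Restriction of coherent modules from `𝒳^[n+1]` to `𝒳^[n]`. -/
def cohTransition (n : ℕ) : Coh (σ.infNbhdSheaf x (n + 1)) ⥤ Coh (σ.infNbhdSheaf x n) :=
  Coh.restrict (σ.infNbhdSheaf x (n + 1)) (ObjectProperty.ιOfLE (σ.infNbhd_le x n))

/-- Restriction of coherent modules from `𝒳` to `𝒳^[n]`. -/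
def cohRestrict (n : ℕ) : Coh σ.structureSheaf ⥤ Coh (σ.infNbhdSheaf x n) :=
  Coh.restrict σ.structureSheaf (σ.infNbhd x n).ι

/-- The natural functor `Coh(𝒳) ⥤ lim_n Coh(𝒳^[n])`. -/
def cohCompletion : Coh σ.structureSheaf ⥤ TowerLimit (C := fun n ↦ Coh (σ.infNbhdSheaf x n)) (σ.cohTransition x) :=
  TowerLimit.lift (C := fun n ↦ Coh (σ.infNbhdSheaf x n)) (σ.cohRestrict x) fun _ ↦ Iso.refl _

end GAction

/-- The affine group scheme `G = Spec H` over `k` is linearly reductive: it is of finite type and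
`BG = [Spec k / G] ⟶ Spec k` is cohomologically affine. -/
structure IsLinearlyReductive : Prop where
  finiteType : Algebra.FiniteType k H
  cohomologicallyAffine : IsCohomologicallyAffine (GAction.trivial k H).structureSheaf

end Group

end

/-!
Linear reductivity makes the formation of invariants exact on all representations of `G = Spec H`
(`IsCohomologicallyAffine.exactInvariants`): a representation `M` has an associated quasi-coherent
module on `BG`, whose global sections are the invariants of `M`.

A quasi-coherent module on `[Spec A / G]` is treated as a `Family` of modules, one for every affine
point, related by base change. Its value at the trivial torsor over `Spec A` is an `A`-module with a
compatible coaction of `H`, and by descent along torsors (`isBaseChange_descend`) this equivariant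
module determines the family: its value at a point with torsor `Spec P` consists of the invariants
of `P ⊗ F` (`associated`, `exists_hom`). The same holds over the infinitesimal neighbourhoods, so
the question is about finite equivariant `A`-modules and their quotients by the powers of the
maximal ideal `𝔪` of the fixed point.

For a finite equivariant module `F` and a finite-dimensional stable space `C` of functions on `G`,
let `F_C` be the part of `F` whose matrix coefficients lie in `C` (`isotypic`). It is isomorphic to
the invariants of `F ⊗ C`. As invariants are exact, `F ↦ F_C` is exact
(`ExactInvariants.exists_mem_isotypic`), and `F_C` is a noetherian module over `A^G`
(`ExactInvariants.isNoetherian_isotypicIn`). Over a complete noetherian local ring such modules are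
linearly compact (`exists_forall_sub_mem`): compatible systems of cosets of a decreasing sequence of
submodules, not necessarily open ones, have a common element. Every element of a representation lies
in some `F_C`, so this is enough to lift sequences whose members have their matrix coefficients in
a common `C` (`exists_mem_forall_eq`).

* Completion is faithful since `F` is separated for the `𝔪`-adic topology
  (`eq_zero_of_forall_mem_pow_smul`).
* It is full since the images of an element under a compatible system of equivariant maps have
  their matrix coefficients in a common `C`, and so lift (`exists_hom_of_compatible`).
* It is essentially surjective since a tower of equivariant modules has a limit among equivariant
  modules, made of the compatible sequences with matrix coefficients in a common `C`
  (`equivariantLimit`). Exactness of isotypic parts lifts generators of the first module to the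
  limit. By Nakayama's lemma a finite stable submodule containing the lifts surjects to the whole
  tower, and by linear compactness it is the whole limit. So the limit is finite, and by the same
  argument it has the right quotients (`exists_limit`).
-/

noncomputable section

/-! ### Representations as comodules -/

section Tact

variable {k A B M N : Type*} [CommRing k] [CommRing A] [Algebra k A] [CommRing B] [Algebra k B]
  [AddCommGroup M] [Module k M] [Module A M] [IsScalarTower k A M]
  [AddCommGroup N] [Module k N] [Module B N] [IsScalarTower k B N]

variable (k A B M N) in
/-- The action of the algebra `A ⊗ B` on `M ⊗ N`, for an `A`-module `M` and a `B`-module `N`. It is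
kept as a homomorphism rather than a `Module` instance, which would compete with the action of
`A ⊗ B` on itself. -/
def tensorAct : A ⊗[k] B →ₐ[k] Module.End k (M ⊗[k] N) :=
  Module.endTensorEndAlgHom.comp
    (Algebra.TensorProduct.map (Algebra.lsmul k k M) (Algebra.lsmul k k N))

@[simp]
lemma tensorAct_tmul (a : A) (b : B) (m : M) (n : N) :
    tensorAct k A B M N (a ⊗ₜ b) (m ⊗ₜ n) = (a • m) ⊗ₜ (b • n) := by
  simp [tensorAct, Module.endTensorEndAlgHom_apply]

end Tact

section Coaction

variable (k H : Type u) [Field k] [CommRing H] [HopfAlgebra k H]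

/-- A (right) coaction of `H` on a `k`-module `M`, i.e. a representation of the affine group scheme
`Spec H`. -/
structure Coaction (M : Type*) [AddCommGroup M] [Module k M] where
  /-- the coaction map -/
  coact : M →ₗ[k] M ⊗[k] H
  coassoc (m : M) : TensorProduct.assoc k M H H (coact.rTensor H (coact m)) =
    (Coalgebra.comul : H →ₗ[k] H ⊗[k] H).lTensor M (coact m)
  counit (m : M) : TensorProduct.rid k M
    ((Coalgebra.counit : H →ₗ[k] k).lTensor M (coact m)) = m

namespace Coaction

variable {k H}
variable {M N : Type*} [AddCommGroup M] [Module k M] [AddCommGroup N] [Module k N]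
variable (c : Coaction k H M) (d : Coaction k H N)

/-- A linear map of representations is equivariant if it commutes with the coactions. -/
def IsHom (f : M →ₗ[k] N) : Prop := ∀ m, d.coact (f m) = f.rTensor H (c.coact m)

/-- An element `m` is invariant if its coaction is `m ⊗ 1`. -/
def IsInvariant (m : M) : Prop := c.coact m = m ⊗ₜ 1

/-- A subspace `W` is stable if the coaction maps it to `W ⊗ H`. -/
def IsStable (W : Submodule k M) : Prop :=
  ∀ w ∈ W, c.coact w ∈ LinearMap.range (W.subtype.rTensor H)

variable (k H M) in
/-- The trivial representation on `M`. -/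
def trivial : Coaction k H M where
  coact := (TensorProduct.mk k M H).flip 1
  coassoc m := by simp [Algebra.TensorProduct.one_def]
  counit m := by simp

/-- The pairing `(M ⊗ B) × (N ⊗ B) → (M ⊗ N) ⊗ B` given by the multiplication of `B`. -/
def pairing (M N : Type*) [AddCommGroup M] [Module k M] [AddCommGroup N] [Module k N]
    (B : Type*) [CommRing B] [Algebra k B] :
    M ⊗[k] B →ₗ[k] N ⊗[k] B →ₗ[k] (M ⊗[k] N) ⊗[k] B :=
  TensorProduct.map₂ (TensorProduct.mk k M N) (LinearMap.mul k B)

@[simp]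
lemma pairing_tmul {B : Type*} [CommRing B] [Algebra k B] (m : M) (n : N) (a b : B) :
    pairing M N B (m ⊗ₜ[k] a) (n ⊗ₜ[k] b) = (m ⊗ₜ n) ⊗ₜ (a * b) := rfl

lemma lTensor_pairing {B B' : Type*} [CommRing B] [Algebra k B] [CommRing B'] [Algebra k B']
    (φ : B →ₐ[k] B') (x : M ⊗[k] B) (y : N ⊗[k] B) :
    φ.toLinearMap.lTensor _ (pairing M N B x y) =
      pairing M N B' (φ.toLinearMap.lTensor _ x) (φ.toLinearMap.lTensor _ y) := by
  induction x with
  | zero => simp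
  | add x x' hx hx' => simp only [map_add, LinearMap.add_apply, hx, hx']
  | tmul m a =>
    induction y with
    | zero => simp
    | add y y' hy hy' => simp only [map_add, hy, hy']
    | tmul n b => simp

lemma rTensor_pairing {M' N' : Type*} [AddCommGroup M'] [Module k M'] [AddCommGroup N']
    [Module k N'] {B : Type*} [CommRing B] [Algebra k B] (f : M →ₗ[k] M') (g : N →ₗ[k] N')
    (x : M ⊗[k] B) (y : N ⊗[k] B) :
    (TensorProduct.map f g).rTensor B (pairing M N B x y) =
      pairing M' N' B (f.rTensor B x) (g.rTensor B y) := by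
  induction x with
  | zero => simp
  | add x x' hx hx' => simp only [map_add, LinearMap.add_apply, hx, hx']
  | tmul m a =>
    induction y with
    | zero => simp
    | add y y' hy hy' => simp only [map_add, hy, hy']
    | tmul n b => simp

lemma assoc_pairing_tmul {B : Type*} [CommRing B] [Algebra k B] (u : M ⊗[k] B) (v : N ⊗[k] B)
    (a b : B) :
    TensorProduct.assoc k (M ⊗[k] N) B B (pairing M N B u v ⊗ₜ (a * b)) =
      pairing M N (B ⊗[k] B) (TensorProduct.assoc k M B B (u ⊗ₜ a))
        (TensorProduct.assoc k N B B (v ⊗ₜ b)) := by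
  induction u with
  | zero => simp
  | add x x' hx hx' => simp only [map_add, LinearMap.add_apply, add_tmul, hx, hx']
  | tmul m a =>
    induction v with
    | zero => simp
    | add y y' hy hy' => simp only [map_add, add_tmul, hy, hy']
    | tmul n b => simp

/-- The tensor product of two representations, with the diagonal action. -/
def tensor : Coaction k H (M ⊗[k] N) where
  coact := TensorProduct.lift ((pairing M N H).compl₁₂ c.coact d.coact)
  coassoc z := by
    induction z with
    | zero => simp
    | add x y hx hy => simp only [map_add, hx, hy]
    | tmul m n =>
      have h1 := lTensor_pairing (Bialgebra.comulAlgHom k H) (c.coact m) (d.coact n)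
      have h2 : (Bialgebra.comulAlgHom k H).toLinearMap = Coalgebra.comul := rfl
      rw [h2, ← c.coassoc, ← d.coassoc] at h1
      simp only [lift.tmul, LinearMap.compl₁₂_apply]
      rw [h1]
      generalize c.coact m = x
      generalize d.coact n = y
      induction x with
      | zero => simp
      | add x x' hx hx' => simp only [map_add, LinearMap.add_apply, hx, hx']
      | tmul m a =>
        induction y with
        | zero => simp
        | add y y' hy hy' => simp only [map_add, hy, hy']
        | tmul n b => simp [assoc_pairing_tmul]
  counit z := by
    induction z with
    | zero => simp
    | add x y hx hy => simp only [map_add, hx, hy]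
    | tmul m n =>
      have h1 := lTensor_pairing (Bialgebra.counitAlgHom k H) (c.coact m) (d.coact n)
      have h2 : (Bialgebra.counitAlgHom k H).toLinearMap = Coalgebra.counit := rfl
      have h3 := c.counit m
      have h4 := d.counit n
      rw [← LinearEquiv.eq_symm_apply] at h3 h4
      rw [h2, h3, h4] at h1
      simp only [lift.tmul, LinearMap.compl₁₂_apply]
      rw [h1]
      simp

@[simp]
lemma tensor_coact_tmul (m : M) (n : N) :
    (c.tensor d).coact (m ⊗ₜ n) = pairing M N H (c.coact m) (d.coact n) := rfl

lemma IsHom.tensor {M' N' : Type*} [AddCommGroup M'] [Module k M'] [AddCommGroup N'] [Module k N']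
    {c : Coaction k H M} {d : Coaction k H N} {c' : Coaction k H M'} {d' : Coaction k H N'}
    {f : M →ₗ[k] M'} {g : N →ₗ[k] N'} (hf : c.IsHom c' f) (hg : d.IsHom d' g) :
    (c.tensor d).IsHom (c'.tensor d') (TensorProduct.map f g) := by
  intro z
  induction z with
  | zero => simp
  | add x y hx hy => simp only [map_add, hx, hy]
  | tmul m n => simp [hf m, hg n, rTensor_pairing]

lemma rTensor_subtype_injective (W : Submodule k M) :
    Function.Injective (W.subtype.rTensor H) :=
  Module.Flat.rTensor_preserves_injective_linearMap _ W.subtype_injective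

/-- The coaction on a stable subspace. -/
def restrict (W : Submodule k M) (hW : c.IsStable W) : Coaction k H W :=
  let e := LinearEquiv.ofInjective (W.subtype.rTensor H) (rTensor_subtype_injective W)
  let r : W →ₗ[k] W ⊗[k] H :=
    e.symm.toLinearMap ∘ₗ (c.coact ∘ₗ W.subtype).codRestrict _ fun w ↦ hW w w.2
  have hr (w : W) : W.subtype.rTensor H (r w) = c.coact w :=
    congrArg Subtype.val (e.apply_symm_apply ⟨c.coact w, hW w w.2⟩)
  have hr' : W.subtype.rTensor H ∘ₗ r = c.coact ∘ₗ W.subtype := LinearMap.ext hr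
  { coact := r
    coassoc := fun w ↦ by
      apply rTensor_subtype_injective (H := H ⊗[k] H) W
      have h1 (z : (W ⊗[k] H) ⊗[k] H) : W.subtype.rTensor (H ⊗[k] H) (TensorProduct.assoc k _ _ _ z)
          = TensorProduct.assoc k _ _ _ ((W.subtype.rTensor H).rTensor H z) := by
        rw [LinearMap.rTensor_tensor]; simp
      have h2 (z : W ⊗[k] H) : W.subtype.rTensor (H ⊗[k] H)
          ((Coalgebra.comul : H →ₗ[k] H ⊗[k] H).lTensor W z) =
          (Coalgebra.comul : H →ₗ[k] H ⊗[k] H).lTensor M (W.subtype.rTensor H z) := by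
        simp only [← LinearMap.comp_apply, LinearMap.rTensor_comp_lTensor,
          LinearMap.lTensor_comp_rTensor]
      rw [h1, h2, hr, ← LinearMap.rTensor_comp_apply, hr', LinearMap.rTensor_comp_apply, hr,
        c.coassoc]
    counit := fun w ↦ by
      apply W.subtype_injective
      have h1 (z : W ⊗[k] H) : W.subtype (TensorProduct.rid k W
          ((Coalgebra.counit : H →ₗ[k] k).lTensor W z)) =
          TensorProduct.rid k M ((Coalgebra.counit : H →ₗ[k] k).lTensor M
            (W.subtype.rTensor H z)) := by
        induction z with
        | zero => simp
        | add x y hx hy => simp only [map_add, hx, hy]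
        | tmul m n => simp
      rw [h1, hr, c.counit]
      rfl }

lemma rTensor_subtype_restrict (W : Submodule k M) (hW : c.IsStable W) (w : W) :
    W.subtype.rTensor H ((c.restrict W hW).coact w) = c.coact w :=
  congrArg Subtype.val ((LinearEquiv.ofInjective (W.subtype.rTensor H)
    (rTensor_subtype_injective W)).apply_symm_apply ⟨c.coact w, hW w w.2⟩)

variable {c d} in
lemma IsHom.isStable_map {f : M →ₗ[k] N} (hf : c.IsHom d f) {W : Submodule k M}
    (hW : c.IsStable W) : d.IsStable (W.map f) := by
  rintro _ ⟨w, hw, rfl⟩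
  obtain ⟨z, hz⟩ := hW w hw
  rw [hf, ← hz]
  refine ⟨(f.submoduleMap W).rTensor H z, ?_⟩
  rw [← LinearMap.rTensor_comp_apply, ← LinearMap.rTensor_comp_apply]
  rfl

variable (k H) in
/-- Taking invariants is exact: invariants lift along surjections of representations. -/
def ExactInvariants : Prop :=
  ∀ ⦃M N : Type u⦄ [AddCommGroup M] [AddCommGroup N] [Module k M] [Module k N]
    (c : Coaction k H M) (d : Coaction k H N) (f : M →ₗ[k] N), c.IsHom d f →
    Function.Surjective f → ∀ n, d.IsInvariant n → ∃ m, c.IsInvariant m ∧ f m = n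

lemma ExactInvariants.exists_mem {M N : Type u} [AddCommGroup M] [AddCommGroup N] [Module k M]
    [Module k N] {c : Coaction k H M} {d : Coaction k H N}
    (hH : ExactInvariants k H) {f : M →ₗ[k] N} (hf : c.IsHom d f)
    {W : Submodule k M} (hW : c.IsStable W) {n : N} (hn : d.IsInvariant n) (hnW : n ∈ W.map f) :
    ∃ w ∈ W, c.IsInvariant w ∧ f w = n := by
  have hV := hf.isStable_map hW
  obtain ⟨w, hw, hwn⟩ := hH (c.restrict W hW) (d.restrict _ hV) (f.submoduleMap W)
    (fun w ↦ by
      apply rTensor_subtype_injective (W.map f)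
      rw [rTensor_subtype_restrict, ← LinearMap.rTensor_comp_apply]
      change d.coact (f w) = (f ∘ₗ W.subtype).rTensor H _
      rw [LinearMap.rTensor_comp_apply, rTensor_subtype_restrict, hf])
    (f.submoduleMap_surjective W) ⟨n, hnW⟩ (by
      apply rTensor_subtype_injective (W.map f)
      rw [rTensor_subtype_restrict]
      simpa using! hn)
  refine ⟨w, w.2, ?_, congrArg Subtype.val hwn⟩
  have := congrArg (W.subtype.rTensor H) hw
  rw [rTensor_subtype_restrict] at this
  simpa using! this

end Coaction
end Coaction

/-! ### Isotypic parts and exactness of invariants -/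

section Antipode

variable {k H : Type u} [Field k] [CommRing H] [HopfAlgebra k H]

/-- The antipode is anti-comultiplicative, as it is the inverse in the group of points. -/
lemma comul_antipode (h : H) :
    (Coalgebra.comul (HopfAlgebra.antipode k h) : H ⊗[k] H) =
      TensorProduct.map (HopfAlgebra.antipode k) (HopfAlgebra.antipode k)
        (TensorProduct.comm k H H (Coalgebra.comul h)) := by
  let iL : WithConv (H →ₐ[k] H ⊗[k] H) := WithConv.toConv Algebra.TensorProduct.includeLeft
  let iR : WithConv (H →ₐ[k] H ⊗[k] H) := WithConv.toConv Algebra.TensorProduct.includeRight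
  have h1 : WithConv.toConv (Bialgebra.comulAlgHom k H) = iL * iR := by
    ext x
    rw [AlgHom.convMul_apply]
    change Coalgebra.comul x = _
    generalize (Coalgebra.comul x : H ⊗[k] H) = z
    induction z with
    | zero => simp
    | add x y hx hy => simp only [map_add, ← hx, ← hy]
    | tmul a b => simp [iL, iR]
  have h2 := congrArg (fun f ↦ (f⁻¹).ofConv h) h1
  have h3 : (Coalgebra.comul (HopfAlgebra.antipode k h) : H ⊗[k] H) = (iR⁻¹ * iL⁻¹) h :=
    h2.trans (congrArg (fun f ↦ f.ofConv h) (mul_inv_rev iL iR))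
  rw [h3, AlgHom.convMul_apply]
  generalize (Coalgebra.comul h : H ⊗[k] H) = z
  induction z with
  | zero => simp
  | add x y hx hy => simp only [map_add, ← hx, ← hy]
  | tmul a b =>
    change (1 ⊗ₜ[k] (HopfAlgebra.antipode k a)) * ((HopfAlgebra.antipode k b) ⊗ₜ[k] 1) = _
    simp

namespace Coaction

variable (k H) in
/-- The representation of `G = Spec H` on the functions on `G` that comes from the inverse left
translations, `h ↦ h₂ ⊗ S(h₁)`. -/
def leftRegular : Coaction k H H where
  coact := (HopfAlgebra.antipode k).lTensor H ∘ₗ (TensorProduct.comm k H H).toLinearMap ∘ₗ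
    Coalgebra.comul
  coassoc h := by
    let S : H →ₗ[k] H := HopfAlgebra.antipode k
    -- the map `a ⊗ (b ⊗ c) ↦ c ⊗ (S b ⊗ S a)`, which sends both versions of the iterated
    -- comultiplication to the two sides
    let r : H ⊗[k] (H ⊗[k] H) →ₗ[k] H ⊗[k] (H ⊗[k] H) :=
      (TensorProduct.map S S).lTensor H ∘ₗ (TensorProduct.assoc k H H H).toLinearMap ∘ₗ
        ((TensorProduct.comm k H H).toLinearMap).rTensor H ∘ₗ
        (TensorProduct.comm k H (H ⊗[k] H)).toLinearMap
    have h1 (z : H ⊗[k] H) : TensorProduct.assoc k H H H ((S.lTensor H ∘ₗ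
        (TensorProduct.comm k H H).toLinearMap ∘ₗ Coalgebra.comul).rTensor H
        (S.lTensor H (TensorProduct.comm k H H z))) =
        r ((Coalgebra.comul : H →ₗ[k] H ⊗[k] H).lTensor H z) := by
      induction z with
      | zero => simp
      | add x y hx hy => simp only [map_add, ← hx, ← hy]
      | tmul a b =>
        simp only [LinearMap.lTensor_tmul, TensorProduct.comm_tmul, LinearMap.rTensor_tmul,
          LinearMap.comp_apply, LinearEquiv.coe_coe, r]
        generalize (Coalgebra.comul b : H ⊗[k] H) = w
        induction w with
        | zero => simp
        | add x y hx hy => simp only [map_add, add_tmul, hx, hy]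
        | tmul c d => simp
    have h2 (z : H ⊗[k] H) : (Coalgebra.comul : H →ₗ[k] H ⊗[k] H).lTensor H
        (S.lTensor H (TensorProduct.comm k H H z)) =
        r (TensorProduct.assoc k H H H ((Coalgebra.comul : H →ₗ[k] H ⊗[k] H).rTensor H z)) := by
      induction z with
      | zero => simp
      | add x y hx hy => simp only [map_add, ← hx, ← hy]
      | tmul a b =>
        simp only [LinearMap.lTensor_tmul, TensorProduct.comm_tmul, LinearMap.rTensor_tmul,
          LinearMap.comp_apply, LinearEquiv.coe_coe, r, S, comul_antipode]
        generalize (Coalgebra.comul a : H ⊗[k] H) = w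
        induction w with
        | zero => simp
        | add x y hx hy => simp only [map_add, tmul_add, add_tmul, hx, hy]
        | tmul c d => simp
    simp only [LinearMap.comp_apply, LinearEquiv.coe_coe]
    erw [h1, h2, Coalgebra.coassoc_apply]
  counit h := by
    have h1 (z : H ⊗[k] H) : TensorProduct.rid k H ((Coalgebra.counit : H →ₗ[k] k).lTensor H
        ((HopfAlgebra.antipode k).lTensor H (TensorProduct.comm k H H z))) =
        TensorProduct.lid k H ((Coalgebra.counit : H →ₗ[k] k).rTensor H z) := by
      induction z with
      | zero => simp
      | add x y hx hy => simp only [map_add, ← hx, ← hy]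
      | tmul a b => simp
    simp [h1]

lemma leftRegular_coact (h : H) : (leftRegular k H).coact h =
    (HopfAlgebra.antipode k).lTensor H (TensorProduct.comm k H H (Coalgebra.comul h)) := rfl

variable {M N : Type*} [AddCommGroup M] [Module k M] [AddCommGroup N] [Module k N]
variable (c : Coaction k H M) (d : Coaction k H N)

/-- Every element of a representation is contained in a finite-dimensional stable subspace. -/
lemma exists_finite_stable (m : M) :
    ∃ W : Submodule k M, Module.Finite k W ∧ c.IsStable W ∧ m ∈ W := by
  classical
  let b := Module.Basis.ofVectorSpace k H
  let e := TensorProduct.equivFinsuppOfBasisRight (M := M) b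
  let v := e (c.coact m)
  have hv : c.coact m = ∑ i ∈ v.support, v i ⊗ₜ b i := by
    rw [← e.symm_apply_apply (c.coact m), TensorProduct.equivFinsuppOfBasisRight_symm_apply]
    rfl
  refine ⟨Submodule.span k (Set.range fun i : v.support ↦ v i), ?_, ?_, ?_⟩
  · exact Module.Finite.span_of_finite _ (Set.finite_range _)
  · set W := Submodule.span k (Set.range fun i : v.support ↦ v i)
    -- in terms of the basis of `H` on the right, coassociativity writes `ρ (v i)` as a
    -- combination of the `v j`
    have key (i) : c.coact (v i) = ∑ j ∈ v.support,
        v j ⊗ₜ (TensorProduct.equivFinsuppOfBasisRight (M := H) b (Coalgebra.comul (b j)) i) := by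
      have h1 := c.coassoc m
      let L : M ⊗[k] (H ⊗[k] H) →ₗ[k] M ⊗[k] H :=
        (Finsupp.lapply i ∘ₗ
          (TensorProduct.equivFinsuppOfBasisRight (M := H) b).toLinearMap).lTensor M
      have h2 := congrArg L h1
      rw [hv] at h2
      simp only [map_sum, LinearMap.rTensor_tmul, LinearMap.lTensor_tmul] at h2
      have h3 (z : M ⊗[k] H) (j) : L (TensorProduct.assoc k M H H (z ⊗ₜ b j)) =
          if j = i then z else 0 := by
        induction z with
        | zero => simp
        | add x y hx hy => rw [add_tmul, map_add, map_add, hx, hy]; split_ifs <;> simp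
        | tmul x y =>
          simp [L, Finsupp.single_apply]
          split_ifs <;> simp
      simp only [h3] at h2
      rw [Finset.sum_ite_eq'] at h2
      by_cases hi : i ∈ v.support
      · rw [if_pos hi] at h2
        rw [h2]
        rfl
      · rw [if_neg hi] at h2
        rw [Finsupp.notMem_support_iff.mp hi, map_zero, h2]
        rfl
    intro w hw
    induction hw using Submodule.span_induction with
    | zero => simp
    | add x y _ _ hx hy => rw [map_add]; exact add_mem hx hy
    | smul a x _ hx => rw [map_smul]; exact Submodule.smul_mem _ _ hx
    | mem x hx =>
      obtain ⟨i, rfl⟩ := hx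
      simp only [key]
      refine sum_mem fun j hj ↦ ?_
      exact ⟨⟨v j, Submodule.subset_span ⟨⟨j, hj⟩, rfl⟩⟩ ⊗ₜ _, by simp; rfl⟩
  · have h1 := c.counit m
    rw [hv] at h1
    rw [← h1]
    simp only [map_sum, LinearMap.lTensor_tmul, TensorProduct.rid_tmul]
    exact sum_mem fun j hj ↦ Submodule.smul_mem _ _ (Submodule.subset_span ⟨⟨j, hj⟩, rfl⟩)

lemma IsStable.sup {c : Coaction k H M} {V W : Submodule k M} (hV : c.IsStable V)
    (hW : c.IsStable W) : c.IsStable (V ⊔ W) := by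
  have mono {U U' : Submodule k M} (h : U ≤ U') :
      LinearMap.range (U.subtype.rTensor H) ≤ LinearMap.range (U'.subtype.rTensor H) := by
    rintro _ ⟨z, rfl⟩
    exact ⟨(Submodule.inclusion h).rTensor H z, by rw [← LinearMap.rTensor_comp_apply]; rfl⟩
  intro x hx
  obtain ⟨v, hv, w, hw, rfl⟩ := Submodule.mem_sup.mp hx
  rw [map_add]
  exact add_mem (mono le_sup_left (hV v hv)) (mono le_sup_right (hW w hw))

/-- Every finite-dimensional subspace is contained in a finite-dimensional stable one. -/
lemma exists_finite_stable_ge (V : Submodule k M) [Module.Finite k V] :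
    ∃ W : Submodule k M, Module.Finite k W ∧ c.IsStable W ∧ V ≤ W := by
  obtain ⟨s, hs⟩ := Module.Finite.iff_fg.mp ‹Module.Finite k V›
  rw [← hs]
  clear hs
  induction s using Finset.cons_induction with
  | empty => exact ⟨⊥, inferInstance, fun w hw ↦ by simp [(Submodule.mem_bot k).mp hw], by simp⟩
  | cons a s _ ih =>
    obtain ⟨W, h1, h2, h3⟩ := ih
    obtain ⟨W', h1', h2', h3'⟩ := c.exists_finite_stable a
    refine ⟨W' ⊔ W, inferInstance, h2'.sup h2, ?_⟩
    rw [Finset.coe_cons, Submodule.span_insert]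
    exact sup_le_sup (by simpa using h3') h3

/-- The range of `W ⊗ C` in `M ⊗ N`, for subspaces `W` of `M` and `C` of `N`. -/
abbrev tensorRange (W : Submodule k M) (C : Submodule k N) : Submodule k (M ⊗[k] N) :=
  LinearMap.range (TensorProduct.map W.subtype C.subtype)

lemma IsStable.tensor {c : Coaction k H M} {d : Coaction k H N} {W : Submodule k M}
    (hW : c.IsStable W) {C : Submodule k N} (hC : d.IsStable C) :
    (c.tensor d).IsStable (tensorRange W C) := by
  rintro _ ⟨z, rfl⟩
  induction z with
  | zero => simp
  | add x y hx hy => simp only [map_add]; exact add_mem hx hy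
  | tmul w e =>
    obtain ⟨x, hx⟩ := hW w w.2
    obtain ⟨y, hy⟩ := hC e e.2
    simp only [map_tmul, Submodule.subtype_apply, tensor_coact_tmul]
    rw [← hx, ← hy, ← rTensor_pairing]
    refine ⟨(TensorProduct.map W.subtype C.subtype).rangeRestrict.rTensor H
      (pairing W C H x y), ?_⟩
    rw [← LinearMap.rTensor_comp_apply]
    rfl

/-- The coaction of an element is an invariant of `M ⊗ leftRegular`: the map `g ↦ g m` is
equivariant. -/
lemma isInvariant_coact (m : M) : (c.tensor (leftRegular k H)).IsInvariant (c.coact m) := by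
  let S : H →ₗ[k] H := HopfAlgebra.antipode k
  let Φ : M ⊗[k] (H ⊗[k] H) →ₗ[k] (M ⊗[k] H) ⊗[k] H :=
    TensorProduct.lift ((pairing M H H).compl₂ (leftRegular k H).coact) ∘ₗ
      (TensorProduct.assoc k M H H).symm.toLinearMap
  have h1 (z : M ⊗[k] H) : (c.tensor (leftRegular k H)).coact z =
      Φ (TensorProduct.assoc k M H H (c.coact.rTensor H z)) := by
    induction z with
    | zero => simp
    | add x y hx hy => simp only [map_add, hx, hy]
    | tmul m h => simp [Φ]
  let g : H ⊗[k] (H ⊗[k] H) →ₗ[k] H ⊗[k] H :=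
    (LinearMap.mul' k H ∘ₗ S.lTensor H).lTensor H ∘ₗ
      (TensorProduct.comm k (H ⊗[k] H) H).toLinearMap ∘ₗ
      (TensorProduct.assoc k H H H).symm.toLinearMap
  let Ψ : H ⊗[k] H →ₗ[k] H ⊗[k] H := g ∘ₗ (Coalgebra.comul : H →ₗ[k] H ⊗[k] H).lTensor H
  have h2 (h : H) : Ψ (Coalgebra.comul h) = h ⊗ₜ 1 := by
    have : Ψ (Coalgebra.comul h) = g (TensorProduct.assoc k H H H
        ((Coalgebra.comul : H →ₗ[k] H ⊗[k] H).rTensor H (Coalgebra.comul h))) := by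
      rw [Coalgebra.coassoc_apply]; rfl
    rw [this]
    have h3 (z : H ⊗[k] H) : g (TensorProduct.assoc k H H H
        ((Coalgebra.comul : H →ₗ[k] H ⊗[k] H).rTensor H z)) =
        (TensorProduct.lid k H ((Coalgebra.counit : H →ₗ[k] k).rTensor H z)) ⊗ₜ 1 := by
      induction z with
      | zero => simp
      | add x y hx hy => simp only [map_add, hx, hy, add_tmul]
      | tmul a b =>
        simp only [LinearMap.rTensor_tmul, g, LinearMap.comp_apply, LinearEquiv.coe_coe,
          LinearEquiv.symm_apply_apply, TensorProduct.comm_tmul, LinearMap.lTensor_tmul, S,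
          HopfAlgebra.mul_antipode_lTensor_comul_apply, TensorProduct.lid_tmul]
        rw [Algebra.algebraMap_eq_smul_one, tmul_smul, smul_tmul']
    rw [h3]
    simp
  have h4 (z : M ⊗[k] H) : Φ ((Coalgebra.comul : H →ₗ[k] H ⊗[k] H).lTensor M z) = z ⊗ₜ 1 := by
    induction z with
    | zero => simp
    | add x y hx hy => simp only [map_add, hx, hy, add_tmul]
    | tmul m h =>
      have h5 (w : H ⊗[k] H) : Φ (m ⊗ₜ w) = (TensorProduct.assoc k M H H).symm (m ⊗ₜ Ψ w) := by
        induction w with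
        | zero => simp
        | add x y hx hy => simp only [map_add, hx, hy, tmul_add]
        | tmul a b =>
          simp only [Φ, Ψ, g, LinearMap.comp_apply, LinearEquiv.coe_coe, assoc_symm_tmul,
            LinearMap.lTensor_tmul, lift.tmul, LinearMap.compl₂_apply, leftRegular_coact]
          generalize (Coalgebra.comul b : H ⊗[k] H) = w
          induction w with
          | zero => simp
          | add x y hx hy => simp only [map_add, hx, hy, tmul_add]
          | tmul c d => simp [S]
      rw [LinearMap.lTensor_tmul, h5, h2, assoc_symm_tmul]
  rw [IsInvariant, h1, c.coassoc, h4]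

/-- An invariant of `M ⊗ leftRegular` is the coaction of its value at the identity. -/
lemma IsInvariant.eq_coact {z : M ⊗[k] H} (hz : (c.tensor (leftRegular k H)).IsInvariant z) :
    c.coact (TensorProduct.rid k M ((Coalgebra.counit : H →ₗ[k] k).lTensor M z)) = z := by
  let S : H →ₗ[k] H := HopfAlgebra.antipode k
  let E : (M ⊗[k] H) ⊗[k] H →ₗ[k] M ⊗[k] H :=
    (LinearMap.mul' k H).lTensor M ∘ₗ (TensorProduct.assoc k M H H).toLinearMap
  have h1 (z : M ⊗[k] H) : E ((c.tensor (leftRegular k H)).coact z) =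
      c.coact (TensorProduct.rid k M ((Coalgebra.counit : H →ₗ[k] k).lTensor M z)) := by
    induction z with
    | zero => simp
    | add x y hx hy => simp only [map_add, hx, hy]
    | tmul m h =>
      simp only [tensor_coact_tmul, LinearMap.lTensor_tmul, TensorProduct.rid_tmul, map_smul]
      generalize c.coact m = u
      induction u with
      | zero => simp
      | add x y hx hy => simp only [map_add, LinearMap.add_apply, hx, hy, smul_add]
      | tmul m a =>
        have h2 (w : H ⊗[k] H) :
            E (pairing M H H (m ⊗ₜ a) (S.lTensor H (TensorProduct.comm k H H w))) =
            m ⊗ₜ (a * LinearMap.mul' k H (S.rTensor H w)) := by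
          induction w with
          | zero => simp
          | add x y hx hy => simp only [map_add, hx, hy, mul_add, tmul_add]
          | tmul c d =>
            simp [E]
            congr 1
            ring
        rw [leftRegular_coact, h2, HopfAlgebra.mul_antipode_rTensor_comul_apply,
          Algebra.algebraMap_eq_smul_one, mul_smul_comm, mul_one, tmul_smul]
  have h3 (z : M ⊗[k] H) : E (z ⊗ₜ 1) = z := by
    induction z with
    | zero => simp
    | add x y hx hy => simp only [add_tmul, map_add, hx, hy]
    | tmul m h => simp [E]
  rw [← h1, hz, h3]

/-- The elements `m` of `M` whose matrix coefficients lie in the subspace `C` of `H`, i.e. whose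
coaction lies in `M ⊗ C`. For `C` a stable subspace of the left regular representation this is
the space of invariants of `M ⊗ C`. -/
def isotypic (C : Submodule k H) : Submodule k M :=
  (tensorRange ⊤ C).comap c.coact

lemma mem_tensorRange_top {C : Submodule k H} {z : M ⊗[k] H} :
    z ∈ tensorRange (⊤ : Submodule k M) C ↔ z ∈ LinearMap.range (C.subtype.lTensor M) := by
  constructor
  · rintro ⟨y, rfl⟩
    refine ⟨(⊤ : Submodule k M).subtype.rTensor C y, ?_⟩
    rw [← LinearMap.comp_apply, LinearMap.lTensor_comp_rTensor]
  · rintro ⟨y, rfl⟩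
    refine ⟨(LinearMap.id.codRestrict ⊤ fun _ ↦ Submodule.mem_top).rTensor C y, ?_⟩
    rw [LinearMap.rTensor, ← LinearMap.comp_apply, ← TensorProduct.map_comp]
    rfl

lemma mem_isotypic {C : Submodule k H} {m : M} :
    m ∈ c.isotypic C ↔ c.coact m ∈ LinearMap.range (C.subtype.lTensor M) :=
  mem_tensorRange_top

/-- Representations are locally finite: every element lies in the isotypic part of a
finite-dimensional stable space of functions on `G`. -/
lemma exists_mem_isotypic (m : M) : ∃ C : Submodule k H, Module.Finite k C ∧
    (leftRegular k H).IsStable C ∧ m ∈ c.isotypic C := by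
  obtain ⟨D, hD, h⟩ := TensorProduct.exists_finite_submodule_right_of_setFinite {c.coact m}
    (Set.finite_singleton _)
  obtain ⟨C, h1, h2, h3⟩ := (leftRegular k H).exists_finite_stable_ge D
  refine ⟨C, h1, h2, c.mem_isotypic.mpr ?_⟩
  obtain ⟨z, hz⟩ := h (Set.mem_singleton _)
  refine ⟨(Submodule.inclusion h3).lTensor M z, ?_⟩
  rw [← hz, ← LinearMap.lTensor_comp_apply]
  rfl

variable {c d}

lemma isotypic_mono {C D : Submodule k H} (h : C ≤ D) : c.isotypic C ≤ c.isotypic D := by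
  intro m hm
  rw [mem_isotypic] at hm ⊢
  obtain ⟨z, hz⟩ := hm
  exact ⟨(Submodule.inclusion h).lTensor M z, by rw [← hz, ← LinearMap.lTensor_comp_apply]; rfl⟩

lemma IsHom.map_mem_isotypic {f : M →ₗ[k] N} (hf : c.IsHom d f) {C : Submodule k H} {m : M}
    (hm : m ∈ c.isotypic C) : f m ∈ d.isotypic C := by
  rw [mem_isotypic] at hm ⊢
  obtain ⟨z, hz⟩ := hm
  refine ⟨f.rTensor C z, ?_⟩
  rw [hf, ← hz, ← LinearMap.comp_apply, LinearMap.lTensor_comp_rTensor, ← LinearMap.comp_apply,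
    LinearMap.rTensor_comp_lTensor]

lemma IsStable.coact_mem_tensorRange {W : Submodule k M} (hW : c.IsStable W)
    {C : Submodule k H} {m : M} (hm : m ∈ W) (hmC : m ∈ c.isotypic C) :
    c.coact m ∈ tensorRange W C := by
  obtain ⟨p, hp⟩ := C.subtype.exists_leftInverse_of_injective (by simp)
  obtain ⟨y, hy⟩ := hW m hm
  obtain ⟨z, hz⟩ := c.mem_isotypic.mp hmC
  refine ⟨p.lTensor W y, ?_⟩
  have h1 : TensorProduct.map W.subtype C.subtype (p.lTensor W y) =
      C.subtype.lTensor M (p.lTensor M (W.subtype.rTensor H y)) := by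
    generalize y = y
    induction y with
    | zero => simp
    | add x y hx hy => simp only [map_add, hx, hy]
    | tmul a b => simp
  have h2 : p.lTensor M (C.subtype.lTensor M z) = z := by
    rw [← LinearMap.lTensor_comp_apply, hp, LinearMap.lTensor_id, LinearMap.id_apply]
  rw [h1, hy, ← hz, h2]

lemma isHom_id (c : Coaction k H M) : c.IsHom c LinearMap.id := fun _ ↦ by simp

/-- For a finite-dimensional stable `C`, the functor `M ↦ M.isotypic C` is exact if taking
invariants is. -/
lemma ExactInvariants.exists_mem_isotypic {M N : Type u} [AddCommGroup M] [AddCommGroup N]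
    [Module k M] [Module k N] {c : Coaction k H M} {d : Coaction k H N}
    (hH : ExactInvariants k H) {f : M →ₗ[k] N} (hf : c.IsHom d f)
    {W : Submodule k M} (hW : c.IsStable W) {C : Submodule k H}
    (hC : (leftRegular k H).IsStable C) {n : N} (hn : n ∈ d.isotypic C) (hnW : n ∈ W.map f) :
    ∃ w ∈ W, w ∈ c.isotypic C ∧ f w = n := by
  have hmem : d.coact n ∈ (tensorRange W C).map (TensorProduct.map f LinearMap.id) := by
    obtain ⟨y, hy⟩ := (hf.isStable_map hW).coact_mem_tensorRange hnW hn
    obtain ⟨y, rfl⟩ := LinearMap.rTensor_surjective C (f.submoduleMap_surjective W) y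
    refine ⟨_, ⟨y, rfl⟩, ?_⟩
    rw [← hy]
    generalize y = y
    induction y with
    | zero => simp
    | add x y hx hy => simp only [map_add, hx, hy]
    | tmul a b => simp
  obtain ⟨z, hz, hz', hzn⟩ := hH.exists_mem (f := TensorProduct.map f LinearMap.id)
    (hf.tensor (leftRegular k H).isHom_id) (hW.tensor hC) (d.isInvariant_coact n) hmem
  refine ⟨TensorProduct.rid k M ((Coalgebra.counit : H →ₗ[k] k).lTensor M z), ?_, ?_, ?_⟩
  · obtain ⟨y, rfl⟩ := hz
    generalize y = y
    induction y with
    | zero => simp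
    | add x y hx hy => simp only [map_add]; exact add_mem hx hy
    | tmul a b => simpa using W.smul_mem _ a.2
  · rw [mem_isotypic, hz'.eq_coact]
    obtain ⟨y, rfl⟩ := hz
    refine ⟨W.subtype.rTensor C y, ?_⟩
    rw [← LinearMap.comp_apply, LinearMap.lTensor_comp_rTensor]
  · rw [← d.counit n, ← hzn]
    generalize z = z
    induction z with
    | zero => simp
    | add x y hx hy => simp only [map_add, hx, hy]
    | tmul a b => simp

end Coaction
end Antipode

/-! ### Finiteness over the ring of invariants -/

section Slice

variable {k H : Type*} [Field k] [AddCommGroup H] [Module k H]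
variable {M N : Type*} [AddCommGroup M] [Module k M] [AddCommGroup N] [Module k N]

/-- The contraction `M ⊗ H → M` with a linear functional on a vector space `H`. -/
def slice (M : Type*) [AddCommGroup M] [Module k M] (φ : H →ₗ[k] k) : M ⊗[k] H →ₗ[k] M :=
  (TensorProduct.rid k M).toLinearMap ∘ₗ φ.lTensor M

@[simp]
lemma slice_tmul (φ : H →ₗ[k] k) (m : M) (h : H) : slice M φ (m ⊗ₜ h) = φ h • m := by
  simp [slice]

lemma slice_rTensor (φ : H →ₗ[k] k) (f : M →ₗ[k] N) (z : M ⊗[k] H) :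
    slice N φ (f.rTensor H z) = f (slice M φ z) := by
  induction z with
  | zero => simp
  | add x y hx hy => simp only [map_add, hx, hy]
  | tmul m h => simp

/-- An element of `M ⊗ H` is a sum of contractions of it, tensored with basis vectors. -/
lemma exists_eq_sum_slice (z : M ⊗[k] H) : ∃ (s : Finset (Module.Basis.ofVectorSpaceIndex k H)),
    z = ∑ i ∈ s, slice M ((Module.Basis.ofVectorSpace k H).coord i) z ⊗ₜ
      (Module.Basis.ofVectorSpace k H) i := by
  classical
  set b := Module.Basis.ofVectorSpace k H
  let e := TensorProduct.equivFinsuppOfBasisRight (M := M) b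
  have h (i) (z : M ⊗[k] H) : e z i = slice M (b.coord i) z := by
    induction z with
    | zero => simp
    | add x y hx hy => simp only [map_add, Finsupp.add_apply, hx, hy]
    | tmul m h => simp [e]
  refine ⟨(e z).support, ?_⟩
  nth_rewrite 1 [← e.symm_apply_apply z]
  rw [TensorProduct.equivFinsuppOfBasisRight_symm_apply]
  simp only [← h]
  rfl

lemma ext_slice {z w : M ⊗[k] H} (h : ∀ φ : H →ₗ[k] k, slice M φ z = slice M φ w) : z = w := by
  rw [← sub_eq_zero]
  obtain ⟨s, hs⟩ := exists_eq_sum_slice (z - w)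
  rw [hs]
  simp [h]

lemma mem_range_rTensor_iff {W : Submodule k M} {z : M ⊗[k] H} :
    z ∈ LinearMap.range (W.subtype.rTensor H) ↔ ∀ φ : H →ₗ[k] k, slice M φ z ∈ W := by
  constructor
  · rintro ⟨y, rfl⟩ φ
    rw [slice_rTensor]
    exact (slice W φ y).2
  · intro h
    obtain ⟨s, hs⟩ := exists_eq_sum_slice z
    rw [hs]
    exact sum_mem fun i _ ↦
      ⟨⟨_, h ((Module.Basis.ofVectorSpace k H).coord i)⟩ ⊗ₜ (Module.Basis.ofVectorSpace k H) i,
        by simp⟩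

end Slice

section Equivariant

variable {k H A : Type u} [Field k] [CommRing H] [HopfAlgebra k H] [CommRing A] [Algebra k A]

namespace Coaction

variable {M N : Type*} [AddCommGroup M] [Module k M] [AddCommGroup N] [Module k N]

lemma isStable_iff {c : Coaction k H M} {W : Submodule k M} :
    c.IsStable W ↔ ∀ φ : H →ₗ[k] k, ∀ w ∈ W, slice M φ (c.coact w) ∈ W :=
  ⟨fun h φ w hw ↦ mem_range_rTensor_iff.mp (h w hw) φ,
    fun h w hw ↦ mem_range_rTensor_iff.mpr fun φ ↦ h φ w hw⟩

lemma slice_counit_coact (c : Coaction k H M) (m : M) :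
    slice M Coalgebra.counit (c.coact m) = m := c.counit m

end Coaction

lemma slice_tensorAct {M : Type*} [AddCommGroup M] [Module k M] [Module A M] [IsScalarTower k A M]
    (φ : H →ₗ[k] k) (z : A ⊗[k] H) (m : M) :
    slice M φ (tensorAct k A H M H z (m ⊗ₜ 1)) = slice A φ z • m := by
  induction z with
  | zero => simp
  | add x y hx hy => simp only [map_add, LinearMap.add_apply, hx, hy, add_smul]
  | tmul a h => simp

lemma tensorAct_tmul_one {M : Type*} [AddCommGroup M] [Module k M] [Module A M]
    [IsScalarTower k A M] (a : A) (z : M ⊗[k] H) :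
    tensorAct k A H M H (a ⊗ₜ 1) z = a • z := by
  induction z with
  | zero => simp
  | add x y hx hy => simp only [map_add, smul_add, hx, hy]
  | tmul m h => simp [smul_tmul']

/-- The coordinate ring of a `G`-scheme as a representation of `G`. -/
def GAction.toCoaction (σ : GAction k H A) : Coaction k H A where
  coact := σ.coact.toLinearMap
  coassoc a := DFunLike.congr_fun σ.coassoc a
  counit a := DFunLike.congr_fun σ.counit a

namespace Coaction

variable (σ : GAction k H A)
variable {M N : Type*} [AddCommGroup M] [Module k M] [Module A M] [IsScalarTower k A M]
  [AddCommGroup N] [Module k N] [Module A N] [IsScalarTower k A N]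

/-- A coaction on an `A`-module `M` is equivariant if the scalar multiplication `A × M → M`
commutes with the actions of `G`; such an `M` is a quasi-coherent module on `[Spec A / G]`. -/
def IsEquivariant (c : Coaction k H M) : Prop :=
  ∀ (a : A) (m : M), c.coact (a • m) = tensorAct k A H M H (σ.coact a) (c.coact m)

variable {σ} {c : Coaction k H M} {d : Coaction k H N}

lemma _root_.GAction.isEquivariant_toCoaction (σ : GAction k H A) :
    σ.toCoaction.IsEquivariant σ := fun a b ↦ by
  change σ.coact (a * b) = tensorAct k A H A H (σ.coact a) (σ.coact b)
  rw [map_mul]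
  generalize σ.coact a = x
  generalize σ.coact b = y
  induction x with
  | zero => simp
  | add x x' hx hx' => simp only [map_add, add_mul, LinearMap.add_apply, hx, hx']
  | tmul m a =>
    induction y with
    | zero => simp
    | add y y' hy hy' => simp only [map_add, mul_add, hy, hy']
    | tmul n b => simp

lemma IsEquivariant.coact_smul_of_mem (hc : c.IsEquivariant σ) {a : A} (ha : a ∈ σ.invariants)
    (m : M) : c.coact (a • m) = a • c.coact m := by
  have : σ.coact a = a ⊗ₜ 1 := ha
  rw [hc, this, tensorAct_tmul_one]

lemma IsEquivariant.tensor {N : Type*} [AddCommGroup N] [Module k N] (hc : c.IsEquivariant σ)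
    (d : Coaction k H N) : (c.tensor d).IsEquivariant σ := by
  intro a z
  induction z with
  | zero => simp
  | add x y hx hy => simp only [map_add, smul_add, hx, hy]
  | tmul m n =>
    rw [smul_tmul', tensor_coact_tmul, tensor_coact_tmul, hc]
    generalize σ.coact a = x
    generalize c.coact m = y
    generalize d.coact n = z
    induction x with
    | zero => simp
    | add x x' hx hx' => simp only [map_add, LinearMap.add_apply, hx, hx']
    | tmul a h =>
      induction y with
      | zero => simp
      | add y y' hy hy' => simp only [map_add, LinearMap.add_apply, hy, hy']
      | tmul m h =>
        induction z with
        | zero => simp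
        | add y y' hy hy' => simp only [map_add, hy, hy']
        | tmul n h => simp [smul_tmul', mul_assoc]

lemma IsHom.isInvariant {M N : Type*} [AddCommGroup M] [Module k M] [AddCommGroup N] [Module k N]
    {c : Coaction k H M} {d : Coaction k H N} {f : M →ₗ[k] N} (hf : c.IsHom d f) {m : M}
    (hm : c.IsInvariant m) : d.IsInvariant (f m) := by
  rw [IsInvariant, hf, hm, LinearMap.rTensor_tmul]

variable (c) in
/-- The invariants in an equivariant module, as a module over the ring of invariants. -/
def invariantsIn (hc : c.IsEquivariant σ) (W : Submodule A M) : Submodule σ.invariants M where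
  carrier := {m | c.IsInvariant m ∧ m ∈ W}
  add_mem' {m n} hm hn :=
    ⟨by rw [IsInvariant, map_add, hm.1, hn.1, add_tmul], W.add_mem hm.2 hn.2⟩
  zero_mem' := ⟨by simp [IsInvariant], W.zero_mem⟩
  smul_mem' a m hm := ⟨by
    change c.coact ((a : A) • m) = ((a : A) • m) ⊗ₜ 1
    rw [hc.coact_smul_of_mem a.2, hm.1, smul_tmul'], W.smul_mem (a : A) hm.2⟩

/-- If taking invariants is exact, then an `A^G`-submodule `N` of the invariants of `M` is
recovered from the `A`-submodule it generates. -/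
lemma ExactInvariants.mem_of_mem_span (hH : ExactInvariants k H) {M : Type u} [AddCommGroup M]
    [Module k M] [Module A M] [IsScalarTower k A M] {c : Coaction k H M}
    (hc : c.IsEquivariant σ) (N : Submodule σ.invariants M) (hN : ∀ n ∈ N, c.IsInvariant n)
    {y : M} (hy : c.IsInvariant y) (hyN : y ∈ Submodule.span A (N : Set M)) : y ∈ N := by
  let N' : Submodule k M := N.restrictScalars k
  -- the equivariant map `A ⊗ N → M`, for the trivial action on `N`
  let f : A ⊗[k] N' →ₗ[k] M :=
    TensorProduct.lift ((Algebra.lsmul k k M).toLinearMap.compl₂ N'.subtype)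
  have hf : (σ.toCoaction.tensor (Coaction.trivial k H N')).IsHom c f := by
    intro z
    induction z with
    | zero => simp
    | add x y hx hy => simp only [map_add, hx, hy]
    | tmul a n =>
      change c.coact (a • (n : M)) = f.rTensor H (pairing A N' H (σ.coact a) (n ⊗ₜ 1))
      rw [hc, hN n n.2]
      generalize σ.coact a = x
      induction x with
      | zero => simp
      | add x x' hx hx' => simp only [map_add, LinearMap.add_apply, hx, hx']
      | tmul a h => simp [f]
  have hfA (a : A) (z : A ⊗[k] N') : f (a • z) = a • f z := by
    induction z with
    | zero => simp
    | add x y hx hy => simp only [map_add, smul_add, hx, hy]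
    | tmul b n => simp [f, smul_tmul']
  have hyf : y ∈ (⊤ : Submodule k (A ⊗[k] N')).map f := by
    clear hy
    induction hyN using Submodule.span_induction with
    | zero => exact zero_mem _
    | add x y _ _ hx hy => exact add_mem hx hy
    | smul a x _ hx =>
      obtain ⟨z, -, rfl⟩ := hx
      exact ⟨a • z, Submodule.mem_top, hfA a z⟩
    | mem x hx => exact ⟨1 ⊗ₜ ⟨x, hx⟩, Submodule.mem_top, by simp [f]⟩
  obtain ⟨z, -, hz, rfl⟩ := hH.exists_mem hf (fun w _ ↦
    mem_range_rTensor_iff.mpr fun _ ↦ Submodule.mem_top) hy hyf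
  -- the coefficients of an invariant `z` with respect to a basis of `N` are invariants of `A`
  have hsl (φ : N' →ₗ[k] k) : slice A φ z ∈ σ.invariants := by
    have : (σ.toCoaction.tensor (Coaction.trivial k H N')).IsHom σ.toCoaction (slice A φ) := by
      intro z
      induction z with
      | zero => simp
      | add x y hx hy => simp only [map_add, hx, hy]
      | tmul a n =>
        rw [slice_tmul, map_smul]
        change φ n • σ.coact a = (slice A φ).rTensor H (pairing A N' H (σ.coact a) (n ⊗ₜ 1))
        generalize σ.coact a = x
        induction x with
        | zero => simp
        | add x x' hx hx' => simp only [map_add, LinearMap.add_apply, smul_add, hx, hx']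
        | tmul a h => simp [smul_tmul']
    exact this.isInvariant hz
  obtain ⟨s, hs⟩ := exists_eq_sum_slice z
  rw [hs, map_sum]
  refine sum_mem fun i _ ↦ ?_
  have := N.smul_mem ⟨_, hsl ((Module.Basis.ofVectorSpace k N').coord i)⟩
    ((Module.Basis.ofVectorSpace k N') i).2
  simpa [f] using! this

/-- If taking invariants is exact, the invariants in a noetherian module are noetherian. -/
lemma ExactInvariants.isNoetherian_invariantsIn (hH : ExactInvariants k H) {M : Type u}
    [AddCommGroup M] [Module k M] [Module A M] [IsScalarTower k A M] {c : Coaction k H M}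
    (hc : c.IsEquivariant σ) (W : Submodule A M) [IsNoetherian A W] :
    IsNoetherian σ.invariants (c.invariantsIn hc W) := by
  let g (N : Submodule σ.invariants (c.invariantsIn hc W)) : Submodule A W :=
    (Submodule.span A (N.map (c.invariantsIn hc W).subtype : Set M)).comap W.subtype
  have hg (N) (n : c.invariantsIn hc W) : (⟨n, n.2.2⟩ : W) ∈ g N ↔ n ∈ N := by
    constructor
    · intro h
      have := hH.mem_of_mem_span hc (N.map (c.invariantsIn hc W).subtype) (by
        rintro _ ⟨n, -, rfl⟩
        exact n.2.1) n.2.1 h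
      obtain ⟨m, hm, hmn⟩ := this
      rwa [← Subtype.ext hmn]
    · intro h
      exact Submodule.subset_span ⟨n, h, rfl⟩
  have hmono : StrictMono g := by
    refine Monotone.strictMono_of_injective (fun N N' h ↦ ?_) fun N N' h ↦ ?_
    · exact Submodule.comap_mono (Submodule.span_mono (Set.image_mono h))
    · ext n
      rw [← hg N n, h, hg]
  rw [isNoetherian_iff']
  exact hmono.wellFoundedGT

variable (c) in
/-- The elements of an equivariant submodule `W` whose matrix coefficients lie in `C`, as a module
over the ring of invariants. -/
def isotypicIn (hc : c.IsEquivariant σ) (W : Submodule A M) (C : Submodule k H) :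
    Submodule σ.invariants M where
  carrier := {m | m ∈ c.isotypic C ∧ m ∈ W}
  add_mem' {m n} hm hn := ⟨add_mem hm.1 hn.1, add_mem hm.2 hn.2⟩
  zero_mem' := ⟨zero_mem _, zero_mem _⟩
  smul_mem' a m hm := ⟨by
    obtain ⟨z, hz⟩ := c.mem_isotypic.mp hm.1
    rw [mem_isotypic]
    change c.coact ((a : A) • m) ∈ _
    refine ⟨(a : A) • z, ?_⟩
    rw [hc.coact_smul_of_mem a.2, ← hz]
    generalize z = z
    induction z with
    | zero => simp
    | add x y hx hy => simp only [map_add, smul_add, hx, hy]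
    | tmul m h => simp [smul_tmul'], W.smul_mem (a : A) hm.2⟩

/-- The coaction embeds the isotypic part into the invariants of the noetherian `A`-module
`W ⊗ C`. -/
lemma ExactInvariants.isNoetherian_isotypicIn [IsNoetherianRing A] (hH : ExactInvariants k H)
    {M : Type u} [AddCommGroup M] [Module k M] [Module A M] [IsScalarTower k A M]
    {c : Coaction k H M} (hc : c.IsEquivariant σ) (W : Submodule A M) [Module.Finite A W]
    (hW : c.IsStable (W.restrictScalars k)) (C : Submodule k H) [Module.Finite k C] :
    IsNoetherian σ.invariants (c.isotypicIn hc W C) := by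
  let g : W ⊗[k] C →ₗ[A] M ⊗[k] H := TensorProduct.AlgebraTensorModule.map W.subtype C.subtype
  let V : Submodule A (M ⊗[k] H) := LinearMap.range g
  have : Module.Finite A (W ⊗[k] C) := Module.Finite.equiv
    (TensorProduct.AlgebraTensorModule.cancelBaseChange k A A W C)
  have : IsNoetherian A V := inferInstance
  have := hH.isNoetherian_invariantsIn (hc.tensor (leftRegular k H)) V
  let e : c.isotypicIn hc W C →ₗ[σ.invariants] (c.tensor (leftRegular k H)).invariantsIn
      (hc.tensor (leftRegular k H)) V :=
    { toFun := fun m ↦ ⟨c.coact m, c.isInvariant_coact m, by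
        obtain ⟨z, hz⟩ := hW.coact_mem_tensorRange m.2.2 m.2.1
        exact ⟨z, hz⟩⟩
      map_add' := fun m n ↦ Subtype.ext (map_add c.coact (m : M) n)
      map_smul' := fun a m ↦ Subtype.ext (hc.coact_smul_of_mem a.2 m) }
  refine isNoetherian_of_injective e fun m n h ↦ Subtype.ext ?_
  have h' : c.coact m = c.coact n := congrArg Subtype.val h
  rw [← c.counit m, h', c.counit]

end Coaction
end Equivariant

/-! ### Linear compactness over complete local rings -/

section LinearlyCompact

variable {R : Type*} [CommRing R]

/-- Finite modules over a complete ring are complete. -/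
lemma isPrecomplete_of_finite (I : Ideal R) [IsPrecomplete I R] (Q : Type*) [AddCommGroup Q]
    [Module R Q] [Module.Finite R Q] : IsPrecomplete I Q := by
  rw [← AdicCompletion.of_surjective_iff]
  intro y
  obtain ⟨z, rfl⟩ := AdicCompletion.ofTensorProduct_surjective_of_finite I Q y
  induction z with
  | zero => exact ⟨0, by simp⟩
  | add x y hx hy =>
    obtain ⟨a, ha⟩ := hx
    obtain ⟨b, hb⟩ := hy
    exact ⟨a + b, by rw [map_add, map_add, ha, hb]⟩
  | tmul r q =>
    obtain ⟨r, rfl⟩ := AdicCompletion.of_surjective I R r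
    refine ⟨r • q, ?_⟩
    rw [AdicCompletion.ofTensorProduct_tmul]
    ext n
    rfl

variable [IsLocalRing R] [IsNoetherianRing R]

open IsLocalRing

lemma isArtinianRing_quotient_maximalIdeal_pow (n : ℕ) :
    IsArtinianRing (R ⧸ maximalIdeal R ^ n) := by
  have : Ring.KrullDimLE 0 (R ⧸ maximalIdeal R ^ n) :=
    Ring.krullDimLE_zero_iff.mpr fun J prime ↦ by
      have h1 : maximalIdeal R ≤ J.comap (Ideal.Quotient.mk _) := by
        have := prime.comap (Ideal.Quotient.mk (maximalIdeal R ^ n))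
        refine this.le_of_pow_le (n := n) fun r hr ↦ ?_
        rw [Ideal.mem_comap, Ideal.Quotient.eq_zero_iff_mem.mpr hr]
        exact zero_mem _
      rw [← Ideal.map_comap_of_surjective _ Ideal.Quotient.mk_surjective J,
        ← (maximalIdeal.isMaximal R).eq_of_le (Ideal.IsPrime.ne_top (prime.comap _)) h1]
      refine (Ideal.map_eq_top_or_isMaximal_of_surjective _ Ideal.Quotient.mk_surjective
        (maximalIdeal.isMaximal R)).resolve_left fun h ↦ prime.ne_top (top_le_iff.mp ?_)
      rw [← h]
      exact Ideal.map_le_iff_le_comap.mpr h1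
  exact IsNoetherianRing.isArtinianRing_of_krullDimLE_zero

/-- Linear compactness of noetherian modules over a complete local ring: for a decreasing
sequence of submodules `S n`, a sequence that is Cauchy for the `S n` has a limit. -/
lemma exists_forall_sub_mem [IsAdicComplete (maximalIdeal R) R] {Q : Type*} [AddCommGroup Q]
    [Module R Q] [Module.Finite R Q] {S : ℕ → Submodule R Q} (hS : Antitone S) {q : ℕ → Q}
    (hq : ∀ n, q (n + 1) - q n ∈ S n) : ∃ y, ∀ n, y - q n ∈ S n := by
  have := isPrecomplete_of_finite (maximalIdeal R) Q
  have hq' {m n} (h : m ≤ n) : q n - q m ∈ S m := by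
    induction n, h using Nat.le_induction with
    | base => simp
    | succ n hn ih =>
      rw [show q (n + 1) - q m = (q (n + 1) - q n) + (q n - q m) by abel]
      exact add_mem (hS hn (hq n)) ih
  let I (j : ℕ) : Submodule R Q := maximalIdeal R ^ j • ⊤
  -- modulo `𝔪 ^ j` the sequence `S` becomes stationary
  have hstab (j) : ∃ N, ∀ n, S N ≤ S n ⊔ I j := by
    have := isArtinianRing_quotient_maximalIdeal_pow (R := R) j
    have : IsArtinian R (Q ⧸ I j) :=
      isArtinian_of_surjective_algebraMap (R := R ⧸ maximalIdeal R ^ j) Ideal.Quotient.mk_surjective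
    obtain ⟨N, hN⟩ := IsArtinian.monotone_stabilizes
      ⟨fun n ↦ OrderDual.toDual ((S n).map (I j).mkQ), fun m n h ↦ Submodule.map_mono (hS h)⟩
    refine ⟨N, fun n x hx ↦ ?_⟩
    obtain h | h := le_total n N
    · exact Submodule.mem_sup_left (hS h hx)
    · have h1 : (S N).map (I j).mkQ = (S n).map (I j).mkQ := hN n h
      have h2 : (I j).mkQ x ∈ (S n).map (I j).mkQ := h1 ▸ Submodule.mem_map_of_mem hx
      rw [← Submodule.mem_comap, Submodule.comap_map_mkQ, sup_comm] at h2
      exact h2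
  obtain ⟨N, hNmono, hN⟩ : ∃ N : ℕ → ℕ, Monotone N ∧ ∀ j n, S (N j) ≤ S n ⊔ I j := by
    choose N hN using hstab
    refine ⟨fun j ↦ ∑ i ∈ Finset.range (j + 1), N i, fun i j h ↦ ?_, fun j n ↦ ?_⟩
    · exact Finset.sum_le_sum_of_subset (Finset.range_subset_range.mpr (by lia))
    · exact (hS (Finset.single_le_sum (f := N) (fun _ _ ↦ Nat.zero_le _)
        (Finset.self_mem_range_succ j))).trans (hN j n)
  -- approximations `t j` modulo `𝔪 ^ j` of the limit
  have step (j : ℕ) (t : {t // t - q (N j) ∈ S (N j)}) :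
      ∃ t' : {t // t - q (N (j + 1)) ∈ S (N (j + 1))}, (t' : Q) - t ∈ I j := by
    obtain ⟨s, hs, i, hi, hsi⟩ := Submodule.mem_sup.mp (hN j (N (j + 1))
      (sub_mem t.2 (hq' (hNmono (Nat.le_succ j)))))
    refine ⟨⟨q (N (j + 1)) + s, by simpa using hs⟩, ?_⟩
    rw [show q (N (j + 1)) + s - t = -i by
      rw [eq_neg_iff_add_eq_zero, sub_add_eq_add_sub, add_assoc, hsi]; abel]
    exact neg_mem hi
  choose next hnext using step
  let t (j : ℕ) : {t // t - q (N j) ∈ S (N j)} :=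
    Nat.rec (motive := fun j ↦ {t // t - q (N j) ∈ S (N j)}) ⟨q (N 0), by simp⟩ next j
  have ht {m n} (h : m ≤ n) : (t m).1 ≡ (t n).1 [SMOD I m] := by
    induction n, h using Nat.le_induction with
    | base => rfl
    | succ n hn ih =>
      refine ih.trans (SModEq.symm (SModEq.sub_mem.mpr ?_))
      exact Submodule.smul_mono_left (Ideal.pow_le_pow_right hn) (hnext n (t n))
  obtain ⟨y, hy⟩ := IsPrecomplete.prec ‹_› ht
  refine ⟨y, fun n ↦ ?_⟩
  have hmem (j) : y - q n ∈ S n ⊔ I j := by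
    rw [show y - q n = (y - (t j).1) + ((t j).1 - q (N j)) + (q (N j) - q n) by abel]
    refine add_mem (add_mem ?_ (hN j n (t j).2)) ?_
    · exact Submodule.mem_sup_right (SModEq.sub_mem.mp (hy j).symm)
    · obtain h | h := le_total n (N j)
      · exact Submodule.mem_sup_left (hq' h)
      · rw [← neg_sub]
        exact neg_mem (hN j n (hq' h))
  rw [← Submodule.Quotient.mk_eq_zero, ← Submodule.mem_bot R,
    ← Ideal.iInf_pow_smul_eq_bot_of_isLocalRing (maximalIdeal R) (Ideal.IsPrime.ne_top'),
    Submodule.mem_iInf]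
  intro j
  obtain ⟨s, hs, i, hi, h⟩ := Submodule.mem_sup.mp (hmem j)
  rw [← h, Submodule.Quotient.mk_add, (Submodule.Quotient.mk_eq_zero _).mpr hs, zero_add]
  have : (S n).mkQ i ∈ (I j).map (S n).mkQ := Submodule.mem_map_of_mem hi
  rwa [Submodule.map_smul'', Submodule.map_top, Submodule.range_mkQ] at this

end LinearlyCompact

/-! ### Stable submodules and separatedness -/

section StableSubmodules

variable {k H A : Type u} [Field k] [CommRing H] [HopfAlgebra k H] [CommRing A] [Algebra k A]
variable {σ : GAction k H A} {x : A →ₐ[k] k}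

namespace Coaction

variable {M N : Type*} [AddCommGroup M] [Module k M] [Module A M] [IsScalarTower k A M]
  [AddCommGroup N] [Module k N] [Module A N] [IsScalarTower k A N]
  {c : Coaction k H M} {d : Coaction k H N}

lemma isStable_top : c.IsStable ⊤ := isStable_iff.mpr fun _ _ _ ↦ Submodule.mem_top

lemma tensorAct_mem {I : Submodule k A} {W V : Submodule k M} (h : ∀ a ∈ I, ∀ w ∈ W, a • w ∈ V)
    {y : A ⊗[k] H} (hy : y ∈ LinearMap.range (I.subtype.rTensor H)) {z : M ⊗[k] H}
    (hz : z ∈ LinearMap.range (W.subtype.rTensor H)) :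
    tensorAct k A H M H y z ∈ LinearMap.range (V.subtype.rTensor H) := by
  obtain ⟨y, rfl⟩ := hy
  obtain ⟨z, rfl⟩ := hz
  induction y with
  | zero => simp
  | add y y' hy hy' => simp only [map_add, LinearMap.add_apply]; exact add_mem hy hy'
  | tmul a g =>
    induction z with
    | zero => simp
    | add z z' hz hz' => simp only [map_add]; exact add_mem hz hz'
    | tmul w g' => exact ⟨⟨(a : A) • (w : M), h a a.2 w w.2⟩ ⊗ₜ (g * g'), by simp⟩

lemma IsEquivariant.isStable_smul (hc : c.IsEquivariant σ) {I : Ideal A}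
    (hI : σ.toCoaction.IsStable (I.restrictScalars k)) {W : Submodule A M}
    (hW : c.IsStable (W.restrictScalars k)) : c.IsStable ((I • W).restrictScalars k) := by
  intro m hm
  rw [Submodule.restrictScalars_mem] at hm
  induction hm using Submodule.smul_induction_on' with
  | smul a ha w hw =>
    rw [hc]
    exact tensorAct_mem (I := I.restrictScalars k) (W := W.restrictScalars k)
      (V := (I • W).restrictScalars k) (fun a ha w hw ↦
        (Submodule.restrictScalars_mem k (I • W) (a • w)).mpr (Submodule.smul_mem_smul ha hw))
      (y := σ.coact a) (hI a ha) (hW w hw)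
  | add m _ n _ hm hn => rw [map_add]; exact add_mem hm hn

lemma isStable_pow {I : Ideal A} (hI : σ.toCoaction.IsStable (I.restrictScalars k)) (n : ℕ) :
    σ.toCoaction.IsStable ((I ^ n).restrictScalars k) := by
  induction n with
  | zero => rw [pow_zero, Ideal.one_eq_top, Submodule.restrictScalars_top]; exact isStable_top
  | succ n ih => rw [pow_succ]; exact σ.isEquivariant_toCoaction.isStable_smul ih hI

lemma IsEquivariant.isStable_span (hc : c.IsEquivariant σ) {V : Submodule k M}
    (hV : c.IsStable V) : c.IsStable ((Submodule.span A (V : Set M)).restrictScalars k) := by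
  intro m hm
  rw [Submodule.restrictScalars_mem, ← Submodule.top_smul (Submodule.span A (V : Set M))] at hm
  induction hm using Submodule.smul_induction_on' with
  | add m _ n _ hm hn => rw [map_add]; exact add_mem hm hn
  | smul a _ w hw =>
    induction hw using Submodule.span_induction generalizing a with
    | zero => simp
    | add x y _ _ hx hy =>
      rw [smul_add, map_add]
      exact add_mem (hx a ‹_›) (hy a ‹_›)
    | smul b x _ hx => rw [smul_smul]; exact hx (a * b) Submodule.mem_top
    | mem w hw =>
      rw [hc]
      refine tensorAct_mem (I := ⊤) (W := V)
        (V := (Submodule.span A (V : Set M)).restrictScalars k) (fun a _ w hw ↦ ?_)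
        (y := σ.coact a) (mem_range_rTensor_iff.mpr fun _ ↦ Submodule.mem_top) (hV w hw)
      exact Submodule.smul_mem _ _ (Submodule.subset_span hw)

lemma isHom_of_isFixed (hx : σ.IsFixed x) :
    σ.toCoaction.IsHom (Coaction.trivial k H k) x.toLinearMap := by
  intro a
  have h := DFunLike.congr_fun hx a
  rw [← (TensorProduct.lid k H).injective.eq_iff]
  refine Eq.trans ?_ h.symm
  change TensorProduct.lid k H (x a ⊗ₜ 1) = _
  simp [Algebra.algebraMap_eq_smul_one]

lemma isStable_ker (hx : σ.IsFixed x) :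
    σ.toCoaction.IsStable ((RingHom.ker x).restrictScalars k) := by
  rw [isStable_iff]
  intro φ a ha
  change x (slice A φ (σ.toCoaction.coact a)) = 0
  have := isHom_of_isFixed hx a
  rw [show x.toLinearMap a = 0 from ha, map_zero] at this
  rw [← AlgHom.toLinearMap_apply, ← slice_rTensor, ← this, map_zero]

/-- The annihilator of a stable submodule is stable. -/
lemma IsEquivariant.isStable_annihilator (hc : c.IsEquivariant σ) {W : Submodule A M}
    (hW : c.IsStable (W.restrictScalars k)) :
    σ.toCoaction.IsStable (W.annihilator.restrictScalars k) := by
  rw [isStable_iff]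
  intro φ a ha
  rw [Submodule.restrictScalars_mem, Submodule.mem_annihilator] at ha ⊢
  intro m hm
  change slice A φ (σ.coact a) • m = 0
  rw [← slice_tensorAct]
  suffices h : tensorAct k A H M H (σ.coact a) (m ⊗ₜ 1) = 0 by rw [h, map_zero]
  -- `m ⊗ 1` is a combination of elements `ρ(w) (1 ⊗ h)` with `w` in `W`
  let S : H →ₗ[k] H := HopfAlgebra.antipode k
  let E : (M ⊗[k] H) ⊗[k] H →ₗ[k] M ⊗[k] H :=
    (LinearMap.mul' k H ∘ₗ S.lTensor H).lTensor M ∘ₗ (TensorProduct.assoc k M H H).toLinearMap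
  have h1 (z : M ⊗[k] H) : (LinearMap.mul' k H ∘ₗ S.lTensor H).lTensor M
      ((Coalgebra.comul : H →ₗ[k] H ⊗[k] H).lTensor M z) =
      (TensorProduct.rid k M ((Coalgebra.counit : H →ₗ[k] k).lTensor M z)) ⊗ₜ 1 := by
    induction z with
    | zero => simp
    | add x y hx hy => simp only [map_add, hx, hy, add_tmul]
    | tmul m h =>
      simp only [LinearMap.lTensor_tmul, LinearMap.comp_apply, S,
        HopfAlgebra.mul_antipode_lTensor_comul_apply, TensorProduct.rid_tmul]
      rw [Algebra.algebraMap_eq_smul_one, tmul_smul, smul_tmul']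
  have h2 : m ⊗ₜ 1 = E (c.coact.rTensor H (c.coact m)) := by
    simp only [E, LinearMap.comp_apply, LinearEquiv.coe_coe, c.coassoc]
    rw [h1, c.counit]
  have h3 (z : A ⊗[k] H) (y : M ⊗[k] H) (h : H) :
      tensorAct k A H M H z (E (y ⊗ₜ h)) = E (tensorAct k A H M H z y ⊗ₜ h) := by
    induction z with
    | zero => simp
    | add x y hx hy => simp only [map_add, LinearMap.add_apply, hx, hy, add_tmul]
    | tmul a g =>
      induction y with
      | zero => simp
      | add z z' hz hz' => simp only [map_add, add_tmul, hz, hz']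
      | tmul w g' => simp [E, mul_assoc]
  rw [h2]
  obtain ⟨z, hz⟩ := hW m hm
  rw [← hz]
  generalize z = z
  induction z with
  | zero => simp
  | add x y hx hy => simp only [map_add, hx, hy, add_zero]
  | tmul w g =>
    have h4 := hc a w
    rw [ha w w.2, map_zero] at h4
    simp only [LinearMap.rTensor_tmul, h3]
    erw [← h4]
    simp

end Coaction

open Coaction

/-- A finite equivariant module is separated for the topology defined by a fixed point, if the ring
of invariants is local: the intersection `W` of the `𝔪 ^ n • M` has an annihilator that is not
contained in `𝔪`, so the annihilator contains an invariant outside `𝔪`, which is a unit. -/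
lemma eq_zero_of_forall_mem_pow_smul [IsNoetherianRing A] [IsLocalRing σ.invariants]
    (hH : ExactInvariants k H) (hx : σ.IsFixed x) {M : Type*} [AddCommGroup M] [Module k M]
    [Module A M] [IsScalarTower k A M] [Module.Finite A M] {c : Coaction k H M}
    (hc : c.IsEquivariant σ) {m : M} (hm : ∀ n, m ∈ (RingHom.ker x ^ n • ⊤ : Submodule A M)) :
    m = 0 := by
  set 𝔪 := RingHom.ker x
  let W : Submodule A M := ⨅ n : ℕ, 𝔪 ^ n • ⊤
  have hW : c.IsStable (W.restrictScalars k) := by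
    rw [isStable_iff]
    intro φ w hw
    rw [Submodule.restrictScalars_mem, Submodule.mem_iInf] at hw ⊢
    intro n
    exact isStable_iff.mp (hc.isStable_smul (isStable_pow (isStable_ker hx) n)
      (by rw [Submodule.restrictScalars_top]; exact isStable_top)) φ w (hw n)
  obtain ⟨r, hr, hrW⟩ := Submodule.exists_sub_one_mem_and_smul_eq_zero_of_fg_of_le_smul 𝔪 W
    (IsNoetherian.noetherian W) fun w hw ↦ by
      obtain ⟨r, hr⟩ := (Ideal.mem_iInf_smul_pow_eq_bot_iff 𝔪 w).mp hw
      rw [← hr]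
      exact Submodule.smul_mem_smul r.2 hw
  have hxr : x r = 1 := by
    have : x (r - 1) = 0 := hr
    rwa [map_sub, map_one, sub_eq_zero] at this
  obtain ⟨j, hj, hjinv, hxj⟩ := hH.exists_mem (isHom_of_isFixed hx)
    (hc.isStable_annihilator hW) (n := 1) rfl ⟨r, by
      rw [SetLike.mem_coe, Submodule.restrictScalars_mem, Submodule.mem_annihilator]
      exact hrW, hxr⟩
  let j' : σ.invariants := ⟨j, hjinv⟩
  have hunit : IsUnit j' := by
    refine (IsLocalRing.isUnit_or_isUnit_one_sub_self j').resolve_right fun h ↦ ?_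
    have := (h.map σ.invariants.val).map x
    rw [map_sub, map_one, map_sub, map_one] at this
    exact this.ne_zero (sub_eq_zero.mpr hxj.symm)
  have hmW : m ∈ W := Submodule.mem_iInf _ |>.mpr hm
  have hjm : j • m = 0 := Submodule.mem_annihilator.mp hj m hmW
  exact ((hunit.map σ.invariants.val).smul_eq_zero).mp hjm

end StableSubmodules

/-! ### Lifting compatible sequences -/

section Limits

variable {k H A : Type u} [Field k] [CommRing H] [HopfAlgebra k H] [CommRing A] [Algebra k A]
variable {σ : GAction k H A} {x : A →ₐ[k] k}

open Coaction

lemma Coaction.ExactInvariants.isNoetherianRing_invariants [IsNoetherianRing A]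
    (hH : ExactInvariants k H) (σ : GAction k H A) : IsNoetherianRing σ.invariants := by
  have := hH.isNoetherian_invariantsIn σ.isEquivariant_toCoaction ⊤
  exact isNoetherian_of_injective (P := σ.toCoaction.invariantsIn σ.isEquivariant_toCoaction ⊤)
    (LinearMap.codRestrict _ (Algebra.linearMap σ.invariants A) fun a ↦ ⟨a.2, Submodule.mem_top⟩)
    fun a b h ↦ Subtype.ext (congrArg
      (fun z : σ.toCoaction.invariantsIn σ.isEquivariant_toCoaction ⊤ ↦ (z : A)) h)

variable {F : Type u} [AddCommGroup F] [Module k F] [Module A F] [IsScalarTower k A F]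
  {c : Coaction k H F}
  {E : ℕ → Type u} [∀ n, AddCommGroup (E n)] [∀ n, Module k (E n)] [∀ n, Module A (E n)]
  [∀ n, IsScalarTower k A (E n)] {e : ∀ n, Coaction k H (E n)}

/-- A compatible sequence of elements of the images `π n (W)` lifts to an element of `W`, if the
matrix coefficients of its members lie in a common finite-dimensional space `C`. By linear
reductivity the lifts of each member can be chosen in the `C`-isotypic part of `W`, which is a
noetherian, hence linearly compact, module over the complete local ring of invariants. There are no
transition maps here, so compatibility is stated through lifts to `F`. -/
lemma exists_mem_forall_eq [IsNoetherianRing A] [IsLocalRing σ.invariants]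
    [IsAdicComplete (IsLocalRing.maximalIdeal σ.invariants) σ.invariants]
    (hH : ExactInvariants k H) (hc : c.IsEquivariant σ) {π : ∀ n, F →ₗ[A] E n}
    (hπ : ∀ n, c.IsHom (e n) ((π n).restrictScalars k))
    (hker : ∀ n, LinearMap.ker (π (n + 1)) ≤ LinearMap.ker (π n))
    {W : Submodule A F} [Module.Finite A W] (hW : c.IsStable (W.restrictScalars k))
    {C : Submodule k H} [Module.Finite k C] (hC : (leftRegular k H).IsStable C) {f : ∀ n, E n}
    (hfC : ∀ n, f n ∈ (e n).isotypic C) (hfW : ∀ n, f n ∈ W.map (π n))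
    (hf : ∀ n w, π (n + 1) w = f (n + 1) → π n w = f n) :
    ∃ w ∈ W, ∀ n, π n w = f n := by
  have := hH.isNoetherianRing_invariants σ
  have := hH.isNoetherian_isotypicIn hc W hW C
  have h (n) : ∃ q : c.isotypicIn hc W C, π n q = f n := by
    obtain ⟨w, hw, hwC, hwf⟩ := hH.exists_mem_isotypic (hπ n) hW hC (hfC n) (hfW n)
    exact ⟨⟨w, hwC, hw⟩, hwf⟩
  choose q hq using h
  let S (n : ℕ) : Submodule σ.invariants (c.isotypicIn hc W C) :=
    ((LinearMap.ker (π n)).restrictScalars σ.invariants).comap (Submodule.subtype _)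
  have hS : Antitone S := antitone_nat_of_succ_le fun n w hw ↦ hker n hw
  obtain ⟨y, hy⟩ := exists_forall_sub_mem hS (q := q) fun n ↦ by
    change π n (q (n + 1) - q n : F) = 0
    rw [map_sub, hf n _ (hq (n + 1)), hq, sub_self]
  refine ⟨y, y.2.2, fun n ↦ ?_⟩
  have : π n (y - q n : F) = 0 := hy n
  rwa [map_sub, sub_eq_zero, hq] at this

/-- Compatible equivariant maps from `M` to the quotients `N / 𝔪 ^ (n + 1) N` of a finite
equivariant module `N` come from an equivariant map `M → N`. -/
lemma exists_hom_of_compatible [IsNoetherianRing A] [IsLocalRing σ.invariants]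
    [IsAdicComplete (IsLocalRing.maximalIdeal σ.invariants) σ.invariants]
    (hH : ExactInvariants k H) (hx : σ.IsFixed x) (hc : c.IsEquivariant σ) [Module.Finite A F]
    {π : ∀ n, F →ₗ[A] E n} (hπ : ∀ n, c.IsHom (e n) ((π n).restrictScalars k))
    (hsurj : ∀ n, Function.Surjective (π n))
    (hker : ∀ n, LinearMap.ker (π n) = RingHom.ker x ^ (n + 1) • ⊤)
    {M : Type u} [AddCommGroup M] [Module k M] [Module A M] [IsScalarTower k A M]
    {d : Coaction k H M} {r : ∀ n, M →ₗ[A] E n}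
    (hr : ∀ n, d.IsHom (e n) ((r n).restrictScalars k))
    (hrπ : ∀ n w m, π (n + 1) w = r (n + 1) m → π n w = r n m) :
    ∃ f : M →ₗ[A] F, d.IsHom c (f.restrictScalars k) ∧ ∀ n m, π n (f m) = r n m := by
  have huniq {w w' : F} (h : ∀ n, π n w = π n w') : w = w' := by
    rw [← sub_eq_zero]
    refine eq_zero_of_forall_mem_pow_smul hH hx hc fun n ↦ ?_
    have : w - w' ∈ LinearMap.ker (π n) := by rw [LinearMap.mem_ker, map_sub, h, sub_self]
    rw [hker] at this
    exact Submodule.smul_mono_left (Ideal.pow_le_pow_right (Nat.le_succ n)) this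
  have hex (m : M) : ∃ w, ∀ n, π n w = r n m := by
    obtain ⟨C, hC, hC', hm⟩ := d.exists_mem_isotypic m
    obtain ⟨w, -, hw⟩ := exists_mem_forall_eq hH hc hπ (fun n ↦ by
        rw [hker, hker]
        exact Submodule.smul_mono_left (Ideal.pow_le_pow_right (Nat.le_succ _)))
      (W := ⊤) (by rw [Submodule.restrictScalars_top]; exact isStable_top) hC' (f := fun n ↦ r n m)
      (fun n ↦ (hr n).map_mem_isotypic hm)
      (fun n ↦ by rw [Submodule.map_top, LinearMap.range_eq_top.mpr (hsurj n)]; trivial)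
      (fun n w ↦ hrπ n w m)
    exact ⟨w, hw⟩
  choose f hf using hex
  let f' : M →ₗ[A] F :=
    { toFun := f
      map_add' := fun m n ↦ huniq fun i ↦ by simp [hf]
      map_smul' := fun a m ↦ huniq fun i ↦ by simp [hf] }
  refine ⟨f', fun m ↦ ext_slice fun φ ↦ huniq fun n ↦ ?_, fun n m ↦ hf m n⟩
  rw [slice_rTensor]
  have h1 : (π n).restrictScalars k (slice F φ (c.coact (f m))) =
      slice (E n) φ ((e n).coact (r n m)) := by
    rw [← slice_rTensor, ← hπ n (f m)]
    simp [hf]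
  have h2 : (π n) (f (slice M φ (d.coact m))) = slice (E n) φ ((e n).coact (r n m)) := by
    rw [hf, ← LinearMap.restrictScalars_apply k (r n), ← slice_rTensor, ← hr]
    simp
  exact h1.trans h2.symm

/-- A map `F → F ⊗ H` that is compatible with the coactions under jointly injective maps from `F`
to representations is a coaction. -/
def Coaction.ofJointlyInjective {ι : Type*} {F : Type*} [AddCommGroup F] [Module k F]
    {E : ι → Type*} [∀ n, AddCommGroup (E n)] [∀ n, Module k (E n)] (e : ∀ n, Coaction k H (E n))
    (π : ∀ n, F →ₗ[k] E n) (hπ : ∀ f, (∀ n, π n f = 0) → f = 0) (ρ : F →ₗ[k] F ⊗[k] H)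
    (hρ : ∀ n f, (π n).rTensor H (ρ f) = (e n).coact (π n f)) : Coaction k H F where
  coact := ρ
  coassoc f := by
    have hinj {V : Type u} [AddCommGroup V] [Module k V] {z w : F ⊗[k] V}
        (h : ∀ n, (π n).rTensor V z = (π n).rTensor V w) : z = w :=
      ext_slice fun φ ↦ sub_eq_zero.mp <| hπ _ fun n ↦ by
        rw [map_sub, ← slice_rTensor, ← slice_rTensor, h, sub_self]
    refine hinj fun n ↦ ?_
    have h1 (z : (F ⊗[k] H) ⊗[k] H) : (π n).rTensor (H ⊗[k] H) (TensorProduct.assoc k _ _ _ z)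
        = TensorProduct.assoc k _ _ _ (((π n).rTensor H).rTensor H z) := by
      rw [LinearMap.rTensor_tensor]; simp
    have h2 (z : F ⊗[k] H) : (π n).rTensor (H ⊗[k] H)
        ((Coalgebra.comul : H →ₗ[k] H ⊗[k] H).lTensor F z) =
        (Coalgebra.comul : H →ₗ[k] H ⊗[k] H).lTensor (E n) ((π n).rTensor H z) := by
      simp only [← LinearMap.comp_apply, LinearMap.rTensor_comp_lTensor,
        LinearMap.lTensor_comp_rTensor]
    have h3 : (π n).rTensor H ∘ₗ ρ = (e n).coact ∘ₗ π n := LinearMap.ext (hρ n)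
    rw [h1, h2, hρ, ← LinearMap.rTensor_comp_apply, h3, LinearMap.rTensor_comp_apply, hρ,
      (e n).coassoc]
  counit f := sub_eq_zero.mp <| hπ _ fun n ↦ by
    change π n (slice F Coalgebra.counit (ρ f) - f) = 0
    rw [map_sub, ← slice_rTensor, hρ, slice_counit_coact, sub_self]

lemma Coaction.isEquivariant_of_jointlyInjective {c : Coaction k H F}
    (he : ∀ n, (e n).IsEquivariant σ) (π : ∀ n, F →ₗ[A] E n)
    (hc : ∀ n, c.IsHom (e n) ((π n).restrictScalars k)) (hπ : ∀ f, (∀ n, π n f = 0) → f = 0) :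
    c.IsEquivariant σ := by
  intro a f
  refine ext_slice fun φ ↦ sub_eq_zero.mp <| hπ _ fun n ↦ ?_
  have h1 (y : A ⊗[k] H) (z : F ⊗[k] H) :
      ((π n).restrictScalars k).rTensor H (tensorAct k A H F H y z) =
      tensorAct k A H (E n) H y (((π n).restrictScalars k).rTensor H z) := by
    induction y with
    | zero => simp
    | add y y' hy hy' => simp only [map_add, LinearMap.add_apply, hy, hy']
    | tmul a g =>
      induction z with
      | zero => simp
      | add z z' hz hz' => simp only [map_add, hz, hz']
      | tmul w g' => simp
  rw [← LinearMap.restrictScalars_apply k (π n), map_sub, ← slice_rTensor, ← slice_rTensor, h1,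
    ← hc, ← hc, LinearMap.restrictScalars_apply, map_smul, he, LinearMap.restrictScalars_apply,
    sub_self]

end Limits

/-! ### Limits of towers of equivariant modules -/

section LimitModule

variable {k H A : Type u} [Field k] [CommRing H] [HopfAlgebra k H] [CommRing A] [Algebra k A]
variable {σ : GAction k H A} {x : A →ₐ[k] k}

namespace Coaction

section

variable {M : Type*} [AddCommGroup M] [Module k M] [Module A M] [IsScalarTower k A M]
  {c : Coaction k H M}

lemma IsEquivariant.exists_smul_mem_isotypic (σ : GAction k H A) (a : A) (D : Submodule k H)
    [Module.Finite k D] :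
    ∃ D' : Submodule k H, Module.Finite k D' ∧ ∀ {M : Type u} [AddCommGroup M] [Module k M]
      [Module A M] [IsScalarTower k A M] {c : Coaction k H M}, c.IsEquivariant σ →
      ∀ m ∈ c.isotypic D, a • m ∈ c.isotypic D' := by
  obtain ⟨B, hB, h⟩ := TensorProduct.exists_finite_submodule_right_of_setFinite {σ.coact a}
    (Set.finite_singleton _)
  obtain ⟨y, hy⟩ := h (Set.mem_singleton _)
  refine ⟨B * D, Module.Finite.iff_fg.mpr
    ((Module.Finite.iff_fg.mp hB).mul (Module.Finite.iff_fg.mp inferInstance)), ?_⟩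
  intro M _ _ _ _ c hc m hm
  obtain ⟨z, hz⟩ := c.mem_isotypic.mp hm
  rw [mem_isotypic, hc, ← hy, ← hz]
  generalize y = y
  generalize z = z
  induction y with
  | zero => simp
  | add y y' hy hy' => simp only [map_add, LinearMap.add_apply]; exact add_mem hy hy'
  | tmul a g =>
    induction z with
    | zero => simp
    | add z z' hz hz' => simp only [map_add]; exact add_mem hz hz'
    | tmul w g' => exact ⟨(a • w) ⊗ₜ ⟨g * g', Submodule.mul_mem_mul g.2 g'.2⟩, by simp⟩

lemma coact_slice_coact (φ : H →ₗ[k] k) (m : M) : c.coact (slice M φ (c.coact m)) =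
    (slice H φ ∘ₗ Coalgebra.comul).lTensor M (c.coact m) := by
  have h1 (w : M ⊗[k] (H ⊗[k] H)) : slice (M ⊗[k] H) φ ((TensorProduct.assoc k M H H).symm w) =
      (slice H φ).lTensor M w := by
    induction w with
    | zero => simp
    | add x y hx hy => simp only [map_add, hx, hy]
    | tmul m w =>
      induction w with
      | zero => simp
      | add x y hx hy => simp only [map_add, tmul_add, hx, hy]
      | tmul a b => simp
  have h2 := c.coassoc m
  rw [← LinearEquiv.eq_symm_apply] at h2
  rw [← slice_rTensor, h2, h1, ← LinearMap.lTensor_comp_apply]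

lemma slice_coact_mem_isotypic (φ : H →ₗ[k] k) {D : Submodule k H} {m : M}
    (hm : m ∈ c.isotypic D) :
    slice M φ (c.coact m) ∈ c.isotypic (D.map (slice H φ ∘ₗ Coalgebra.comul)) := by
  obtain ⟨z, hz⟩ := c.mem_isotypic.mp hm
  rw [mem_isotypic, coact_slice_coact, ← hz]
  refine ⟨((slice H φ ∘ₗ Coalgebra.comul).submoduleMap D).lTensor M z, ?_⟩
  rw [← LinearMap.lTensor_comp_apply, ← LinearMap.lTensor_comp_apply]
  rfl

end

/-- Elements of `M ⊗ D`, for `D` finite-dimensional, are recovered uniformly from finitely many of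
their contractions. -/
lemma exists_eq_sum_slice_of_finite (D : Submodule k H) [Module.Finite k D] :
    ∃ (s : Finset (Module.Basis.ofVectorSpaceIndex k H)), ∀ {M : Type u} [AddCommGroup M]
      [Module k M], ∀ z ∈ LinearMap.range (D.subtype.lTensor M),
      z = ∑ i ∈ s, slice M ((Module.Basis.ofVectorSpace k H).coord i) z ⊗ₜ
        (Module.Basis.ofVectorSpace k H) i := by
  classical
  set b := Module.Basis.ofVectorSpace k H
  obtain ⟨t, ht⟩ := Module.Finite.iff_fg.mp ‹Module.Finite k D›
  let s := t.biUnion fun d ↦ (b.repr d).support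
  have hs : ∀ d ∈ D, d = ∑ i ∈ s, b.coord i d • b i := by
    intro d hd
    rw [← ht] at hd
    induction hd using Submodule.span_induction with
    | zero => simp
    | add x y _ _ hx hy =>
      nth_rewrite 1 [hx, hy]
      simp only [map_add, add_smul, Finset.sum_add_distrib]
    | smul a x _ hx =>
      nth_rewrite 1 [hx]
      simp only [map_smul, smul_eq_mul, mul_smul, Finset.smul_sum]
    | mem d hd =>
      nth_rewrite 1 [← b.linearCombination_repr d]
      rw [Finsupp.linearCombination_apply, Finsupp.sum]
      refine Finset.sum_subset (Finset.subset_biUnion_of_mem (fun d ↦ (b.repr d).support) hd) ?_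
      intro i _ hi
      rw [Finsupp.notMem_support_iff.mp hi, zero_smul]
  refine ⟨s, ?_⟩
  rintro M _ _ _ ⟨z, rfl⟩
  induction z with
  | zero => simp
  | add x y hx hy =>
    nth_rewrite 1 [map_add, hx, hy]
    simp only [map_add, add_tmul, Finset.sum_add_distrib]
  | tmul m d =>
    simp only [LinearMap.lTensor_tmul, Submodule.subtype_apply, slice_tmul]
    nth_rewrite 1 [hs d d.2]
    rw [tmul_sum]
    simp only [tmul_smul, smul_tmul']

end Coaction

open Coaction

variable {E : ℕ → Type u} [∀ n, AddCommGroup (E n)] [∀ n, Module k (E n)] [∀ n, Module A (E n)]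
  [∀ n, IsScalarTower k A (E n)] {e : ∀ n, Coaction k H (E n)}

/-- The limit of a tower of equivariant modules in the category of equivariant modules: the
compatible families whose members have all their matrix coefficients in a common finite-dimensional
subspace of `H`. -/
def equivariantLimit (he : ∀ n, (e n).IsEquivariant σ) (t : ∀ n, E (n + 1) →ₗ[A] E n) :
    Submodule A (∀ n, E n) where
  carrier := {f | (∀ n, t n (f (n + 1)) = f n) ∧
    ∃ D : Submodule k H, Module.Finite k D ∧ ∀ n, f n ∈ (e n).isotypic D}
  add_mem' := by
    rintro f g ⟨hf, D, hD, hfD⟩ ⟨hg, D', hD', hgD⟩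
    exact ⟨fun n ↦ by simp [hf, hg], D ⊔ D', inferInstance,
      fun n ↦ add_mem (isotypic_mono le_sup_left (hfD n)) (isotypic_mono le_sup_right (hgD n))⟩
  zero_mem' := ⟨fun n ↦ by simp, ⊥, inferInstance, fun n ↦ zero_mem _⟩
  smul_mem' := by
    rintro a f ⟨hf, D, hD, hfD⟩
    obtain ⟨D', hD', h⟩ := IsEquivariant.exists_smul_mem_isotypic σ a D
    exact ⟨fun n ↦ by simp [hf], D', hD', fun n ↦ h (he n) _ (hfD n)⟩

namespace equivariantLimit

variable (he : ∀ n, (e n).IsEquivariant σ) {t : ∀ n, E (n + 1) →ₗ[A] E n}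
  (ht : ∀ n, (e (n + 1)).IsHom (e n) ((t n).restrictScalars k))

/-- The projections from the limit. -/
def proj (t : ∀ n, E (n + 1) →ₗ[A] E n) (n : ℕ) : equivariantLimit he t →ₗ[A] E n :=
  LinearMap.proj n ∘ₗ Submodule.subtype _

lemma t_proj (n : ℕ) (f : equivariantLimit he t) : t n (proj he t (n + 1) f) = proj he t n f :=
  f.2.1 n

lemma eq_zero {f : equivariantLimit he t} (h : ∀ n, proj he t n f = 0) : f = 0 :=
  Subtype.ext (funext h)

include ht in
lemma exists_unique_coact (f : equivariantLimit he t) : ∃! z : equivariantLimit he t ⊗[k] H,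
    ∀ n, ((proj he t n).restrictScalars k).rTensor H z = (e n).coact (proj he t n f) := by
  refine existsUnique_of_exists_of_unique ?_ fun z w hz hw ↦ ?_
  · obtain ⟨hf, D, hD, hfD⟩ := f.2
    obtain ⟨s, hs⟩ := exists_eq_sum_slice_of_finite D
    let g (φ : H →ₗ[k] k) : equivariantLimit he t :=
      ⟨fun n ↦ slice (E n) φ ((e n).coact ((f : ∀ n, E n) n)), fun n ↦ by
        have := slice_rTensor φ ((t n).restrictScalars k)
          ((e (n + 1)).coact ((f : ∀ n, E n) (n + 1)))
        rw [← ht, LinearMap.restrictScalars_apply, hf] at this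
        exact this.symm, _, inferInstance, fun n ↦ slice_coact_mem_isotypic φ (hfD n)⟩
    refine ⟨∑ i ∈ s, g ((Module.Basis.ofVectorSpace k H).coord i) ⊗ₜ
      (Module.Basis.ofVectorSpace k H) i, fun n ↦ ?_⟩
    refine Eq.trans ?_ (hs _ ((e n).mem_isotypic.mp (hfD n))).symm
    rw [map_sum]
    rfl
  · refine ext_slice fun φ ↦ sub_eq_zero.mp (eq_zero he fun n ↦ ?_)
    rw [← LinearMap.restrictScalars_apply k (proj he t n), map_sub, ← slice_rTensor,
      ← slice_rTensor, hz, hw, sub_self]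

/-- The coaction on the limit. -/
def coaction : Coaction k H (equivariantLimit he t) :=
  have h := exists_unique_coact he ht
  have huniq {f} {z w : equivariantLimit he t ⊗[k] H}
      (hz : ∀ n, ((proj he t n).restrictScalars k).rTensor H z = (e n).coact (proj he t n f))
      (hw : ∀ n, ((proj he t n).restrictScalars k).rTensor H w = (e n).coact (proj he t n f)) :
      z = w := (h f).unique hz hw
  .ofJointlyInjective e (fun n ↦ (proj he t n).restrictScalars k) (fun f ↦ eq_zero he)
    { toFun := fun f ↦ (h f).choose
      map_add' := fun f g ↦ huniq (h (f + g)).choose_spec.1 fun n ↦ by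
        rw [map_add, map_add, map_add, (h f).choose_spec.1 n, (h g).choose_spec.1 n]
      map_smul' := fun a f ↦ huniq (h (a • f)).choose_spec.1 fun n ↦ by
        rw [RingHom.id_apply, map_smul, (h f).choose_spec.1 n,
          ← LinearMap.restrictScalars_apply k (proj he t n) (a • f), map_smul, map_smul]
        rfl }
    fun n f ↦ (h f).choose_spec.1 n

lemma isHom_proj (n : ℕ) :
    (coaction he ht).IsHom (e n) ((proj he t n).restrictScalars k) :=
  fun f ↦ ((exists_unique_coact he ht f).choose_spec.1 n).symm

lemma isEquivariant : (coaction he ht).IsEquivariant σ :=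
  isEquivariant_of_jointlyInjective he (proj he t) (isHom_proj he ht) fun _ ↦ eq_zero he

variable (hsurj : ∀ n, Function.Surjective (t n))
  (hker : ∀ n, LinearMap.ker (t n) = RingHom.ker x ^ (n + 1) • ⊤)
  (hzero : ∀ n, (RingHom.ker x ^ (n + 1) • ⊤ : Submodule A (E n)) = ⊥)

include ht hsurj in
/-- The lifts of an element can be chosen with matrix coefficients in the same space, so that they
form an element of the limit. -/
lemma surjective_proj_zero (hH : ExactInvariants k H) : Function.Surjective (proj he t 0) := by
  intro y
  obtain ⟨C, hC, hC', hy⟩ := (e 0).exists_mem_isotypic y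
  have step (n : ℕ) (y : (e n).isotypic C) : ∃ y' : (e (n + 1)).isotypic C, t n y' = y := by
    obtain ⟨w, -, hw, h⟩ := hH.exists_mem_isotypic (ht n) isStable_top hC' y.2
      ⟨_, Submodule.mem_top, (hsurj n y).choose_spec⟩
    exact ⟨⟨w, hw⟩, h⟩
  choose next hnext using step
  let f (n : ℕ) : (e n).isotypic C :=
    Nat.rec (motive := fun n ↦ (e n).isotypic C) ⟨y, hy⟩ next n
  exact ⟨⟨fun n ↦ f n, fun n ↦ hnext n (f n), C, hC, fun n ↦ (f n).2⟩, rfl⟩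

include hker hzero in
/-- Nakayama's lemma: a submodule of the limit that surjects to `E 0` surjects to all `E n`. -/
lemma map_proj_eq_top {W : Submodule A (equivariantLimit he t)} (hW : W.map (proj he t 0) = ⊤)
    (n : ℕ) : W.map (proj he t n) = ⊤ := by
  set 𝔪 := RingHom.ker x
  induction n with
  | zero => exact hW
  | succ n ih =>
    have h1 : W.map (proj he t (n + 1)) ⊔ 𝔪 ^ (n + 1) • ⊤ = ⊤ := by
      rw [← hker, eq_top_iff, ← Submodule.comap_map_eq, ← Submodule.map_comp]
      have : t n ∘ₗ proj he t (n + 1) = proj he t n := LinearMap.ext (t_proj he n)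
      rw [this, ih]
      exact fun _ _ ↦ Submodule.mem_top
    have h2 : 𝔪 ^ (n + 1) • (⊤ : Submodule A (E (n + 1))) ≤ W.map (proj he t (n + 1)) := by
      conv_lhs => rw [← h1]
      rw [Submodule.smul_sup, sup_le_iff]
      refine ⟨Submodule.smul_le_right, ?_⟩
      rw [← Submodule.mul_smul, ← pow_add]
      refine (Submodule.smul_mono_left (Ideal.pow_le_pow_right (by lia : n + 1 + 1 ≤ _))).trans ?_
      rw [hzero]
      exact bot_le
    rwa [sup_eq_left.mpr h2] at h1

include ht hsurj hker hzero in
lemma surjective_proj (hH : ExactInvariants k H) (n : ℕ) : Function.Surjective (proj he t n) := by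
  rw [← LinearMap.range_eq_top, LinearMap.range_eq_map]
  refine map_proj_eq_top he hker hzero ?_ n
  rw [← LinearMap.range_eq_map, LinearMap.range_eq_top]
  exact surjective_proj_zero he ht hsurj hH

variable [IsNoetherianRing A] [IsLocalRing σ.invariants]
    [IsAdicComplete (IsLocalRing.maximalIdeal σ.invariants) σ.invariants]

include ht in
/-- Finite stable submodules of the limit are closed. -/
lemma mem_of_forall_proj_mem (hH : ExactInvariants k H) {W : Submodule A (equivariantLimit he t)}
    [Module.Finite A W] (hW : (coaction he ht).IsStable (W.restrictScalars k))
    {f : equivariantLimit he t} (hf : ∀ n, proj he t n f ∈ W.map (proj he t n)) : f ∈ W := by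
  obtain ⟨C, hC, hC', hfC⟩ := (coaction he ht).exists_mem_isotypic f
  obtain ⟨w, hw, h⟩ := exists_mem_forall_eq hH (isEquivariant he ht) (isHom_proj he ht)
    (fun n f hf ↦ by
      rw [LinearMap.mem_ker] at hf ⊢
      rw [← t_proj, hf, map_zero]) hW hC' (f := fun n ↦ proj he t n f)
    (fun n ↦ (isHom_proj he ht n).map_mem_isotypic hfC) hf
    (fun n w hw ↦ by rw [← t_proj he n w, ← t_proj he n f, hw])
  have : f = w := sub_eq_zero.mp (eq_zero he fun n ↦ by rw [map_sub, h, sub_self])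
  rwa [this]

include ht hsurj hker hzero in
/-- The limit is finite: lifts of generators of `E 0` lie in a finite stable submodule, which
surjects to every `E n` by Nakayama's lemma and is closed. -/
lemma finite (hH : ExactInvariants k H) [Module.Finite A (E 0)] :
    Module.Finite A (equivariantLimit he t) := by
  obtain ⟨s, hs⟩ := Module.Finite.fg_top (R := A) (M := E 0)
  choose l hl using surjective_proj_zero he ht hsurj hH
  have : Module.Finite k (Submodule.span k (l '' s)) :=
    Module.Finite.span_of_finite _ (s.finite_toSet.image l)
  obtain ⟨V, hV, hV', hle⟩ := (coaction he ht).exists_finite_stable_ge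
    (Submodule.span k (l '' s))
  let W : Submodule A (equivariantLimit he t) := Submodule.span A V
  have hWfin : Module.Finite A W := by
    obtain ⟨b, hb⟩ := Module.Finite.iff_fg.mp hV
    have : W = Submodule.span A b := by
      refine le_antisymm (Submodule.span_le.mpr ?_) (Submodule.span_mono ?_)
      · rw [← hb]
        exact Submodule.span_subset_span k A _
      · rw [← hb]
        exact Submodule.subset_span
    rw [this]
    exact Module.Finite.span_of_finite _ b.finite_toSet
  have hW0 : W.map (proj he t 0) = ⊤ := by
    rw [eq_top_iff, ← hs, Submodule.span_le]
    intro y hy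
    exact ⟨l y, Submodule.subset_span (hle (Submodule.subset_span ⟨y, hy, rfl⟩)), hl y⟩
  have hWtop : W = ⊤ := by
    rw [eq_top_iff]
    intro f _
    refine mem_of_forall_proj_mem he ht hH ((isEquivariant he ht).isStable_span hV') fun n ↦ ?_
    rw [map_proj_eq_top he hker hzero hW0]
    trivial
  rw [hWtop] at hWfin
  exact Module.Finite.equiv Submodule.topEquiv

include ht hsurj hker hzero in
/-- The limit recovers the tower, since the stable submodule `𝔪 ^ (n + 1)` times the limit is
closed. -/
lemma ker_proj (hH : ExactInvariants k H) (hx : σ.IsFixed x) [Module.Finite A (E 0)] (n : ℕ) :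
    LinearMap.ker (proj he t n) = RingHom.ker x ^ (n + 1) • ⊤ := by
  set 𝔪 := RingHom.ker x
  have := finite he ht hsurj hker hzero hH
  have hmap (i N : ℕ) : (𝔪 ^ i • ⊤ : Submodule A (equivariantLimit he t)).map (proj he t N) =
      𝔪 ^ i • ⊤ := by
    rw [Submodule.map_smul'', Submodule.map_top,
      LinearMap.range_eq_top.mpr (surjective_proj he ht hsurj hker hzero hH N)]
  apply le_antisymm
  · intro f hf
    rw [LinearMap.mem_ker] at hf
    refine mem_of_forall_proj_mem he ht hH ((isEquivariant he ht).isStable_smul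
      (isStable_pow (isStable_ker hx) _)
      (by rw [Submodule.restrictScalars_top]; exact isStable_top))
      fun N ↦ ?_
    rw [hmap]
    induction N with
    | zero =>
      have h0 (n) (hn : proj he t n f = 0) : proj he t 0 f = 0 := by
        induction n with
        | zero => exact hn
        | succ n ih => exact ih (by rw [← t_proj, hn, map_zero])
      rw [h0 n hf]
      exact zero_mem _
    | succ N ih =>
      obtain h | h := le_total (N + 1) n
      · have h0 (m) (hm : N + 1 ≤ m) (hm' : proj he t m f = 0) : proj he t (N + 1) f = 0 := by
          induction m, hm using Nat.le_induction with
          | base => exact hm'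
          | succ m _ ih => exact ih (by rw [← t_proj, hm', map_zero])
        rw [h0 n h hf]
        exact zero_mem _
      · obtain rfl | h := h.eq_or_lt
        · rw [hf]
          exact zero_mem _
        have h1 : (𝔪 ^ (n + 1) • ⊤ : Submodule A (E (N + 1))).map (t N) = 𝔪 ^ (n + 1) • ⊤ := by
          rw [Submodule.map_smul'', Submodule.map_top, LinearMap.range_eq_top.mpr (hsurj N)]
        rw [← t_proj, ← h1, ← Submodule.mem_comap, Submodule.comap_map_eq, hker,
          sup_eq_left.mpr (Submodule.smul_mono_left (Ideal.pow_le_pow_right (by lia)))] at ih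
        exact ih
  · intro f hf
    have := Submodule.mem_map_of_mem (f := proj he t n) hf
    rwa [hmap, hzero, Submodule.mem_bot] at this

end equivariantLimit

end LimitModule

/-! ### Base change along homomorphisms of rings -/

section BaseChange

variable {R S T : Type*} [CommRing R] [CommRing S] [CommRing T]
  {M N L : Type*} [AddCommGroup M] [Module R M] [AddCommGroup N] [Module S N]
  [AddCommGroup L] [Module T L]

/-- The map `f : M → N`, semilinear over the ring homomorphism `φ : R → S`, exhibits `N` as
`S ⊗ M`. This is `IsBaseChange` without instances, for use with many homomorphisms at a time. -/
structure IsBC (φ : R →+* S) (f : M →+ N) : Prop where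
  map_smul (r : R) (m : M) : f (r • m) = φ r • f m
  isBaseChange :
    letI : Algebra R S := φ.toAlgebra
    letI : Module R N := Module.compHom N φ
    haveI : IsScalarTower R S N := ⟨fun a b n ↦ mul_smul (φ a) b n⟩
    IsBaseChange S ({ f with map_smul' := map_smul } : M →ₗ[R] N)

lemma isBC_iff [i : Algebra R S] [j : Module R N] [IsScalarTower R S N] {φ : R →+* S}
    (hφ : ∀ r, algebraMap R S r = φ r) (f : M →ₗ[R] N) :
    IsBC φ f.toAddMonoidHom ↔ IsBaseChange S f := by
  have h1 : i = φ.toAlgebra := by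
    refine @Algebra.algebra_ext R _ S _ i φ.toAlgebra ?_
    exact hφ
  subst h1
  have h2 : j = Module.compHom N φ := by
    refine @Module.ext' R _ N _ j (Module.compHom N φ) ?_
    exact fun r n ↦ (@algebraMap_smul R _ S _ φ.toAlgebra N _ _ j _ r n).symm
  subst h2
  let := φ.toAlgebra
  let := Module.compHom N φ
  exact ⟨fun h ↦ h.isBaseChange, fun h ↦ ⟨f.map_smul, h⟩⟩

namespace IsBC

variable {φ : R →+* S} {ψ : S →+* T} {χ : R →+* T} {f : M →+ N} {g : N →+ L} {h : M →+ L}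

@[elab_as_elim]
lemma induction_on (hf : IsBC φ f) {motive : N → Prop} (n : N) (zero : motive 0)
    (add : ∀ x y, motive x → motive y → motive (x + y))
    (smul : ∀ (s : S) (m : M), motive (s • f m : N)) : motive n := by
  let : Algebra R S := φ.toAlgebra
  let : Module R N := Module.compHom N φ
  have : IsScalarTower R S N := ⟨fun a b n ↦ mul_smul (φ a) b n⟩
  obtain ⟨z, rfl⟩ := hf.isBaseChange.equiv.surjective n
  induction z with
  | zero => simpa
  | add x y hx hy => rw [map_add]; exact add _ _ hx hy
  | tmul s m => rw [IsBaseChange.equiv_tmul]; exact smul s m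

lemma comp (hf : IsBC φ f) (hg : IsBC ψ g) (hχ : ∀ r, χ r = ψ (φ r))
    (hh : ∀ m, h m = g (f m)) : IsBC χ h := by
  let : Algebra R S := φ.toAlgebra
  let : Algebra S T := ψ.toAlgebra
  let : Algebra R T := χ.toAlgebra
  let : Module R N := Module.compHom N φ
  let : Module S L := Module.compHom L ψ
  let : Module R L := Module.compHom L χ
  have : IsScalarTower R S N := ⟨fun a b n ↦ mul_smul (φ a) b n⟩
  have : IsScalarTower S T L := ⟨fun a b n ↦ mul_smul (ψ a) b n⟩
  have : IsScalarTower R T L := ⟨fun a b n ↦ mul_smul (χ a) b n⟩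
  have : IsScalarTower R S T := .of_algebraMap_eq hχ
  have : IsScalarTower R S L := .of_algebraMap_smul fun r n ↦ by
    change ψ (φ r) • n = χ r • n
    rw [hχ]
  have := hf.isBaseChange.comp hg.isBaseChange
  rw [← isBC_iff (φ := χ) fun _ ↦ rfl] at this
  convert this
  exact AddMonoidHom.ext hh

lemma of_comp (hf : IsBC φ f) (hh : IsBC χ h) (hχ : ∀ r, χ r = ψ (φ r))
    (hfg : ∀ m, h m = g (f m)) (hg : ∀ s n, g (s • n) = ψ s • g n) : IsBC ψ g := by
  let : Algebra R S := φ.toAlgebra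
  let : Algebra S T := ψ.toAlgebra
  let : Algebra R T := χ.toAlgebra
  let : Module R N := Module.compHom N φ
  let : Module S L := Module.compHom L ψ
  let : Module R L := Module.compHom L χ
  have : IsScalarTower R S N := ⟨fun a b n ↦ mul_smul (φ a) b n⟩
  have : IsScalarTower S T L := ⟨fun a b n ↦ mul_smul (ψ a) b n⟩
  have : IsScalarTower R T L := ⟨fun a b n ↦ mul_smul (χ a) b n⟩
  have : IsScalarTower R S T := .of_algebraMap_eq hχ
  have : IsScalarTower R S L := .of_algebraMap_smul fun r n ↦ by
    change ψ (φ r) • n = χ r • n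
    rw [hχ]
  let f' : M →ₗ[R] N := { f with map_smul' := hf.map_smul }
  let g' : N →ₗ[S] L := { g with map_smul' := hg }
  have h1 : IsBaseChange T ((g'.restrictScalars R).comp f') := by
    rw [← isBC_iff (φ := χ) fun _ ↦ rfl]
    convert hh
    exact AddMonoidHom.ext fun m ↦ (hfg m).symm
  exact ⟨hg, hf.isBaseChange.of_comp (h := g') h1⟩

/-- Semilinear maps extend along base changes; the semilinearity of the extension is expressed by
an action of `S` on the target. -/
lemma exists_lift (hf : IsBC φ f) {Q : Type*} [AddCommGroup Q] (act : S →+* AddMonoid.End Q)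
    (q : M →+ Q) (hq : ∀ r m, q (r • m) = act (φ r) (q m)) :
    ∃ l : N →+ Q, (∀ (s : S) (n : N), l (s • n) = act s (l n)) ∧ ∀ m, l (f m) = q m := by
  let : Algebra R S := φ.toAlgebra
  let : Module R N := Module.compHom N φ
  let : Module S Q := Module.compHom Q act
  let : Module R Q := Module.compHom Q φ
  have : IsScalarTower R S N := ⟨fun a b n ↦ mul_smul (φ a) b n⟩
  have : IsScalarTower R S Q := ⟨fun a b n ↦ mul_smul (φ a) b n⟩
  let l := hf.isBaseChange.lift ({ q with map_smul' := hq } : M →ₗ[R] Q)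
  exact ⟨l.toAddMonoidHom, l.map_smul, hf.isBaseChange.lift_eq _⟩

lemma linear_ext (hf : IsBC φ f) {Q : Type*} [AddCommGroup Q] (act : S → Q → Q)
    {l l' : N →+ Q} (hl : ∀ (s : S) (n : N), l (s • n) = act s (l n))
    (hl' : ∀ (s : S) (n : N), l' (s • n) = act s (l' n))
    (h : ∀ m, l (f m) = l' (f m)) (n : N) : l n = l' n := by
  induction n using hf.induction_on with
  | zero => simp
  | add x y hx hy => rw [map_add, map_add, hx, hy]
  | smul s m => rw [hl, hl', h]

lemma bijective_of (hf : IsBC φ f) {N' : Type*} [AddCommGroup N'] [Module S N'] {f' : M →+ N'}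
    (hf' : IsBC φ f') {l : N →+ N'} (hl : ∀ (s : S) (n : N), l (s • n) = s • l n)
    (h : ∀ m, l (f m) = f' m) : Function.Bijective l := by
  obtain ⟨l', h1, h2⟩ := hf'.exists_lift (Module.toAddMonoidEnd S N) f hf.map_smul
  replace h1 (s : S) (n : N') : l' (s • n) = s • l' n := h1 s n
  refine Function.bijective_iff_has_inverse.mpr ⟨l', fun n ↦ ?_, fun n ↦ ?_⟩
  · exact hf.linear_ext (fun (s : S) (n : N) ↦ s • n) (l := l'.comp l) (l' := AddMonoidHom.id N)
      (fun s n ↦ by simp [hl, h1]) (fun s n ↦ rfl) (fun m ↦ by simp [h, h2]) n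
  · exact hf'.linear_ext (fun (s : S) (n : N') ↦ s • n) (l := l.comp l') (l' := AddMonoidHom.id N')
      (fun s n ↦ by simp [hl, h1]) (fun s n ↦ rfl) (fun m ↦ by simp [h, h2]) n

lemma injective (hf : IsBC φ f) (hφ : φ.FaithfullyFlat) : Function.Injective f := by
  let : Algebra R S := φ.toAlgebra
  let : Module R N := Module.compHom N φ
  have : IsScalarTower R S N := ⟨fun a b n ↦ mul_smul (φ a) b n⟩
  have : Module.FaithfullyFlat R S := hφ
  intro a b hab
  apply Module.FaithfullyFlat.tensorProduct_mk_injective (A := R) (B := S) M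
  apply hf.isBaseChange.equiv.injective
  change hf.isBaseChange.equiv (1 ⊗ₜ a) = hf.isBaseChange.equiv (1 ⊗ₜ b)
  rw [IsBaseChange.equiv_tmul, IsBaseChange.equiv_tmul]
  simpa using hab

lemma finite (hf : IsBC φ f) [Module.Finite R M] : Module.Finite S N := by
  let : Algebra R S := φ.toAlgebra
  let : Module R N := Module.compHom N φ
  have : IsScalarTower R S N := ⟨fun a b n ↦ mul_smul (φ a) b n⟩
  exact Module.Finite.equiv hf.isBaseChange.equiv

lemma finite_of_faithfullyFlat (hf : IsBC φ f) (hφ : φ.FaithfullyFlat) [Module.Finite S N] :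
    Module.Finite R M := by
  let : Algebra R S := φ.toAlgebra
  let : Module R N := Module.compHom N φ
  have : IsScalarTower R S N := ⟨fun a b n ↦ mul_smul (φ a) b n⟩
  have : Module.FaithfullyFlat R S := hφ
  have : Module.Finite S (S ⊗[R] M) := Module.Finite.equiv hf.isBaseChange.equiv.symm
  exact Module.Finite.of_finite_tensorProduct_of_faithfullyFlat (R := R) (M := M) S

/-- A linear map that becomes bijective after a faithfully flat base change is bijective. -/
lemma bijective_of_faithfullyFlat {M' N' : Type*} [AddCommGroup M'] [Module R M']
    [AddCommGroup N'] [Module S N'] {f' : M' →+ N'} (hf : IsBC φ f) (hf' : IsBC φ f')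
    (hφ : φ.FaithfullyFlat) {l : M →ₗ[R] M'} {l' : N →ₗ[S] N'} (h : ∀ m, l' (f m) = f' (l m)) :
    (Function.Injective l' → Function.Injective l) ∧
      (Function.Surjective l' → Function.Surjective l) := by
  let : Algebra R S := φ.toAlgebra
  let : Module R N := Module.compHom N φ
  have : IsScalarTower R S N := ⟨fun a b n ↦ mul_smul (φ a) b n⟩
  let : Module R N' := Module.compHom N' φ
  have : IsScalarTower R S N' := ⟨fun a b n ↦ mul_smul (φ a) b n⟩
  have : Module.FaithfullyFlat R S := hφ
  have h1 (z : S ⊗[R] M) : hf'.isBaseChange.equiv (l.lTensor S z) =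
      l' (hf.isBaseChange.equiv z) := by
    induction z with
    | zero => simp
    | add x y hx hy => simp only [map_add, hx, hy]
    | tmul s m =>
      rw [LinearMap.lTensor_tmul, IsBaseChange.equiv_tmul, IsBaseChange.equiv_tmul]
      exact (congrArg (s • ·) (h m).symm).trans (l'.map_smul s _).symm
  have h2 : (l.lTensor S : _ → _) = hf'.isBaseChange.equiv.symm ∘ l' ∘ hf.isBaseChange.equiv := by
    funext z
    simp [← h1]
  constructor
  · intro hi
    rw [← Module.FaithfullyFlat.lTensor_injective_iff_injective R S, h2]
    exact (LinearEquiv.injective _).comp (hi.comp (LinearEquiv.injective _))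
  · intro hs
    rw [← Module.FaithfullyFlat.lTensor_surjective_iff_surjective R S, h2]
    exact (LinearEquiv.surjective _).comp (hs.comp (LinearEquiv.surjective _))

/-- Being a base change map can be checked after a faithfully flat base change of the target. -/
lemma of_faithfullyFlat (hg : IsBC ψ g) (hh : IsBC χ h) (hψ : ψ.FaithfullyFlat)
    (hχ : ∀ r, χ r = ψ (φ r)) (hfg : ∀ m, h m = g (f m)) (hf : ∀ r m, f (r • m) = φ r • f m) :
    IsBC φ f := by
  let : Algebra R S := φ.toAlgebra
  let : Module R N := Module.compHom N φ
  have : IsScalarTower R S N := ⟨fun a b n ↦ mul_smul (φ a) b n⟩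
  let f' : M →ₗ[R] N := { f with map_smul' := hf }
  let l : S ⊗[R] M →ₗ[S] N := (TensorProduct.isBaseChange R M S).lift f'
  have hl (m : M) : l (1 ⊗ₜ m) = f m := (TensorProduct.isBaseChange R M S).lift_eq f' m
  let j : M →+ S ⊗[R] M := (TensorProduct.mk R S M 1).toAddMonoidHom
  have hj : IsBC φ j := (isBC_iff (fun _ ↦ rfl) _).mpr (TensorProduct.isBaseChange R M S)
  let : Algebra S T := ψ.toAlgebra
  let i : S ⊗[R] M →+ T ⊗[S] (S ⊗[R] M) := (TensorProduct.mk S T _ 1).toAddMonoidHom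
  have hi : IsBC ψ i := (isBC_iff (fun _ ↦ rfl) _).mpr (TensorProduct.isBaseChange S _ T)
  obtain ⟨l', h1, h2⟩ := hi.exists_lift (Module.toAddMonoidEnd T L) (g.comp l.toAddMonoidHom)
    fun s m ↦ (congrArg g (l.map_smul s m)).trans (hg.map_smul s _)
  have h3 : Function.Bijective l' :=
    (hj.comp hi hχ (h := i.comp j) fun _ ↦ rfl).bijective_of hh h1 fun m ↦ by
      change l' (i (j m)) = _
      rw [h2, hfg]
      exact congrArg g (hl m)
  have h4 := bijective_of_faithfullyFlat hi hg hψ (l := l)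
    (l' := { l' with map_smul' := h1 }) h2
  have h5 : Function.Bijective l := ⟨h4.1 h3.1, h4.2 h3.2⟩
  exact ⟨hf, .of_equiv (LinearEquiv.ofBijective l h5) hl⟩

end IsBC

end BaseChange

/-! ### Descent along torsors -/

section Torsor

variable {k H R P : Type u} [Field k] [CommRing H] [HopfAlgebra k H] [CommRing R] [Algebra k R]
  [CommRing P] [Algebra k P] [Algebra R P] [IsScalarTower k R P] {ρ : GAction k H P}

open Coaction

/-- The base change along `P → N` of the isomorphism `P ⊗ P ≃ P ⊗ H` that defines a torsor. -/
lemma GAction.IsTorsor.exists_equiv (hT : ρ.IsTorsor R) (N : Type*) [AddCommGroup N] [Module k N]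
    [Module R N] [Module P N] [IsScalarTower R P N] [IsScalarTower k P N] [IsScalarTower k R N] :
    ∃ θ : N ⊗[R] P ≃+ N ⊗[k] H, ∀ n q, θ (n ⊗ₜ q) = tensorAct k P H N H (ρ.coact q) (n ⊗ₜ 1) := by
  obtain ⟨F, hF, hF1, hF2⟩ : ∃ F : P ⊗[R] P →ₐ[R] P ⊗[k] H, Function.Bijective F ∧
      (∀ p, F (p ⊗ₜ 1) = p ⊗ₜ 1) ∧ ∀ q, F (1 ⊗ₜ q) = ρ.coact q :=
    ⟨_, hT.bijective, fun p ↦ by simp,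
      fun q ↦ by simp [← Algebra.TensorProduct.one_def]⟩
  have hF3 (p : P) (z : P ⊗[R] P) : F (p • z) = p • F z := by
    have h1 : p • z = (p ⊗ₜ 1) * z := Algebra.smul_def p z
    rw [h1, map_mul, hF1]
    exact (Algebra.smul_def p _).symm
  let b : P ⊗[R] P →ₗ[P] P ⊗[k] H := { toFun := F, map_add' := map_add F, map_smul' := hF3 }
  let β : P ⊗[R] P ≃ₗ[P] P ⊗[k] H := LinearEquiv.ofBijective b hF
  refine ⟨((AlgebraTensorModule.cancelBaseChange R P P N P).symm ≪≫ₗ (LinearEquiv.lTensor N β ≪≫ₗ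
    AlgebraTensorModule.cancelBaseChange k P P N H)).toAddEquiv, fun n q ↦ ?_⟩
  have h2 : β (1 ⊗ₜ q) = ρ.coact q := hF2 q
  have h3 (z : P ⊗[k] H) : AlgebraTensorModule.cancelBaseChange k P P N H (n ⊗ₜ z) =
      tensorAct k P H N H z (n ⊗ₜ 1) := by
    induction z with
    | zero => simp
    | add x y hx hy => simp only [tmul_add, map_add, LinearMap.add_apply, hx, hy]
    | tmul p h => simp
  refine Eq.trans (b := AlgebraTensorModule.cancelBaseChange k P P N H (LinearEquiv.lTensor N β
    ((AlgebraTensorModule.cancelBaseChange R P P N P).symm (n ⊗ₜ q)))) rfl ?_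
  rw [AlgebraTensorModule.cancelBaseChange_symm_tmul, LinearEquiv.lTensor_tmul, h2, h3]

variable {N : Type*} [AddCommGroup N] [Module k N] [Module R N] [Module P N] [IsScalarTower R P N]
  [IsScalarTower k P N] [IsScalarTower k R N] {d : Coaction k H N}

lemma coact_algebraMap_smul (hT : ρ.IsTorsor R) (hd : d.IsEquivariant ρ) (r : R) (n : N) :
    d.coact (r • n) = r • d.coact n := by
  rw [← algebraMap_smul P r n, hd, hT.invariant, tensorAct_tmul_one, algebraMap_smul]

/-- The `P`-module `N ⊗ H`, on which `P` acts through the coaction `P → P ⊗ H`. -/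
def Twist (_ : GAction k H P) (N : Type*) [AddCommGroup N] [Module k N] := N ⊗[k] H

namespace Twist

instance : AddCommGroup (Twist ρ N) := inferInstanceAs (AddCommGroup (N ⊗[k] H))

instance : Module R (Twist ρ N) := inferInstanceAs (Module R (N ⊗[k] H))

instance : IsScalarTower k R (Twist ρ N) := inferInstanceAs (IsScalarTower k R (N ⊗[k] H))

instance (priority := high) : Module P (Twist ρ N) :=
  Module.compHom (N ⊗[k] H) ((tensorAct k P H N H).comp ρ.coact).toRingHom

instance : IsScalarTower k P (Twist ρ N) := ⟨fun a p z ↦ by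
  have h (z : N ⊗[k] H) : tensorAct k P H N H (ρ.coact (a • p)) z =
      a • tensorAct k P H N H (ρ.coact p) z := by rw [map_smul, map_smul, LinearMap.smul_apply]
  exact h z⟩

end Twist

/-- The invariants of an equivariant module on a torsor `Spec P → Spec R`. -/
def descend (hT : ρ.IsTorsor R) (hd : d.IsEquivariant ρ) : Submodule R N where
  carrier := {n | d.IsInvariant n}
  add_mem' {m n} hm hn := by
    change d.coact (m + n) = (m + n) ⊗ₜ 1
    rw [map_add, hm, hn, add_tmul]
  zero_mem' := by
    change d.coact 0 = 0 ⊗ₜ 1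
    simp
  smul_mem' r n hn := by
    change d.coact (r • n) = (r • n) ⊗ₜ 1
    rw [coact_algebraMap_smul hT hd, hn, smul_tmul']

/-- Descent along torsors: an equivariant module on a torsor is the pullback of its invariants.
With `θ : N ⊗ P ≃ N ⊗ H` induced by the torsor isomorphism, `n ∈ N` has to be shown to come from
`descend ⊗ P`, and the candidate is `θ⁻¹ (d n)`. It lies in `descend ⊗ P` by flatness, since the
analogue `κ` of `θ` for `N ⊗ H` turns the two sides of the equation defining the invariants into
the two sides of the coassociativity of `d`. -/
lemma isBaseChange_descend (hT : ρ.IsTorsor R) (hd : d.IsEquivariant ρ) :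
    IsBaseChange P (descend hT hd).subtype := by
  have := hT.faithfullyFlat
  obtain ⟨θ, hθ⟩ := hT.exists_equiv N
  obtain ⟨κ, hκ, hκ'⟩ : ∃ κ : (N ⊗[k] H) ⊗[R] P →+ (N ⊗[k] H) ⊗[k] H, Function.Injective κ ∧
      ∀ z q, κ (z ⊗ₜ q) = ((tensorAct k P H N H).toLinearMap.flip z ∘ₗ
        ρ.coact.toLinearMap).rTensor H (ρ.coact q) := by
    have : IsScalarTower R P (Twist ρ N) := ⟨fun r p z ↦ by
      have h (z : N ⊗[k] H) : tensorAct k P H N H (ρ.coact (r • p)) z =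
          r • tensorAct k P H N H (ρ.coact p) z := by
        rw [Algebra.smul_def, map_mul, map_mul, hT.invariant, Module.End.mul_apply,
          tensorAct_tmul_one, algebraMap_smul]
      exact h z⟩
    obtain ⟨κ, hκ⟩ := hT.exists_equiv (Twist ρ N)
    refine ⟨κ.toAddMonoidHom, κ.injective, fun z q ↦ ?_⟩
    refine (hκ z q).trans ?_
    generalize ρ.coact q = y
    induction y with
    | zero => simp; rfl
    | add x y hx hy => simp only [map_add, LinearMap.add_apply, hx, hy]; rfl
    | tmul p h =>
      refine (tensorAct_tmul (M := Twist ρ N) p h z 1).trans ?_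
      rw [smul_eq_mul, mul_one]
      rfl
  let u : N →ₗ[R] N ⊗[k] H := { d.coact with map_smul' := coact_algebraMap_smul hT hd }
  let v : N →ₗ[R] N ⊗[k] H :=
    { toFun := fun n ↦ n ⊗ₜ 1
      map_add' := fun m n ↦ add_tmul m n 1
      map_smul' := fun r n ↦ rfl }
  have hu (y : N ⊗[R] P) : κ (u.rTensor P y) = d.coact.rTensor H (θ y) := by
    induction y with
    | zero => simp
    | add x y hx hy => simp only [map_add, hx, hy]
    | tmul n q =>
      rw [LinearMap.rTensor_tmul, hκ', hθ]
      generalize ρ.coact q = y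
      induction y with
      | zero => simp
      | add x y hx hy => simp only [map_add, LinearMap.add_apply, hx, hy]
      | tmul p h => simp [hd p n, u]
  have hv (y : N ⊗[R] P) : κ (v.rTensor P y) = (TensorProduct.assoc k N H H).symm
      ((Coalgebra.comul : H →ₗ[k] H ⊗[k] H).lTensor N (θ y)) := by
    induction y with
    | zero => simp
    | add x y hx hy => simp only [map_add, hx, hy]
    | tmul n q =>
      rw [LinearMap.rTensor_tmul, hκ', hθ]
      let s : P →ₗ[k] N := (LinearMap.toSpanSingleton P N n).restrictScalars k
      have h1 (y : P ⊗[k] H) : ((tensorAct k P H N H).toLinearMap.flip (v n) ∘ₗ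
          ρ.coact.toLinearMap).rTensor H y = (TensorProduct.assoc k N H H).symm
            (s.rTensor (H ⊗[k] H)
              (TensorProduct.assoc k P H H (ρ.coact.toLinearMap.rTensor H y))) := by
        induction y with
        | zero => simp
        | add x y hx hy => simp only [map_add, hx, hy]
        | tmul p h =>
          simp only [LinearMap.rTensor_tmul, LinearMap.comp_apply, AlgHom.toLinearMap_apply,
            LinearMap.flip_apply]
          generalize ρ.coact p = y
          induction y with
          | zero => simp
          | add x y hx hy => simp only [map_add, LinearMap.add_apply, add_tmul, hx, hy]
          | tmul p' h' =>
            change tensorAct k P H N H (p' ⊗ₜ h') (n ⊗ₜ 1) ⊗ₜ h = _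
            simp [s]
      have h2 (y : P ⊗[k] H) : (Coalgebra.comul : H →ₗ[k] H ⊗[k] H).lTensor N
          (tensorAct k P H N H y (n ⊗ₜ 1)) = s.rTensor (H ⊗[k] H)
            ((Coalgebra.comul : H →ₗ[k] H ⊗[k] H).lTensor P y) := by
        induction y with
        | zero => simp
        | add x y hx hy => simp only [map_add, LinearMap.add_apply, hx, hy]
        | tmul p h => simp [s]
      rw [h1, h2]
      congr 2
      exact ρ.toCoaction.coassoc q
  have hex : Function.Exact (descend hT hd).subtype (u - v) := by
    intro n
    rw [LinearMap.sub_apply, sub_eq_zero]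
    exact ⟨fun h ↦ ⟨⟨n, h⟩, rfl⟩, by rintro ⟨m, rfl⟩; exact m.2⟩
  have hex' := Module.Flat.rTensor_exact P hex
  let l : P ⊗[R] descend hT hd →ₗ[P] N :=
    (TensorProduct.isBaseChange R (descend hT hd) P).lift (descend hT hd).subtype
  have hl1 (m) : l (1 ⊗ₜ m) = m :=
    (TensorProduct.isBaseChange R (descend hT hd) P).lift_eq (descend hT hd).subtype m
  have hl2 (p m) : l (p ⊗ₜ m) = p • (m : N) := by
    rw [← hl1, ← map_smul, smul_tmul', smul_eq_mul, mul_one]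
  have hl3 (z) : d.coact (l z) = θ ((descend hT hd).subtype.rTensor P
      (TensorProduct.comm R _ _ z)) := by
    induction z with
    | zero => simp
    | add x y hx hy => simp only [map_add, hx, hy]
    | tmul p m =>
      rw [hl2, hd, show d.coact (m : N) = (m : N) ⊗ₜ 1 from m.2]
      simp [hθ]
  refine .of_equiv (LinearEquiv.ofBijective l ⟨fun a b hab ↦ ?_, fun n ↦ ?_⟩) hl1
  · have := congrArg d.coact hab
    rw [hl3, hl3] at this
    exact (TensorProduct.comm R _ _).injective (Module.Flat.rTensor_preserves_injective_linearMap _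
      (descend hT hd).subtype_injective (θ.injective this))
  · obtain ⟨y, hy⟩ := (hex' (θ.symm (d.coact n))).mp (by
      rw [LinearMap.rTensor_sub, LinearMap.sub_apply, sub_eq_zero]
      apply hκ
      rw [hu, hv, θ.apply_symm_apply, LinearEquiv.eq_symm_apply]
      exact d.coassoc n)
    refine ⟨(TensorProduct.comm R _ _).symm y, ?_⟩
    have h := hl3 ((TensorProduct.comm R _ _).symm y)
    rw [LinearEquiv.apply_symm_apply, hy, θ.apply_symm_apply] at h
    rw [← d.counit n, ← h, d.counit]

omit [Module R N] [IsScalarTower R P N] [IsScalarTower k R N] in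
/-- If `N` is the base change of an `R`-module `Y` with trivial action, then `Y` is the module of
invariants of `N`. -/
lemma exists_eq_of_isInvariant {Y : Type*} [AddCommGroup Y] [Module R Y] (hT : ρ.IsTorsor R)
    (hd : d.IsEquivariant ρ) {i : Y →+ N} (hi : IsBC (algebraMap R P) i)
    (hinv : ∀ y, d.IsInvariant (i y)) {n : N} (hn : d.IsInvariant n) : ∃ y, i y = n := by
  let : Module R N := Module.compHom N (algebraMap R P)
  have hs (r : R) (n : N) : algebraMap R P r • n = r • n := rfl
  have : IsScalarTower R P N := .of_algebraMap_smul hs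
  have : IsScalarTower k R N := .of_algebraMap_smul fun a n ↦ by
    rw [← hs, ← IsScalarTower.algebraMap_apply, algebraMap_smul]
  have h1 : IsBC (algebraMap R P) (descend hT hd).subtype.toAddMonoidHom :=
    (isBC_iff (fun _ ↦ rfl) _).mpr (isBaseChange_descend hT hd)
  have h2 := IsBC.bijective_of_faithfullyFlat hi h1
    (RingHom.faithfullyFlat_algebraMap_iff.mpr hT.faithfullyFlat)
    (l := { toFun := fun y ↦ ⟨i y, hinv y⟩
            map_add' := fun a b ↦ Subtype.ext (map_add i a b)
            map_smul' := fun r y ↦ Subtype.ext (hi.map_smul r y) })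
    (l' := LinearMap.id) fun y ↦ rfl
  obtain ⟨y, hy⟩ := h2.2 Function.surjective_id ⟨n, hn⟩
  exact ⟨y, congrArg Subtype.val hy⟩

end Torsor

/-! ### Extending coactions along base change -/

section Extension

variable {k H A P : Type u} [Field k] [CommRing H] [HopfAlgebra k H] [CommRing A] [Algebra k A]
  [CommRing P] [Algebra k P] {σ : GAction k H A} {ρ : GAction k H P}

namespace Coaction

/-- A quotient of a representation by a subrepresentation. -/
def ofSurjective {M N : Type*} [AddCommGroup M] [Module k M] [AddCommGroup N] [Module k N]
    (c : Coaction k H M) (π : M →ₗ[k] N) (hπ : Function.Surjective π) (r : N →ₗ[k] N ⊗[k] H)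
    (h : ∀ m, r (π m) = π.rTensor H (c.coact m)) : Coaction k H N where
  coact := r
  coassoc n := by
    obtain ⟨m, rfl⟩ := hπ n
    have h1 (z : (M ⊗[k] H) ⊗[k] H) : TensorProduct.assoc k _ _ _ ((π.rTensor H).rTensor H z) =
        π.rTensor (H ⊗[k] H) (TensorProduct.assoc k _ _ _ z) := by
      rw [LinearMap.rTensor_tensor]; simp
    have h2 (z : M ⊗[k] H) : (Coalgebra.comul : H →ₗ[k] H ⊗[k] H).lTensor N (π.rTensor H z) =
        π.rTensor (H ⊗[k] H) ((Coalgebra.comul : H →ₗ[k] H ⊗[k] H).lTensor M z) := by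
      simp only [← LinearMap.comp_apply, LinearMap.rTensor_comp_lTensor,
        LinearMap.lTensor_comp_rTensor]
    have h3 : r ∘ₗ π = π.rTensor H ∘ₗ c.coact := LinearMap.ext h
    rw [h, h2, ← LinearMap.rTensor_comp_apply, h3, LinearMap.rTensor_comp_apply, h1, c.coassoc]
  counit n := by
    obtain ⟨m, rfl⟩ := hπ n
    change slice N Coalgebra.counit (r (π m)) = π m
    rw [h, slice_rTensor, slice_counit_coact]

variable {F N : Type*} [AddCommGroup F] [Module k F] [Module A F] [IsScalarTower k A F]
  [AddCommGroup N] [Module k N] [Module P N] [IsScalarTower k P N] {c : Coaction k H F}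

lemma rTensor_tensorAct {j : F →ₗ[k] N} {θ : A →ₐ[k] P} (hj : ∀ a f, j (a • f) = θ a • j f)
    (y : A ⊗[k] H) (z : F ⊗[k] H) : j.rTensor H (tensorAct k A H F H y z) =
      tensorAct k P H N H (Algebra.TensorProduct.map θ (AlgHom.id k H) y) (j.rTensor H z) := by
  induction y with
  | zero => simp
  | add y y' hy hy' => simp only [map_add, LinearMap.add_apply, hy, hy']
  | tmul a g =>
    induction z with
    | zero => simp
    | add z z' hz hz' => simp only [map_add, hz, hz']
    | tmul w g' => simp [hj]

/-- The pullback of an equivariant module along an equivariant morphism. -/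
lemma IsEquivariant.exists_extension (hc : c.IsEquivariant σ) {θ : A →ₐ[k] P}
    (hθ : ρ.coact.comp θ = (Algebra.TensorProduct.map θ (AlgHom.id k H)).comp σ.coact)
    {j : F →ₗ[k] N} (hj : IsBC θ.toRingHom j.toAddMonoidHom) :
    ∃ d : Coaction k H N, d.IsEquivariant ρ ∧ c.IsHom d j := by
  have hj' (a : A) (f : F) : j (a • f) = θ a • j f := hj.map_smul a f
  obtain ⟨r, hr1, hr2⟩ := hj.exists_lift
    ((Module.toAddMonoidEnd (Module.End k (N ⊗[k] H)) (N ⊗[k] H)).comp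
      ((tensorAct k P H N H).comp ρ.coact).toRingHom) (j.rTensor H ∘ₗ c.coact).toAddMonoidHom
    fun a f ↦ by
      change j.rTensor H (c.coact (a • f)) = tensorAct k P H N H (ρ.coact (θ a)) (j.rTensor H _)
      rw [hc, rTensor_tensorAct hj']
      congr 2
      exact (DFunLike.congr_fun hθ a).symm
  replace hr1 (p : P) (n : N) : r (p • n) = tensorAct k P H N H (ρ.coact p) (r n) := hr1 p n
  replace hr2 (f : F) : r (j f) = j.rTensor H (c.coact f) := hr2 f
  let r' : N →ₗ[k] N ⊗[k] H :=
    { r with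
      map_smul' := fun a n ↦ by
        change r (a • n) = a • r n
        rw [← algebraMap_smul P a n, hr1, AlgHom.commutes, AlgHom.commutes]
        rfl }
  let π : P ⊗[k] F →ₗ[k] N := TensorProduct.lift ((Algebra.lsmul k k N).toLinearMap.compl₂ j)
  have hπ (p f) : π (p ⊗ₜ f) = p • j f := rfl
  refine ⟨(ρ.toCoaction.tensor c).ofSurjective π (fun n ↦ ?_) r' fun z ↦ ?_, hr1, hr2⟩
  · induction n using hj.induction_on with
    | zero => exact ⟨0, map_zero _⟩
    | add x y hx hy =>
      obtain ⟨x, rfl⟩ := hx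
      obtain ⟨y, rfl⟩ := hy
      exact ⟨x + y, map_add _ _ _⟩
    | smul p f => exact ⟨p ⊗ₜ f, rfl⟩
  · induction z with
    | zero => simp
    | add x y hx hy => simp only [map_add, hx, hy]
    | tmul p f =>
      rw [hπ, tensor_coact_tmul]
      refine (hr1 p (j f)).trans ?_
      rw [hr2]
      change _ = π.rTensor H (pairing P F H (ρ.coact p) (c.coact f))
      generalize ρ.coact p = y
      generalize c.coact f = z
      induction y with
      | zero => simp
      | add y y' hy hy' => simp only [map_add, LinearMap.add_apply, hy, hy']
      | tmul q g =>
        induction z with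
        | zero => simp
        | add z z' hz hz' => simp only [map_add, hz, hz']
        | tmul w g' => simp [hπ]

omit [IsScalarTower k A F] in
/-- A semilinear map of equivariant modules is equivariant if it is so on generators. -/
lemma isHom_of_isBC {P' : Type u} [CommRing P'] [Algebra k P'] {ρ' : GAction k H P'}
    {φ : P →ₐ[k] P'}
    (hφ : ρ'.coact.comp φ = (Algebra.TensorProduct.map φ (AlgHom.id k H)).comp ρ.coact)
    {c : Coaction k H F} {d : Coaction k H N} (hd : d.IsEquivariant ρ)
    {θ : A →ₐ[k] P} {j : F →ₗ[k] N} (hj : IsBC θ.toRingHom j.toAddMonoidHom) (hjc : c.IsHom d j)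
    {N' : Type*} [AddCommGroup N'] [Module k N'] [Module P' N'] [IsScalarTower k P' N']
    {d' : Coaction k H N'} (hd' : d'.IsEquivariant ρ') {l : N →ₗ[k] N'}
    (hl : ∀ (p : P) n, l (p • n) = φ p • l n) (hlj : c.IsHom d' (l ∘ₗ j)) : d.IsHom d' l := by
  refine hj.linear_ext (fun p z ↦ tensorAct k P' H N' H (ρ'.coact (φ p)) z)
    (l := (d'.coact ∘ₗ l).toAddMonoidHom) (l' := (l.rTensor H ∘ₗ d.coact).toAddMonoidHom)
    (fun p n ↦ ?_) (fun p n ↦ ?_) fun f ↦ ?_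
  · change d'.coact (l (p • n)) = _
    rw [hl, hd']
    rfl
  · change l.rTensor H (d.coact (p • n)) = tensorAct k P' H N' H _ (l.rTensor H (d.coact n))
    rw [hd, rTensor_tensorAct hl]
    exact congrArg (fun y ↦ tensorAct k P' H N' H y (l.rTensor H (d.coact n)))
      (DFunLike.congr_fun hφ p).symm
  · change d'.coact (l (j f)) = l.rTensor H (d.coact (j f))
    rw [hjc, ← LinearMap.rTensor_comp_apply]
    exact hlj f

end Coaction

end Extension

/-! ### The trivial torsor -/

section Points

variable {k H : Type u} [Field k] [CommRing H] [HopfAlgebra k H]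

variable (k H) in
/-- The antipode as a homomorphism of algebras. -/
def antipodeHom : H →ₐ[k] H := (WithConv.toConv (AlgHom.id k H))⁻¹.ofConv

lemma antipode_convMul {C : Type*} [CommRing C] [Algebra k C] (a : H →ₐ[k] C) :
    WithConv.toConv (a.comp (antipodeHom k H)) * WithConv.toConv a = 1 := by
  have h := AlgHom.comp_convMul_distrib a (WithConv.toConv (AlgHom.id k H))⁻¹
    (WithConv.toConv (AlgHom.id k H))
  rw [inv_mul_cancel] at h
  refine (congrArg WithConv.toConv h).symm.trans ?_
  ext x
  exact a.commutes _

lemma convMul_antipode {C : Type*} [CommRing C] [Algebra k C] (a : H →ₐ[k] C) :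
    WithConv.toConv a * WithConv.toConv (a.comp (antipodeHom k H)) = 1 := by
  have h := AlgHom.comp_convMul_distrib a (WithConv.toConv (AlgHom.id k H))
    (WithConv.toConv (AlgHom.id k H))⁻¹
  rw [mul_inv_cancel] at h
  refine (congrArg WithConv.toConv h).symm.trans ?_
  ext x
  exact a.commutes _

namespace GAction

variable (k H) in
/-- The trivial torsor `Spec B × G`, on which `G` acts by right translations. -/
def free (B : Type u) [CommRing B] [Algebra k B] : GAction k H (B ⊗[k] H) where
  coact := (Algebra.TensorProduct.assoc k k k B H H).symm.toAlgHom.comp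
    (Algebra.TensorProduct.map (AlgHom.id k B) (Bialgebra.comulAlgHom k H))
  coassoc := by
    refine Algebra.TensorProduct.ext' fun b h ↦ ?_
    let c : B ⊗[k] H →ₗ[k] (B ⊗[k] H) ⊗[k] H := (TensorProduct.assoc k B H H).symm ∘ₗ
      (Coalgebra.comul : H →ₗ[k] H ⊗[k] H).lTensor B
    let L : H ⊗[k] (H ⊗[k] H) →ₗ[k] (B ⊗[k] H) ⊗[k] (H ⊗[k] H) :=
      (TensorProduct.mk k B H b).rTensor (H ⊗[k] H)
    have h1 (z : H ⊗[k] H) : TensorProduct.assoc k (B ⊗[k] H) H H (c.rTensor H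
        ((TensorProduct.assoc k B H H).symm (b ⊗ₜ z))) =
        L (TensorProduct.assoc k H H H ((Coalgebra.comul : H →ₗ[k] H ⊗[k] H).rTensor H z)) := by
      induction z with
      | zero => simp
      | add x y hx hy => simp only [map_add, tmul_add, hx, hy]
      | tmul g h =>
        simp only [TensorProduct.assoc_symm_tmul, LinearMap.rTensor_tmul, c, LinearMap.comp_apply,
          LinearMap.lTensor_tmul, LinearEquiv.coe_coe]
        generalize (Coalgebra.comul g : H ⊗[k] H) = w
        induction w with
        | zero => simp
        | add x y hx hy => simp only [map_add, tmul_add, add_tmul, hx, hy]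
        | tmul e f => simp [L]
    have h2 (z : H ⊗[k] H) : (Coalgebra.comul : H →ₗ[k] H ⊗[k] H).lTensor (B ⊗[k] H)
        ((TensorProduct.assoc k B H H).symm (b ⊗ₜ z)) =
        L ((Coalgebra.comul : H →ₗ[k] H ⊗[k] H).lTensor H z) := by
      induction z with
      | zero => simp
      | add x y hx hy => simp only [map_add, tmul_add, hx, hy]
      | tmul g h => simp [L]
    exact (h1 (Coalgebra.comul h)).trans
      ((congrArg L (Coalgebra.coassoc_apply h)).trans (h2 (Coalgebra.comul h)).symm)
  counit := by
    refine Algebra.TensorProduct.ext' fun b h ↦ ?_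
    have h1 (z : H ⊗[k] H) : TensorProduct.rid k (B ⊗[k] H)
        ((Coalgebra.counit : H →ₗ[k] k).lTensor (B ⊗[k] H)
          ((TensorProduct.assoc k B H H).symm (b ⊗ₜ z))) =
        b ⊗ₜ TensorProduct.rid k H ((Coalgebra.counit : H →ₗ[k] k).lTensor H z) := by
      induction z with
      | zero => simp
      | add x y hx hy => simp only [map_add, tmul_add, hx, hy]
      | tmul g h => simp
    refine (h1 (Coalgebra.comul h)).trans ?_
    simp

section

variable {B : Type u} [CommRing B] [Algebra k B]

lemma free_coact_tmul (b : B) (h : H) : (free k H B).coact (b ⊗ₜ h) =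
    (TensorProduct.assoc k B H H).symm (b ⊗ₜ Coalgebra.comul h) := rfl

/-- The trivial torsor is a torsor. The inverse of `(x, g) ↦ (x, x g)` on `Spec B × G` is
`(x, y) ↦ (x, x⁻¹ y)`; the equations to be checked are expressed in the groups of points of `G`
with values in the coordinate rings. -/
lemma isTorsor_free : (free k H B).IsTorsor B where
  invariant b := by
    change (free k H B).coact (b ⊗ₜ 1) = (b ⊗ₜ 1) ⊗ₜ 1
    rw [free_coact_tmul, Bialgebra.comul_one]
    rfl
  faithfullyFlat := by
    have : Nontrivial H := (Bialgebra.counitAlgHom k H).toRingHom.domain_nontrivial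
    infer_instance
  bijective := by
    set P := B ⊗[k] H
    suffices h : ∀ F : P ⊗[B] P →ₐ[B] P ⊗[k] H, (∀ p, F (p ⊗ₜ 1) = p ⊗ₜ 1) →
        (∀ q, F (1 ⊗ₜ q) = (free k H B).coact q) → Function.Bijective F from
      h _ (fun p ↦ by simp) (fun q ↦ by simp [← Algebra.TensorProduct.one_def])
    intro F hF1 hF2
    let iL : P →ₐ[k] P ⊗[B] P := Algebra.TensorProduct.includeLeft
    let iR : P →ₐ[k] P ⊗[B] P := Algebra.TensorProduct.includeRight.restrictScalars k
    let jL : P →ₐ[k] P ⊗[k] H := Algebra.TensorProduct.includeLeft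
    let γ : WithConv (H →ₐ[k] P ⊗[k] H) := WithConv.toConv Algebra.TensorProduct.includeRight
    let i : H →ₐ[k] P := Algebra.TensorProduct.includeRight
    let a : WithConv (H →ₐ[k] P ⊗[B] P) := WithConv.toConv (iL.comp i)
    let b : WithConv (H →ₐ[k] P ⊗[B] P) := WithConv.toConv (iR.comp i)
    let u : WithConv (H →ₐ[k] P ⊗[k] H) := WithConv.toConv (jL.comp i)
    let a' : WithConv (H →ₐ[k] P ⊗[B] P) := WithConv.toConv (a.ofConv.comp (antipodeHom k H))
    let u' : WithConv (H →ₐ[k] P ⊗[k] H) := WithConv.toConv (u.ofConv.comp (antipodeHom k H))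
    have ha' : a * a' = 1 := convMul_antipode a.ofConv
    have hu' : u' * u = 1 := antipode_convMul u.ofConv
    have hb : (F.restrictScalars k).comp b.ofConv = (u * γ).ofConv := by
      ext h
      rw [AlgHom.convMul_apply]
      refine (hF2 _).trans ?_
      change (free k H B).coact (1 ⊗ₜ h) = _
      rw [free_coact_tmul]
      change _ = Algebra.TensorProduct.lift _ _ _ (Coalgebra.comul h : H ⊗[k] H)
      generalize (Coalgebra.comul h : H ⊗[k] H) = z
      induction z with
      | zero => simp
      | add x y hx hy => simp only [tmul_add, map_add, hx, hy]
      | tmul g h => simp [u, γ, i, jL]; rfl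
    have ha : (F.restrictScalars k).comp a.ofConv = u.ofConv := by
      ext h
      exact hF1 _
    let G : P ⊗[k] H →ₐ[k] P ⊗[B] P :=
      Algebra.TensorProduct.lift iL (a' * b).ofConv fun _ _ ↦ Commute.all _ _
    have hG1 (p : P) : G (p ⊗ₜ 1) = p ⊗ₜ 1 := by simp [G, iL]
    have hGu : G.comp u.ofConv = a.ofConv := by
      ext h
      exact hG1 _
    have hGγ : G.comp γ.ofConv = (a' * b).ofConv := by
      ext h
      simp [G, γ]
    have hGF : (G.comp (F.restrictScalars k)).comp b.ofConv = b.ofConv := by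
      rw [AlgHom.comp_assoc, hb, AlgHom.comp_convMul_distrib, hGu, hGγ]
      exact congrArg WithConv.ofConv ((mul_assoc a a' b).symm.trans
        ((congrArg (· * b) ha').trans (one_mul b)))
    have hFG : ((F.restrictScalars k).comp G).comp γ.ofConv = γ.ofConv := by
      have hai : (F.restrictScalars k).comp a'.ofConv = u'.ofConv := by
        change ((F.restrictScalars k).comp a.ofConv).comp _ = _
        rw [ha]
      rw [AlgHom.comp_assoc, hGγ, AlgHom.comp_convMul_distrib, hai, hb]
      exact congrArg WithConv.ofConv ((mul_assoc u' u γ).symm.trans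
        ((congrArg (· * γ) hu').trans (one_mul γ)))
    refine Function.bijective_iff_has_inverse.mpr ⟨G, fun z ↦ ?_, fun z ↦ ?_⟩
    · induction z with
      | zero => simp
      | add x y hx hy => simp only [map_add, hx, hy]
      | tmul p q =>
        have h1 : p ⊗ₜ[B] q = (p ⊗ₜ 1) * (1 ⊗ₜ q) := by simp
        rw [h1, map_mul, map_mul, hF1, hG1]
        congr 1
        clear h1
        induction q using TensorProduct.induction_on with
        | zero => simp
        | add x y hx hy => simp only [tmul_add, map_add, hx, hy]
        | tmul c h =>
          have h2 : (1 : P) ⊗ₜ[B] (c ⊗ₜ[k] h : P) = ((c ⊗ₜ 1 : P) ⊗ₜ 1) * (1 ⊗ₜ i h) := by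
            have hc : (c ⊗ₜ[k] 1 : P) = c • (1 : P) := by
              simp [P, Algebra.TensorProduct.one_def, smul_tmul']
            rw [hc, TensorProduct.smul_tmul, ← hc, Algebra.TensorProduct.tmul_mul_tmul, one_mul]
            congr 1
            exact (by simp : (c ⊗ₜ[k] h : B ⊗[k] H) = (c ⊗ₜ 1) * (1 ⊗ₜ h))
          rw [h2, map_mul, map_mul, hF1, hG1]
          congr 1
          exact DFunLike.congr_fun hGF h
    · induction z with
      | zero => simp
      | add x y hx hy => simp only [map_add, hx, hy]
      | tmul p h =>
        have h1 : p ⊗ₜ[k] h = (p ⊗ₜ 1) * (1 ⊗ₜ h) := by simp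
        rw [h1, map_mul, map_mul, hG1, hF1]
        congr 1
        exact DFunLike.congr_fun hFG h

end

end GAction

end Points

/-! ### Affine points given by morphisms to `Spec A` -/

section Cover

variable {k H A B C D : Type u} [Field k] [CommRing H] [HopfAlgebra k H] [CommRing A] [Algebra k A]
  [CommRing B] [Algebra k B] [CommRing C] [Algebra k C] [CommRing D] [Algebra k D]
  {σ : GAction k H A}

namespace GAction

lemma free_coact_map (φ : B →ₐ[k] C) :
    (free k H C).coact.comp (Algebra.TensorProduct.map φ (AlgHom.id k H)) =
      (Algebra.TensorProduct.map (Algebra.TensorProduct.map φ (AlgHom.id k H)) (AlgHom.id k H)).comp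
        (free k H B).coact := by
  refine Algebra.TensorProduct.ext' fun b h ↦ ?_
  simp only [AlgHom.comp_apply, Algebra.TensorProduct.map_tmul, AlgHom.id_apply, free_coact_tmul]
  generalize (Coalgebra.comul h : H ⊗[k] H) = z
  induction z with
  | zero => simp
  | add x y hx hy => simp only [tmul_add, map_add, hx, hy]
  | tmul g h => simp

/-- Coassociativity: the coaction is an equivariant map to the free coaction. -/
lemma free_coact_comp_coact (τ : GAction k H B) : (free k H B).coact.comp τ.coact =
    (Algebra.TensorProduct.map τ.coact (AlgHom.id k H)).comp τ.coact := by
  refine AlgHom.ext fun b ↦ ?_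
  apply (TensorProduct.assoc k B H H).injective
  exact ((TensorProduct.assoc k B H H).apply_symm_apply _).trans
    (DFunLike.congr_fun τ.coassoc b).symm

namespace AffinePoint

/-- For a morphism `Spec B → Spec A`, the point of `[Spec A / G]` it defines: the trivial torsor
on `Spec B` together with the morphism `(b, g) ↦ b g`. -/
abbrev ofHom (α : A →ₐ[k] B) : σ.AffinePoint where
  R := B
  P := B ⊗[k] H
  act := GAction.free k H B
  isTorsor := isTorsor_free
  toP := (Algebra.TensorProduct.map α (AlgHom.id k H)).comp σ.coact
  equivariant := by
    rw [← AlgHom.comp_assoc, free_coact_map, AlgHom.comp_assoc, free_coact_comp_coact,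
      ← AlgHom.comp_assoc, ← Algebra.TensorProduct.map_comp, AlgHom.comp_id]

/-- The pullback of a point `Spec R → [Spec A / G]` to its torsor `Spec P`, where the torsor
becomes trivial. -/
abbrev cover (ξ : σ.AffinePoint) : σ.AffinePoint := ofHom ξ.toP

/-- The projection from the torsor of `ξ` to `ξ`. -/
def coverHom (ξ : σ.AffinePoint) : ξ.cover ⟶ ξ where
  base := IsScalarTower.toAlgHom k ξ.R ξ.P
  total := ξ.act.coact
  comm r := ξ.isTorsor.invariant r
  equivariant := free_coact_comp_coact _
  toP_comp := ξ.equivariant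

/-- Morphisms of points of `[Spec A / G]` from morphisms of schemes over `Spec A`. -/
def mapHom {α : A →ₐ[k] B} {β : A →ₐ[k] C} (φ : B →ₐ[k] C) (h : φ.comp α = β) :
    (ofHom β : σ.AffinePoint) ⟶ ofHom α where
  base := φ
  total := Algebra.TensorProduct.map φ (AlgHom.id k H)
  comm b := by simp
  equivariant := free_coact_map φ
  toP_comp := by
    rw [← AlgHom.comp_assoc, ← Algebra.TensorProduct.map_comp, AlgHom.comp_id, h]

lemma mapHom_comp {α : A →ₐ[k] B} {β : A →ₐ[k] C} {γ : A →ₐ[k] D} (φ : B →ₐ[k] C)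
    (h : φ.comp α = β) (ψ : C →ₐ[k] D) (h' : ψ.comp β = γ) :
    (mapHom ψ h' ≫ mapHom φ h : (ofHom γ : σ.AffinePoint) ⟶ ofHom α) =
      mapHom (ψ.comp φ) (by rw [AlgHom.comp_assoc, h, h']) := by
  refine Hom.ext rfl ?_
  change (Algebra.TensorProduct.map ψ (AlgHom.id k H)).comp
    (Algebra.TensorProduct.map φ (AlgHom.id k H)) = _
  rw [← Algebra.TensorProduct.map_comp, AlgHom.comp_id]
  rfl

lemma coverHom_naturality {ξ η : σ.AffinePoint} (u : ξ ⟶ η) :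
    (mapHom (Hom.total u) (Hom.toP_comp u) : ξ.cover ⟶ η.cover) ≫ coverHom η =
      coverHom ξ ≫ u :=
  Hom.ext (AlgHom.ext fun r ↦ Hom.comm u r) (Hom.equivariant u).symm

/-- The two projections from `Spec P × G`, identified with `Spec P ×_{Spec R} Spec P`, to a point
on `Spec R`. -/
lemma coverHom_coverHom (ξ : σ.AffinePoint) :
    coverHom ξ.cover ≫ coverHom ξ = mapHom ξ.act.coact ξ.equivariant ≫ coverHom ξ :=
  Hom.ext (AlgHom.ext fun r ↦ (ξ.isTorsor.invariant r).symm) (free_coact_comp_coact ξ.act)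

variable (k H B) in
/-- The comorphism of the unit section `Spec B → Spec B × G`. -/
def unitSection : B ⊗[k] H →ₐ[k] B :=
  (Algebra.TensorProduct.rid k k B).toAlgHom.comp
    (Algebra.TensorProduct.map (AlgHom.id k B) (Bialgebra.counitAlgHom k H))

lemma unitSection_tmul (b : B) (h : H) :
    unitSection k H B (b ⊗ₜ h) = (Coalgebra.counit h : k) • b := by
  simp [unitSection]

lemma unitSection_comp_toP (α : A →ₐ[k] B) :
    (unitSection k H B).comp (ofHom α : σ.AffinePoint).toP = α := by
  have h : (unitSection k H B).comp (Algebra.TensorProduct.map α (AlgHom.id k H)) =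
      α.comp (unitSection k H A) := by
    refine Algebra.TensorProduct.ext' fun a h ↦ ?_
    simp [unitSection_tmul]
  change ((unitSection k H B).comp ((Algebra.TensorProduct.map α (AlgHom.id k H)).comp σ.coact)) = α
  rw [← AlgHom.comp_assoc, h, AlgHom.comp_assoc]
  exact (congrArg α.comp σ.counit).trans (AlgHom.comp_id α)

lemma unitSection_coverHom (α : A →ₐ[k] B) :
    mapHom (unitSection k H B) (unitSection_comp_toP α) ≫ coverHom (ofHom α : σ.AffinePoint) =
      𝟙 _ := by
  refine Hom.ext (AlgHom.ext fun b ↦ ?_) (Algebra.TensorProduct.ext' fun b h ↦ ?_)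
  · change unitSection k H B (b ⊗ₜ 1) = b
    rw [unitSection_tmul, Bialgebra.counit_one, one_smul]
  · change Algebra.TensorProduct.map (unitSection k H B) (AlgHom.id k H)
      ((free k H B).coact (b ⊗ₜ h)) = b ⊗ₜ h
    have h1 (z : H ⊗[k] H) : Algebra.TensorProduct.map (unitSection k H B) (AlgHom.id k H)
        ((TensorProduct.assoc k B H H).symm (b ⊗ₜ z)) =
        b ⊗ₜ TensorProduct.lid k H ((Coalgebra.counit : H →ₗ[k] k).rTensor H z) := by
      induction z with
      | zero => simp
      | add x y hx hy => simp only [tmul_add, map_add, hx, hy]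
      | tmul g h => simp [unitSection_tmul, smul_tmul]
    rw [free_coact_tmul, h1]
    simp

lemma mapHom_congr {α : A →ₐ[k] B} {β : A →ₐ[k] C} {φ ψ : B →ₐ[k] C} (h : φ.comp α = β)
    (e : φ = ψ) : (mapHom φ h : (ofHom β : σ.AffinePoint) ⟶ ofHom α) = mapHom ψ (e ▸ h) := by
  subst e
  rfl

end AffinePoint

end GAction

end Cover

/-! ### Quasi-coherent modules as families of modules -/

section Family

variable {k H A B C : Type u} [Field k] [CommRing H] [HopfAlgebra k H] [CommRing A] [Algebra k A]
  [CommRing B] [Algebra k B] [CommRing C] [Algebra k C] {σ : GAction k H A}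

/-- If `E'` is the pullback of a `B`-module `E` to `Spec B × G`, then `E' = E ⊗ H`. -/
lemma IsBC.bijective_tensor {E E' : Type*} [AddCommGroup E] [Module B E] [Module k E]
    [IsScalarTower k B E] [AddCommGroup E'] [Module (B ⊗[k] H) E'] [Module k E'] {j : E →+ E'}
    (hj : IsBC (algebraMap B (B ⊗[k] H)) j) (s : E ⊗[k] H →ₗ[k] E')
    (hs : ∀ m h, s (m ⊗ₜ h) = ((1 : B) ⊗ₜ[k] h) • j m) : Function.Bijective s := by
  let : Module B E' := Module.compHom E' (algebraMap B (B ⊗[k] H))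
  have : IsScalarTower B (B ⊗[k] H) E' := .of_algebraMap_smul fun _ _ ↦ rfl
  let j' : E →ₗ[B] E' := { j with map_smul' := hj.map_smul }
  have hj' : IsBaseChange (B ⊗[k] H) j' := (isBC_iff (fun _ ↦ rfl) j').mp hj
  let c := AlgebraTensorModule.cancelBaseChange k B B E H
  have h (z) : s z = hj'.equiv (TensorProduct.comm B _ _ (c.symm z)) := by
    induction z with
    | zero => simp
    | add x y hx hy => simp only [map_add, hx, hy]
    | tmul m h =>
      rw [hs, AlgebraTensorModule.cancelBaseChange_symm_tmul, TensorProduct.comm_tmul,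
        IsBaseChange.equiv_tmul]
      rfl
  rw [show ⇑s = hj'.equiv ∘ TensorProduct.comm B _ _ ∘ c.symm from funext h]
  exact hj'.equiv.bijective.comp ((LinearEquiv.bijective _).comp c.symm.bijective)

namespace GAction

open Coaction AffinePoint

/-- A quasi-coherent module on the substack of `[Spec A / G]` whose affine points are those with
the property `Q`. -/
structure Family (Q : ObjectProperty σ.AffinePoint) where
  /-- the modules -/
  obj (ξ : σ.AffinePoint) : Q ξ → Type u
  [addCommGroup (ξ : σ.AffinePoint) (h : Q ξ) : AddCommGroup (obj ξ h)]
  [module (ξ : σ.AffinePoint) (h : Q ξ) : Module ξ.R (obj ξ h)]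
  /-- the restriction maps -/
  res {ξ η : σ.AffinePoint} (hξ : Q ξ) (hη : Q η) (u : ξ ⟶ η) : obj η hη →+ obj ξ hξ
  res_id {ξ : σ.AffinePoint} (hξ : Q ξ) (m : obj ξ hξ) : res hξ hξ (𝟙 ξ) m = m
  res_comp {ξ η ζ : σ.AffinePoint} (hξ : Q ξ) (hη : Q η) (hζ : Q ζ) (u : ξ ⟶ η) (v : η ⟶ ζ)
    (m : obj ζ hζ) : res hξ hζ (u ≫ v) m = res hξ hη u (res hη hζ v m)
  isBC {ξ η : σ.AffinePoint} (hξ : Q ξ) (hη : Q η) (u : ξ ⟶ η) :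
    IsBC (Hom.base u).toRingHom (res hξ hη u)

namespace Family

attribute [instance] Family.addCommGroup Family.module

variable {Q : ObjectProperty σ.AffinePoint} (M N : Family Q)

instance (ξ : σ.AffinePoint) (h : Q ξ) : Module k (M.obj ξ h) :=
  Module.compHom _ (algebraMap k ξ.R)

instance (ξ : σ.AffinePoint) (h : Q ξ) : IsScalarTower k ξ.R (M.obj ξ h) :=
  .of_algebraMap_smul fun _ _ ↦ rfl

instance (α : A →ₐ[k] B) (h : Q (ofHom α)) : Module B (M.obj (ofHom α) h) :=
  M.module (ofHom α) h

instance (α : A →ₐ[k] B) (h : Q (ofHom α)) : IsScalarTower k B (M.obj (ofHom α) h) :=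
  .of_algebraMap_smul fun _ _ ↦ rfl

variable {M N}

lemma res_smul {ξ η : σ.AffinePoint} (hξ : Q ξ) (hη : Q η) (u : ξ ⟶ η) (r : η.R)
    (m : M.obj η hη) : M.res hξ hη u (r • m) = Hom.base u r • M.res hξ hη u m :=
  (M.isBC hξ hη u).map_smul r m

lemma res_mapHom_smul {α : A →ₐ[k] B} {β : A →ₐ[k] C} (hα : Q (ofHom α)) (hβ : Q (ofHom β))
    (φ : B →ₐ[k] C) (h : φ.comp α = β) (b : B) (m : M.obj (ofHom α) hα) :
    M.res hβ hα (mapHom φ h) (b • m) = φ b • M.res hβ hα (mapHom φ h) m :=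
  res_smul hβ hα (mapHom φ h) b m

lemma res_coverHom_smul {ξ : σ.AffinePoint} (hξ : Q ξ) (hξ' : Q ξ.cover) (r : ξ.R)
    (m : M.obj ξ hξ) : M.res hξ' hξ (coverHom ξ) (r • m) =
      algebraMap ξ.R ξ.P r • M.res hξ' hξ (coverHom ξ) m :=
  res_smul hξ' hξ (coverHom ξ) r m

lemma res_algebraMap_smul {ξ η : σ.AffinePoint} (hξ : Q ξ) (hη : Q η) (u : ξ ⟶ η) (a : k)
    (m : M.obj η hη) : M.res hξ hη u (a • m) = a • M.res hξ hη u m := by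
  rw [← algebraMap_smul η.R, res_smul, AlgHom.commutes, algebraMap_smul]

variable (M) in
/-- The restriction maps are linear over the base field. -/
def resₗ {ξ η : σ.AffinePoint} (hξ : Q ξ) (hη : Q η) (u : ξ ⟶ η) :
    M.obj η hη →ₗ[k] M.obj ξ hξ :=
  { M.res hξ hη u with map_smul' := res_algebraMap_smul hξ hη u }

section Shift

variable {α : A →ₐ[k] B} (hα : Q (ofHom α)) (hα' : Q (ofHom α).cover)

variable (M) in
/-- The isomorphism of `M ⊗ H` with the pullback of `M` along the projection
`Spec B × G → Spec B`, for a module `M` on `Spec B`. -/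
def shift : M.obj (ofHom α) hα ⊗[k] H →ₗ[k] M.obj (ofHom α).cover hα' :=
  TensorProduct.lift (LinearMap.mk₂ k (fun m h ↦ ((1 : B) ⊗ₜ[k] h : (ofHom α : σ.AffinePoint).P) •
      M.res hα' hα (coverHom (ofHom α)) m)
    (fun m m' h ↦ by rw [map_add, smul_add])
    (fun a m h ↦ by rw [res_algebraMap_smul, smul_comm])
    (fun m h h' ↦ by rw [tmul_add, add_smul])
    (fun a m h ↦ by rw [tmul_smul, smul_assoc]))

lemma shift_tmul (m : M.obj (ofHom α) hα) (h : H) : M.shift hα hα' (m ⊗ₜ h) =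
    ((1 : B) ⊗ₜ[k] h : (ofHom α : σ.AffinePoint).P) • M.res hα' hα (coverHom (ofHom α)) m := rfl

lemma shift_bijective : Function.Bijective (M.shift hα hα') :=
  (M.isBC hα' hα (coverHom (ofHom α))).bijective_tensor (B := B) (H := H) _ (shift_tmul hα hα')

lemma shift_tensorAct (y : B ⊗[k] H) (z : M.obj (ofHom α) hα ⊗[k] H) :
    M.shift hα hα' (tensorAct k B H (M.obj (ofHom α) hα) H y z) =
      (y : (ofHom α : σ.AffinePoint).P) • M.shift hα hα' z := by
  induction y with
  | zero => simp
  | add x y hx hy => simp only [map_add, LinearMap.add_apply, hx, hy, add_smul]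
  | tmul b g =>
    induction z with
    | zero => simp
    | add x y hx hy => simp only [map_add, smul_add, hx, hy]
    | tmul m h =>
      have h1 : M.res hα' hα (coverHom (ofHom α)) (b • m) = (b ⊗ₜ 1 : (ofHom α : σ.AffinePoint).P) •
        M.res hα' hα (coverHom (ofHom α)) m := res_coverHom_smul hα hα' b m
      rw [tensorAct_tmul, shift_tmul, shift_tmul, h1, ← mul_smul, ← mul_smul]
      congr 1
      simp

/-- Restriction along a map of trivial torsors, after the identification `shift`. -/
lemma shift_rTensor_res {β : A →ₐ[k] C} (hβ : Q (ofHom β)) (hβ' : Q (ofHom β).cover)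
    (φ : B →ₐ[k] C) (h : φ.comp α = β) (z : M.obj (ofHom α) hα ⊗[k] H) :
    M.shift hβ hβ' ((M.resₗ hβ hα (mapHom φ h)).rTensor H z) =
      M.res hβ' hα' (mapHom (Hom.total (mapHom φ h)) (Hom.toP_comp (mapHom φ h)))
        (M.shift hα hα' z) := by
  induction z with
  | zero => simp
  | add x y hx hy => simp only [map_add, hx, hy]
  | tmul m g =>
    rw [LinearMap.rTensor_tmul, shift_tmul, shift_tmul]
    refine Eq.trans ?_ (res_mapHom_smul hα' hβ' (Hom.total (mapHom φ h))
      (Hom.toP_comp (mapHom φ h)) ((1 : B) ⊗ₜ[k] g) _).symm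
    rw [← res_comp, coverHom_naturality, M.res_comp hβ' hβ hα]
    congr 1
    change _ = Algebra.TensorProduct.map φ (AlgHom.id k H) ((1 : B) ⊗ₜ[k] g)
    simp

end Shift

variable (hQ : ∀ ⦃ξ η : σ.AffinePoint⦄, (ξ ⟶ η) → Q η → Q ξ)

section Coaction

variable {α : A →ₐ[k] B} (hα : Q (ofHom α)) {τ : GAction k H B}
  (hτ : τ.coact.comp α = (Algebra.TensorProduct.map α (AlgHom.id k H)).comp σ.coact)

include hQ in
lemma exists_coaction : ∃ c : Coaction k H (M.obj (ofHom α) hα), ∀ m,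
    M.shift hα (hQ (coverHom _) hα) (c.coact m) =
      M.res (hQ (coverHom _) hα) hα (mapHom τ.coact hτ) m := by
  have hα' := hQ (coverHom _) hα
  have hα'' := hQ (coverHom _) hα'
  set E := M.obj (ofHom α) hα
  let e : E ⊗[k] H ≃ₗ[k] M.obj (ofHom α).cover hα' :=
    LinearEquiv.ofBijective (M.shift hα hα') (shift_bijective hα hα')
  let r : E →ₗ[k] E ⊗[k] H := e.symm.toLinearMap ∘ₗ M.resₗ hα' hα (mapHom τ.coact hτ)
  have hr (m : E) : M.shift hα hα' (r m) = M.res hα' hα (mapHom τ.coact hτ) m :=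
    e.apply_symm_apply _
  refine ⟨{ coact := r, coassoc := fun m ↦ ?_, counit := fun m ↦ ?_}, hr⟩
  · rw [← LinearEquiv.eq_symm_apply]
    let q : (ofHom α : σ.AffinePoint).cover ⟶ ofHom α := mapHom τ.coact hτ
    let X : (E ⊗[k] H) ⊗[k] H →ₗ[k] M.obj (ofHom α).cover.cover hα'' :=
      M.shift hα' hα'' ∘ₗ (M.shift hα hα').rTensor H
    have hX : Function.Injective X := (shift_bijective hα' hα'').1.comp
      (Module.Flat.rTensor_preserves_injective_linearMap _ (shift_bijective hα hα').1)
    have hX1 (z : E ⊗[k] H) : X (r.rTensor H z) =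
        M.res hα'' hα' (mapHom (Hom.total q) (Hom.toP_comp q)) (M.shift hα hα' z) := by
      rw [← shift_rTensor_res hα hα' hα' hα'' τ.coact hτ z]
      change M.shift hα' hα'' ((M.shift hα hα').rTensor H (r.rTensor H z)) = _
      rw [← LinearMap.rTensor_comp_apply]
      exact congrArg (fun f ↦ M.shift hα' hα'' (LinearMap.rTensor H f z)) (LinearMap.ext hr)
    have hX2 (z : E ⊗[k] H) : X ((TensorProduct.assoc k E H H).symm
        ((Coalgebra.comul : H →ₗ[k] H ⊗[k] H).lTensor E z)) =
        M.res hα'' hα' (mapHom (free k H B).coact (ofHom α : σ.AffinePoint).equivariant)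
          (M.shift hα hα' z) := by
      induction z with
      | zero => simp
      | add x y hx hy => simp only [map_add, hx, hy]
      | tmul m h =>
        have h1 (w : H ⊗[k] H) : X ((TensorProduct.assoc k E H H).symm (m ⊗ₜ w)) =
            ((TensorProduct.assoc k B H H).symm (1 ⊗ₜ w) : (ofHom α : σ.AffinePoint).cover.P) •
              M.res hα'' hα' (coverHom _) (M.res hα' hα (coverHom _) m) := by
          induction w with
          | zero =>
            rw [tmul_zero, tmul_zero, map_zero, map_zero, map_zero]
            exact Eq.symm (zero_smul (ofHom α : σ.AffinePoint).cover.P _)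
          | add x y hx hy => simp only [map_add, tmul_add, hx, hy, add_smul]
          | tmul g h =>
            change M.shift hα' hα'' (M.shift hα hα' (m ⊗ₜ g) ⊗ₜ h) = _
            rw [shift_tmul, shift_tmul]
            have h2 : M.res hα'' hα' (coverHom (ofHom α).cover)
                (((1 : B) ⊗ₜ[k] g : (ofHom α : σ.AffinePoint).P) •
                  M.res hα' hα (coverHom (ofHom α)) m) =
              ((((1 : B) ⊗ₜ[k] g) ⊗ₜ 1 : (B ⊗[k] H) ⊗[k] H) :
                (ofHom α : σ.AffinePoint).cover.P) •
                M.res hα'' hα' (coverHom _) (M.res hα' hα (coverHom _) m) :=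
              res_coverHom_smul (ξ := (ofHom α).cover) hα' hα'' _ _
            rw [h2, ← mul_smul]
            congr 1
            simp
        rw [LinearMap.lTensor_tmul, h1, shift_tmul]
        refine Eq.trans ?_ (res_mapHom_smul hα' hα'' (free k H B).coact
          (ofHom α : σ.AffinePoint).equivariant ((1 : B) ⊗ₜ[k] h) _).symm
        rw [← M.res_comp, ← M.res_comp]
        refine congrArg₂ _ rfl ?_
        exact congrArg (fun u ↦ M.res hα'' hα u m) (coverHom_coverHom (ofHom α))
    apply hX
    rw [hX1, hX2, hr, ← M.res_comp, ← M.res_comp]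
    congr 2
    refine (mapHom_comp _ _ _ _).trans (Eq.trans ?_ (mapHom_comp _ _ _ _).symm)
    exact mapHom_congr _ (free_coact_comp_coact τ).symm
  · let s : (ofHom α : σ.AffinePoint) ⟶ (ofHom α).cover :=
      mapHom (unitSection k H B) (unitSection_comp_toP α)
    have h1 (z : E ⊗[k] H) : M.res hα hα' s (M.shift hα hα' z) =
        TensorProduct.rid k E ((Coalgebra.counit : H →ₗ[k] k).lTensor E z) := by
      induction z with
      | zero => simp
      | add x y hx hy => simp only [map_add, hx, hy]
      | tmul m h =>
        rw [shift_tmul]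
        refine (res_mapHom_smul hα' hα (unitSection k H B) (unitSection_comp_toP α)
          ((1 : B) ⊗ₜ[k] h) _).trans ?_
        rw [unitSection_tmul, ← M.res_comp, unitSection_coverHom, M.res_id]
        simp
    rw [← h1, hr, ← M.res_comp, mapHom_comp,
      mapHom_congr (ψ := AlgHom.id k B) _
        (show (unitSection k H B).comp τ.coact = AlgHom.id k B from τ.counit)]
    refine Eq.trans (congrArg (fun u ↦ M.res hα hα u m) ?_) (M.res_id hα m)
    exact Hom.ext rfl (Algebra.TensorProduct.map_id)

variable (M) in
/-- The coaction on the value of a module on `[Spec A / G]` at an equivariant morphism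
`Spec B → Spec A`. -/
def coaction : Coaction k H (M.obj (ofHom α) hα) := (exists_coaction hQ hα hτ).choose

lemma shift_coact (m : M.obj (ofHom α) hα) :
    M.shift hα (hQ (coverHom _) hα) ((M.coaction hQ hα hτ).coact m) =
      M.res (hQ (coverHom _) hα) hα (mapHom τ.coact hτ) m :=
  (exists_coaction hQ hα hτ).choose_spec m

lemma isEquivariant_coaction : (M.coaction hQ hα hτ).IsEquivariant τ := fun b m ↦ by
  apply (shift_bijective hα (hQ (coverHom _) hα)).1
  rw [shift_tensorAct, shift_coact, shift_coact]
  exact res_mapHom_smul hα (hQ (coverHom _) hα) τ.coact hτ b m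

lemma isHom_resₗ {β : A →ₐ[k] C} (hβ : Q (ofHom β)) {τ' : GAction k H C}
    (hτ' : τ'.coact.comp β = (Algebra.TensorProduct.map β (AlgHom.id k H)).comp σ.coact)
    (φ : B →ₐ[k] C) (h : φ.comp α = β)
    (hφ : τ'.coact.comp φ = (Algebra.TensorProduct.map φ (AlgHom.id k H)).comp τ.coact) :
    (M.coaction hQ hα hτ).IsHom (M.coaction hQ hβ hτ') (M.resₗ hβ hα (mapHom φ h)) := fun m ↦ by
  apply (shift_bijective hβ (hQ (coverHom _) hβ)).1
  rw [shift_coact, shift_rTensor_res hα (hQ (coverHom _) hα), shift_coact]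
  refine (M.res_comp _ _ _ _ _ m).symm.trans (Eq.trans ?_ (M.res_comp _ _ _ _ _ m))
  congr 2
  refine (mapHom_comp _ _ _ _).trans (Eq.trans ?_ (mapHom_comp _ _ _ _).symm)
  exact mapHom_congr _ hφ

lemma isInvariant_iff (m : M.obj (ofHom α) hα) : (M.coaction hQ hα hτ).IsInvariant m ↔
    M.res (hQ (coverHom _) hα) hα (mapHom τ.coact hτ) m =
      M.res (hQ (coverHom _) hα) hα (coverHom _) m := by
  rw [Coaction.IsInvariant, ← (shift_bijective hα (hQ (coverHom _) hα)).1.eq_iff, shift_coact,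
    shift_tmul, ← Algebra.TensorProduct.one_def, one_smul]

end Coaction

end Family

end GAction

end Family

/-! ### The module associated with an equivariant module -/

section Associated

variable {k H A P P' P'' R : Type u} [Field k] [CommRing H] [HopfAlgebra k H] [CommRing A]
  [Algebra k A] [CommRing P] [Algebra k P] [CommRing P'] [Algebra k P'] [CommRing P'']
  [Algebra k P''] {σ : GAction k H A}

open Coaction

/-- The pullback `P ⊗ F` of an `A`-module `F` along `θ : A → P`. -/
def Pull (θ : A →ₐ[k] P) (F : Type u) [AddCommGroup F] [Module A F] : Type u :=
  letI := θ.toAlgebra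
  P ⊗[A] F

namespace Pull

variable (θ : A →ₐ[k] P) (F : Type u) [AddCommGroup F] [Module A F]

instance : AddCommGroup (Pull θ F) :=
  letI := θ.toAlgebra
  show AddCommGroup (P ⊗[A] F) from inferInstance

instance : Module P (Pull θ F) :=
  letI := θ.toAlgebra
  show Module P (P ⊗[A] F) from inferInstance

instance : Module k (Pull θ F) := Module.compHom _ (algebraMap k P)

instance : IsScalarTower k P (Pull θ F) := .of_algebraMap_smul fun _ _ ↦ rfl

variable [Module k F] [IsScalarTower k A F]

/-- The canonical map `f ↦ 1 ⊗ f`. -/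
def of : F →ₗ[k] Pull θ F :=
  letI := θ.toAlgebra
  letI := Module.compHom (P ⊗[A] F) (algebraMap k P)
  { TensorProduct.mk A P F 1 with
    map_smul' a f := by
      change (1 : P) ⊗ₜ[A] (a • f) = algebraMap k P a • (1 ⊗ₜ[A] f)
      rw [← algebraMap_smul A a f, tmul_smul, smul_tmul', smul_tmul', smul_eq_mul, mul_one,
        Algebra.smul_def, mul_one]
      exact congrArg (· ⊗ₜ[A] f) (θ.commutes a) }

lemma isBC_of : IsBC θ.toRingHom (of θ F).toAddMonoidHom :=
  letI := θ.toAlgebra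
  (isBC_iff (fun _ ↦ rfl) (TensorProduct.mk A P F 1)).mpr (TensorProduct.isBaseChange A F P)

variable {θ F}

lemma of_smul (a : A) (f : F) : of θ F (a • f) = θ a • of θ F f := (isBC_of θ F).map_smul a f

@[elab_as_elim]
lemma induction_on {motive : Pull θ F → Prop} (z : Pull θ F) (zero : motive 0)
    (add : ∀ x y, motive x → motive y → motive (x + y))
    (smul : ∀ (p : P) (f : F), motive (p • of θ F f)) : motive z :=
  (isBC_of θ F).induction_on z zero add smul

variable (F) in
lemma exists_map (φ : P →ₐ[k] P') {θ' : A →ₐ[k] P'} (h : φ.comp θ = θ') :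
    ∃ l : Pull θ F →ₗ[k] Pull θ' F, (∀ p z, l (p • z) = φ p • l z) ∧
      ∀ f, l (of θ F f) = of θ' F f := by
  obtain ⟨l, h1, h2⟩ := (isBC_of θ F).exists_lift
    ((Module.toAddMonoidEnd P' (Pull θ' F)).comp φ.toRingHom) (of θ' F).toAddMonoidHom
    fun a f ↦ by
      change of θ' F (a • f) = φ (θ a) • of θ' F f
      rw [of_smul, ← h]
      rfl
  replace h1 (p : P) (z) : l (p • z) = φ p • l z := h1 p z
  refine ⟨{ l with map_smul' := fun a z ↦ ?_ }, h1, h2⟩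
  change l (a • z) = a • l z
  rw [← algebraMap_smul P, h1, AlgHom.commutes, algebraMap_smul]

variable (F) in
/-- Functoriality of the pullback in `P`. -/
def map (φ : P →ₐ[k] P') {θ' : A →ₐ[k] P'} (h : φ.comp θ = θ') : Pull θ F →ₗ[k] Pull θ' F :=
  (exists_map F φ h).choose

variable {φ : P →ₐ[k] P'} {θ' : A →ₐ[k] P'} (h : φ.comp θ = θ')

lemma map_smul (p : P) (z : Pull θ F) : map F φ h (p • z) = φ p • map F φ h z :=
  (exists_map F φ h).choose_spec.1 p z

lemma map_of (f : F) : map F φ h (of θ F f) = of θ' F f := (exists_map F φ h).choose_spec.2 f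

lemma isBC_map : IsBC φ.toRingHom (map F φ h).toAddMonoidHom :=
  (isBC_of θ F).of_comp (isBC_of θ' F) (fun a ↦ by rw [← h]; rfl) (fun f ↦ (map_of h f).symm)
    (map_smul h)

lemma map_id (z : Pull θ F) : map F (AlgHom.id k P) (AlgHom.id_comp θ) z = z := by
  induction z using induction_on with
  | zero => simp
  | add x y hx hy => rw [map_add, hx, hy]
  | smul p f => rw [map_smul, map_of, AlgHom.id_apply]

lemma map_map {ψ : P' →ₐ[k] P''} {θ'' : A →ₐ[k] P''} (h' : ψ.comp θ' = θ'') (z : Pull θ F) :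
    map F ψ h' (map F φ h z) = map F (ψ.comp φ) (by rw [AlgHom.comp_assoc, h, h']) z := by
  induction z using induction_on with
  | zero => simp
  | add x y hx hy => simp only [map_add, hx, hy]
  | smul p f => simp only [map_smul, map_of, AlgHom.comp_apply]

variable {c : Coaction k H F} (hc : c.IsEquivariant σ) {ρ : GAction k H P} {ρ' : GAction k H P'}
  (hθ : ρ.coact.comp θ = (Algebra.TensorProduct.map θ (AlgHom.id k H)).comp σ.coact)
  (hθ' : ρ'.coact.comp θ' = (Algebra.TensorProduct.map θ' (AlgHom.id k H)).comp σ.coact)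

/-- The coaction on the pullback of an equivariant module along an equivariant morphism. -/
def coaction : Coaction k H (Pull θ F) := (hc.exists_extension hθ (isBC_of θ F)).choose

lemma isEquivariant_coaction : (coaction hc hθ).IsEquivariant ρ :=
  (hc.exists_extension hθ (isBC_of θ F)).choose_spec.1

lemma isHom_of : c.IsHom (coaction hc hθ) (of θ F) :=
  (hc.exists_extension hθ (isBC_of θ F)).choose_spec.2

lemma isHom_map
    (hφ : ρ'.coact.comp φ = (Algebra.TensorProduct.map φ (AlgHom.id k H)).comp ρ.coact) :
    (coaction hc hθ).IsHom (coaction hc hθ') (map F φ h) :=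
  isHom_of_isBC hφ (isEquivariant_coaction hc hθ) (isBC_of θ F) (isHom_of hc hθ)
    (isEquivariant_coaction hc hθ') (map_smul h) fun f ↦ by
      have h1 : map F φ h ∘ₗ of θ F = of θ' F := LinearMap.ext (map_of h)
      rw [h1]
      exact isHom_of hc hθ' f

instance (ξ : σ.AffinePoint) : Module ξ.R (Pull ξ.toP F) :=
  Module.compHom _ (algebraMap ξ.R ξ.P)

instance (ξ : σ.AffinePoint) : IsScalarTower ξ.R ξ.P (Pull ξ.toP F) :=
  .of_algebraMap_smul fun _ _ ↦ rfl

instance (ξ : σ.AffinePoint) : IsScalarTower k ξ.R (Pull ξ.toP F) :=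
  .of_algebraMap_smul fun a z ↦ by
    rw [← algebraMap_smul ξ.P (algebraMap k ξ.R a) z, ← IsScalarTower.algebraMap_apply,
      algebraMap_smul]

end Pull

namespace GAction

open Pull AffinePoint

variable {F : Type u} [AddCommGroup F] [Module A F] [Module k F] [IsScalarTower k A F]
  {c : Coaction k H F} (hc : c.IsEquivariant σ)

/-- The value at `ξ` of the module on `[Spec A / G]` associated with an equivariant module `F`: the
invariants of the pullback of `F` to the torsor. -/
abbrev assoc (ξ : σ.AffinePoint) : Submodule ξ.R (Pull ξ.toP F) :=
  descend ξ.isTorsor (isEquivariant_coaction hc ξ.equivariant)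

lemma isBC_assoc (ξ : σ.AffinePoint) :
    IsBC (algebraMap ξ.R ξ.P) (assoc hc ξ).subtype.toAddMonoidHom :=
  (isBC_iff (fun _ ↦ rfl) _).mpr
    (isBaseChange_descend ξ.isTorsor (isEquivariant_coaction hc ξ.equivariant))

lemma AffinePoint.faithfullyFlat (ξ : σ.AffinePoint) : (algebraMap ξ.R ξ.P).FaithfullyFlat :=
  RingHom.faithfullyFlat_algebraMap_iff.mpr ξ.isTorsor.faithfullyFlat

lemma map_mem_assoc {ξ η : σ.AffinePoint} (u : ξ ⟶ η) {z : Pull η.toP F} (hz : z ∈ assoc hc η) :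
    Pull.map F (Hom.total u) (Hom.toP_comp u) z ∈ assoc hc ξ := by
  change (Pull.coaction hc ξ.equivariant).coact _ = _ ⊗ₜ 1
  rw [isHom_map (Hom.toP_comp u) hc η.equivariant ξ.equivariant (Hom.equivariant u),
    show (Pull.coaction hc η.equivariant).coact z = z ⊗ₜ 1 from hz, LinearMap.rTensor_tmul]

/-- The quasi-coherent module on `[Spec A / G]` associated with an equivariant module. -/
abbrev associated : Family (σ := σ) ⊤ where
  obj ξ _ := assoc hc ξ
  res {ξ η} _ _ u :=
    { toFun := fun z ↦ ⟨Pull.map F (Hom.total u) (Hom.toP_comp u) z, map_mem_assoc hc u z.2⟩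
      map_zero' := Subtype.ext (map_zero _)
      map_add' := fun _ _ ↦ Subtype.ext (map_add _ _ _) }
  res_id _ z := Subtype.ext (Pull.map_id z.1)
  res_comp _ _ _ u v z := Subtype.ext (Pull.map_map (Hom.toP_comp v) (Hom.toP_comp u) z.1).symm
  isBC {ξ η} _ _ u := by
    refine (isBC_assoc hc ξ).of_faithfullyFlat
      ((isBC_assoc hc η).comp (isBC_map (Hom.toP_comp u)) (χ := (Hom.total u).toRingHom.comp
        (algebraMap η.R η.P)) (fun _ ↦ rfl) (fun _ ↦ rfl) (h := (Pull.map F (Hom.total u)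
          (Hom.toP_comp u)).toAddMonoidHom.comp (assoc hc η).subtype.toAddMonoidHom))
      ξ.faithfullyFlat (Hom.comm u) (fun _ ↦ rfl) fun r z ↦ Subtype.ext ?_
    change Pull.map F _ _ (algebraMap η.R η.P r • z.1) = algebraMap ξ.R ξ.P (Hom.base u r) • _
    rw [Pull.map_smul, Hom.comm]
    rfl

lemma finite_assoc [Module.Finite A F] (ξ : σ.AffinePoint) : Module.Finite ξ.R (assoc hc ξ) := by
  have := (isBC_of ξ.toP F).finite
  exact (isBC_assoc hc ξ).finite_of_faithfullyFlat ξ.faithfullyFlat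

end GAction

end Associated

/-! ### Morphisms by descent -/

section Descent

variable {k H A B : Type u} [Field k] [CommRing H] [HopfAlgebra k H] [CommRing A]
  [Algebra k A] [CommRing B] [Algebra k B] {σ : GAction k H A}

open Coaction

namespace GAction

open AffinePoint

namespace Family

variable {Q : ObjectProperty σ.AffinePoint} {M N : Family Q}
  (hQ : ∀ ⦃ξ η : σ.AffinePoint⦄, (ξ ⟶ η) → Q η → Q ξ)

lemma res_coverHom_injective {ξ : σ.AffinePoint} (hξ : Q ξ) (hξ' : Q ξ.cover) :
    Function.Injective (M.res hξ' hξ (coverHom ξ)) :=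
  (M.isBC hξ' hξ (coverHom ξ)).injective ξ.faithfullyFlat

lemma isInvariant_res_coverHom {ξ : σ.AffinePoint} (hξ : Q ξ) (hξ' : Q ξ.cover) (m : M.obj ξ hξ) :
    (M.coaction hQ hξ' ξ.equivariant).IsInvariant (M.res hξ' hξ (coverHom ξ) m) := by
  rw [isInvariant_iff, ← M.res_comp, ← M.res_comp, coverHom_coverHom]

/-- Descent along the torsor of `ξ`: the sections over `ξ` are the invariant sections over the
torsor. -/
lemma exists_res_coverHom_eq {ξ : σ.AffinePoint} (hξ : Q ξ) (hξ' : Q ξ.cover)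
    {n : M.obj ξ.cover hξ'} (hn : (M.coaction hQ hξ' ξ.equivariant).IsInvariant n) :
    ∃ m, M.res hξ' hξ (coverHom ξ) m = n :=
  exists_eq_of_isInvariant ξ.isTorsor (isEquivariant_coaction hQ hξ' ξ.equivariant)
    (M.isBC hξ' hξ (coverHom ξ)) (isInvariant_res_coverHom hQ hξ hξ') hn

variable (M N) in
/-- A morphism of quasi-coherent modules. -/
structure Hom where
  /-- the components -/
  app (ξ : σ.AffinePoint) (h : Q ξ) : M.obj ξ h →ₗ[ξ.R] N.obj ξ h
  naturality {ξ η : σ.AffinePoint} (hξ : Q ξ) (hη : Q η) (u : ξ ⟶ η) (m : M.obj η hη) :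
    app ξ hξ (M.res hξ hη u m) = N.res hξ hη u (app η hη m)

lemma Hom.isHom (f : Hom M N) {α : A →ₐ[k] B} (hα : Q (ofHom α)) {τ : GAction k H B}
    (hτ : τ.coact.comp α = (Algebra.TensorProduct.map α (AlgHom.id k H)).comp σ.coact) :
    (M.coaction hQ hα hτ).IsHom (N.coaction hQ hα hτ) ((f.app (ofHom α) hα).restrictScalars k) := by
  have hα' := hQ (coverHom _) hα
  have h (z : M.obj (ofHom α) hα ⊗[k] H) :
      N.shift hα hα' (((f.app (ofHom α) hα).restrictScalars k).rTensor H z) =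
        f.app (ofHom α).cover hα' (M.shift hα hα' z) := by
    induction z with
    | zero => simp
    | add x y hx hy => simp only [map_add, hx, hy]
    | tmul m h =>
      rw [LinearMap.rTensor_tmul, shift_tmul, shift_tmul]
      refine Eq.trans ?_ ((f.app (ofHom α).cover hα').map_smul _ _).symm
      exact congrArg _ (f.naturality hα' hα _ m).symm
  intro m
  apply (shift_bijective hα hα').1
  refine (shift_coact hQ hα hτ _).trans (Eq.trans ?_ (h _).symm)
  exact (f.naturality hα' hα _ m).symm.trans
    (congrArg (f.app (ofHom α).cover hα') (shift_coact hQ hα hτ m).symm)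

/-- The restriction of a quasi-coherent module to a substack. -/
abbrev restrict {Q' : ObjectProperty σ.AffinePoint} (M : Family Q') (h : Q ≤ Q') : Family Q where
  obj ξ hξ := M.obj ξ (h ξ hξ)
  res hξ hη u := M.res (h _ hξ) (h _ hη) u
  res_id hξ := M.res_id (h _ hξ)
  res_comp hξ hη hζ := M.res_comp (h _ hξ) (h _ hη) (h _ hζ)
  isBC hξ hη := M.isBC (h _ hξ) (h _ hη)

section Extend

variable {F : Type u} [AddCommGroup F] [Module A F] [Module k F] [IsScalarTower k A F]
  {c : Coaction k H F} (hc : c.IsEquivariant σ) {α : A →ₐ[k] B} {hα : Q (ofHom α)}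
  {τ : GAction k H B}
  {hτ : τ.coact.comp α = (Algebra.TensorProduct.map α (AlgHom.id k H)).comp σ.coact}
  {r : F →ₗ[k] N.obj (ofHom α) hα} (hr : ∀ a f, r (a • f) = α a • r f)
  (hrc : c.IsHom (N.coaction hQ hα hτ) r)
  {ξ η : σ.AffinePoint} (hξ : Q ξ.cover) (hη : Q η.cover) {b : B →ₐ[k] ξ.P} (hb : b.comp α = ξ.toP)

include hr in
lemma exists_extend : ∃ L : Pull ξ.toP F →ₗ[ξ.P] N.obj ξ.cover hξ,
    ∀ f, L (Pull.of ξ.toP F f) = N.res hξ hα (mapHom b hb) (r f) := by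
  obtain ⟨L, h1, h2⟩ := (Pull.isBC_of ξ.toP F).exists_lift
    (Module.toAddMonoidEnd ξ.P (N.obj ξ.cover hξ))
    ((N.resₗ hξ hα (mapHom b hb)).comp r).toAddMonoidHom fun a f ↦ by
      change N.res hξ hα (mapHom b hb) (r (a • f)) =
        ξ.toP a • N.res hξ hα (mapHom b hb) (r f)
      rw [hr, res_mapHom_smul, show b (α a) = ξ.toP a from DFunLike.congr_fun hb a]
  exact ⟨{ L with map_smul' := h1 }, h2⟩

/-- The linear extension of a map `F → N(Spec B)`, semilinear over `α : A → B`, to the pullback of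
`F` to the torsor of `ξ`, where `Spec P → Spec A` factors through `α`. -/
def extend : Pull ξ.toP F →ₗ[ξ.P] N.obj ξ.cover hξ := (exists_extend hr hξ hb).choose

lemma extend_of (f : F) :
    extend hr hξ hb (Pull.of ξ.toP F f) = N.res hξ hα (mapHom b hb) (r f) :=
  (exists_extend hr hξ hb).choose_spec f

lemma bijective_extend (h : IsBC α.toRingHom r.toAddMonoidHom) :
    Function.Bijective (extend hr hξ hb) :=
  (Pull.isBC_of ξ.toP F).bijective_of
    (h.comp (N.isBC hξ hα (mapHom b hb)) (χ := ξ.toP.toRingHom)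
      (fun a ↦ (DFunLike.congr_fun hb a).symm)
      (h := ((N.resₗ hξ hα (mapHom b hb)).comp r).toAddMonoidHom) fun _ ↦ rfl)
    (l := (extend hr hξ hb).toAddMonoidHom) (extend hr hξ hb).map_smul (extend_of hr hξ hb)

/-- The linear extension is compatible with morphisms of affine points. -/
lemma extend_naturality (u : ξ ⟶ η) {b' : B →ₐ[k] η.P} (hb' : b'.comp α = η.toP)
    (hs : Function.Surjective α) (z : Pull η.toP F) :
    extend hr hξ hb (Pull.map F (AffinePoint.Hom.total u) (AffinePoint.Hom.toP_comp u) z) =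
      N.res hξ hη (mapHom (AffinePoint.Hom.total u) (AffinePoint.Hom.toP_comp u))
        (extend hr hη hb' z) := by
  have h : (AffinePoint.Hom.total u).comp b' = b := by
    rw [← AlgHom.cancel_right hs, AlgHom.comp_assoc, hb', hb, AffinePoint.Hom.toP_comp]
  induction z using Pull.induction_on with
  | zero => simp
  | add x y hx hy => simp only [map_add, hx, hy]
  | smul p f =>
    rw [Pull.map_smul, map_smul, map_smul, res_mapHom_smul, Pull.map_of, extend_of, extend_of,
      ← N.res_comp, mapHom_comp, mapHom_congr _ h]

include hrc in
lemma isHom_extend (hs : Function.Surjective α) : (Pull.coaction hc ξ.equivariant).IsHom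
    (N.coaction hQ hξ ξ.equivariant) ((extend hr hξ hb).restrictScalars k) := by
  refine isHom_of_isBC (φ := AlgHom.id k ξ.P) (by simp) (Pull.isEquivariant_coaction hc _)
    (Pull.isBC_of ξ.toP F) (Pull.isHom_of hc _) (isEquivariant_coaction hQ hξ _)
    (extend hr hξ hb).map_smul ?_
  have h1 : (extend hr hξ hb).restrictScalars k ∘ₗ Pull.of ξ.toP F =
      N.resₗ hξ hα (mapHom b hb) ∘ₗ r := LinearMap.ext (extend_of hr hξ hb)
  have h2 := isHom_resₗ (M := N) hQ hα hτ hξ ξ.equivariant b hb (by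
    rw [← AlgHom.cancel_right hs, AlgHom.comp_assoc, hb, ξ.equivariant, AlgHom.comp_assoc, hτ,
      ← AlgHom.comp_assoc, ← Algebra.TensorProduct.map_comp, hb, AlgHom.comp_id])
  rw [h1]
  intro f
  rw [LinearMap.comp_apply, h2, hrc, ← LinearMap.rTensor_comp_apply]

include hQ hr hrc in
/-- Equivariant maps from `F` to the value of `N` at `Spec B → Spec A` extend to the module
associated with `F`. -/
theorem exists_hom (hs : Function.Surjective α)
    (hb : ∀ ξ : σ.AffinePoint, Q ξ → ∃ b : B →ₐ[k] ξ.P, b.comp α = ξ.toP) :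
    ∃ l : Hom ((associated hc).restrict (le_top : Q ≤ ⊤)) N,
      (∀ ξ (hξ : Q ξ) (b : B →ₐ[k] ξ.P) (hb : b.comp α = ξ.toP) (z : assoc hc ξ),
        N.res (hQ (coverHom ξ) hξ) hξ (coverHom ξ) (l.app ξ hξ z) =
          extend hr (hQ (coverHom ξ) hξ) hb z.1) ∧
      (IsBC α.toRingHom r.toAddMonoidHom → ∀ ξ hξ, Function.Bijective (l.app ξ hξ)) := by
  have h1 (ξ) (hξ : Q ξ) (z : assoc hc ξ) : ∃ y : N.obj ξ hξ,
      ∀ (b : B →ₐ[k] ξ.P) (hb : b.comp α = ξ.toP),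
        N.res (hQ (coverHom ξ) hξ) hξ (coverHom ξ) y = extend hr (hQ (coverHom ξ) hξ) hb z.1 := by
    obtain ⟨b, hb⟩ := hb ξ hξ
    obtain ⟨y, hy⟩ := exists_res_coverHom_eq hQ hξ (hQ (coverHom ξ) hξ)
      (n := extend hr (hQ (coverHom ξ) hξ) hb z.1) (by
        have := isHom_extend hQ hc hr hrc (hQ (coverHom ξ) hξ) hb hs z.1
        rw [show (Pull.coaction hc ξ.equivariant).coact z.1 = z.1 ⊗ₜ 1 from z.2] at this
        exact this)
    refine ⟨y, fun b' hb' ↦ ?_⟩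
    obtain rfl : b = b' := by rw [← AlgHom.cancel_right hs, hb, hb']
    exact hy
  choose l hl using h1
  let l' (ξ) (hξ : Q ξ) : assoc hc ξ →ₗ[ξ.R] N.obj ξ hξ :=
    { toFun := l ξ hξ
      map_add' := fun z z' ↦ by
        obtain ⟨b, hb⟩ := hb ξ hξ
        apply res_coverHom_injective hξ (hQ (coverHom ξ) hξ)
        rw [map_add, hl ξ hξ _ b hb, hl ξ hξ _ b hb, hl ξ hξ _ b hb]
        exact map_add _ _ _
      map_smul' := fun a z ↦ by
        obtain ⟨b, hb⟩ := hb ξ hξ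
        apply res_coverHom_injective hξ (hQ (coverHom ξ) hξ)
        rw [RingHom.id_apply, res_coverHom_smul, hl ξ hξ _ b hb, hl ξ hξ _ b hb]
        exact map_smul _ (algebraMap ξ.R ξ.P a) z.1 }
  refine ⟨{ app := l', naturality := fun {ξ η} hξ hη u z ↦ ?_ },
    fun ξ hξ b hb z ↦ hl ξ hξ z b hb, fun h ξ hξ ↦ ?_⟩
  · obtain ⟨b, hb1⟩ := hb ξ hξ
    obtain ⟨b', hb2⟩ := hb η hη
    apply res_coverHom_injective hξ (hQ (coverHom ξ) hξ)
    refine (hl ξ hξ _ b hb1).trans ((extend_naturality hr (hQ (coverHom ξ) hξ)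
      (hQ (coverHom η) hη) hb1 u hb2 hs _).trans ?_)
    refine (congrArg (N.res _ _ _) (hl η hη z b' hb2).symm).trans ?_
    exact (N.res_comp _ _ _ _ _ _).symm.trans ((congrArg (fun v ↦ N.res _ hη v (l η hη z))
      (coverHom_naturality u)).trans (N.res_comp _ _ _ _ _ _))
  · obtain ⟨b, hb⟩ := hb ξ hξ
    have := IsBC.bijective_of_faithfullyFlat (isBC_assoc hc ξ)
      (N.isBC (hQ (coverHom ξ) hξ) hξ (coverHom ξ)) ξ.faithfullyFlat
      (l := l' ξ hξ) (l' := extend hr (hQ (coverHom ξ) hξ) hb) fun z ↦ (hl ξ hξ z b hb).symm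
    exact ⟨this.1 (bijective_extend hr _ hb h).1, this.2 (bijective_extend hr _ hb h).2⟩

end Extend

end Family

end GAction

end Descent

/-! ### Comparison with presheaves of modules -/

section Conversion

variable {k H A : Type u} [Field k] [CommRing H] [HopfAlgebra k H] [CommRing A]
  [Algebra k A] {σ : GAction k H A}

namespace GAction

open AffinePoint

variable {Q : ObjectProperty σ.AffinePoint}

lemma _root_.PMod.IsBaseChangeAt.isBC {C : Type u'} [Category.{v'} C] {O : Cᵒᵖ ⥤ CommRingCat.{u}}
    {M : PMod O} {X Y : Cᵒᵖ} {f : X ⟶ Y} (h : M.IsBaseChangeAt f) :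
    IsBC (O.map f).hom (AddMonoidHom.mk' (fun m : M.obj X ↦ (M.map f m : M.obj Y))
      fun a b ↦ map_add (M.map f).hom a b) :=
  ⟨fun r m ↦ M.map_smul f r m, h⟩

/-- The family of modules underlying a quasi-coherent presheaf of modules. -/
abbrev Family.ofPMod (M : PMod (Q.ι.op ⋙ σ.structureSheaf)) (hM : isQCoh _ M) : Family Q where
  obj ξ h := M.obj (op ⟨ξ, h⟩)
  addCommGroup ξ h := inferInstanceAs (AddCommGroup (M.obj (op ⟨ξ, h⟩)))
  module ξ h := inferInstanceAs
    (Module ((Q.ι.op ⋙ σ.structureSheaf).obj (op ⟨ξ, h⟩)) (M.obj (op ⟨ξ, h⟩)))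
  res {ξ η} hξ hη u := AddMonoidHom.mk'
    (fun m ↦ M.map
      (Quiver.Hom.op (ObjectProperty.homMk u : (⟨ξ, hξ⟩ : Q.FullSubcategory) ⟶ ⟨η, hη⟩)) m)
    fun a b ↦ map_add (M.map _).hom a b
  res_id {ξ} hξ m := by
    exact congrArg (fun f ↦ f m) (M.map_id (op ⟨ξ, hξ⟩))
  res_comp {ξ η ζ} hξ hη hζ u v m := M.map_comp_apply
    (Quiver.Hom.op (ObjectProperty.homMk v : (⟨η, hη⟩ : Q.FullSubcategory) ⟶ ⟨ζ, hζ⟩))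
    (Quiver.Hom.op (ObjectProperty.homMk u : (⟨ξ, hξ⟩ : Q.FullSubcategory) ⟶ ⟨η, hη⟩)) m
  isBC {ξ η} hξ hη u := (hM
    (Quiver.Hom.op (ObjectProperty.homMk u : (⟨ξ, hξ⟩ : Q.FullSubcategory) ⟶ ⟨η, hη⟩))).isBC

namespace Family

variable {M N : PMod (Q.ι.op ⋙ σ.structureSheaf)} {hM : isQCoh _ M} {hN : isQCoh _ N}

/-- The morphism of families underlying a morphism of presheaves of modules. -/
def Hom.ofPMod (f : M ⟶ N) : Hom (.ofPMod M hM) (.ofPMod N hN) where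
  app ξ h := (f.app (op ⟨ξ, h⟩)).hom
  naturality {ξ η} hξ hη u m := PresheafOfModules.naturality_apply f
    (Quiver.Hom.op (ObjectProperty.homMk u : (⟨ξ, hξ⟩ : Q.FullSubcategory) ⟶ ⟨η, hη⟩)) m

/-- A bijective morphism of families is an isomorphism of presheaves of modules. -/
def Hom.toIso (l : Hom (.ofPMod M hM) (.ofPMod N hN))
    (hl : ∀ ξ h, Function.Bijective (l.app ξ h)) : M ≅ N :=
  PresheafOfModules.isoMk
    (fun X ↦ LinearEquiv.toModuleIso (.ofBijective (l.app X.unop.obj X.unop.property)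
      (hl X.unop.obj X.unop.property)))
    fun X Y f ↦ by
      ext m
      exact l.naturality Y.unop.property X.unop.property f.unop.hom m

variable {M' N' : PMod σ.structureSheaf} {hM' : isQCoh _ M'} {hN' : isQCoh _ N'}

/-- The family underlying a quasi-coherent module on `[Spec A / G]`. -/
abbrev ofQCoh (M : PMod σ.structureSheaf) (hM : isQCoh _ M) : Family (σ := σ) ⊤ :=
  .ofPMod ((PresheafOfModules.pushforward₀OfCommRingCat (⊤ : ObjectProperty σ.AffinePoint).ι
    σ.structureSheaf).obj M) fun _ _ f ↦ hM ((⊤ : ObjectProperty σ.AffinePoint).ι.op.map f)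

/-- The morphism of families underlying a morphism of presheaves of modules on `[Spec A / G]`. -/
def homOfQCoh (f : M' ⟶ N') : Hom (ofQCoh M' hM') (ofQCoh N' hN') where
  app ξ _ := (f.app (op ξ)).hom
  naturality {_ _} _ _ u m := PresheafOfModules.naturality_apply f u.op m

/-- A morphism of families on `[Spec A / G]` as a morphism of presheaves of modules. -/
def Hom.toPMod (l : Hom (ofQCoh M' hM') (ofQCoh N' hN')) : M' ⟶ N' where
  app X := ModuleCat.ofHom (l.app X.unop True.intro)
  naturality {X Y} f := by
    ext m
    exact l.naturality True.intro True.intro f.unop m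

instance (M : Family (σ := σ) ⊤) (X : σ.AffinePointᵒᵖ) :
    Module ((σ.structureSheaf ⋙ forget₂ CommRingCat.{u} RingCat.{u}).obj X)
      (M.obj X.unop True.intro) :=
  M.module X.unop True.intro

/-- A family on `[Spec A / G]` as a presheaf of modules. -/
def toPMod (M : Family (σ := σ) ⊤) : PMod σ.structureSheaf where
  obj X := ModuleCat.of ((σ.structureSheaf ⋙ forget₂ CommRingCat.{u} RingCat.{u}).obj X)
    (M.obj X.unop True.intro)
  map {X Y} f := ModuleCat.ofHom (Y := (ModuleCat.restrictScalars
      ((σ.structureSheaf ⋙ forget₂ CommRingCat.{u} RingCat.{u}).map f).hom).obj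
        (ModuleCat.of ((σ.structureSheaf ⋙ forget₂ CommRingCat.{u} RingCat.{u}).obj Y)
          (M.obj Y.unop True.intro)))
    { M.res True.intro True.intro f.unop with
      map_smul' := fun r m ↦ M.res_smul True.intro True.intro f.unop r m }
  map_id X := by
    refine ModuleCat.hom_ext (LinearMap.ext fun m ↦ ?_)
    exact M.res_id True.intro m
  map_comp f g := by
    refine ModuleCat.hom_ext (LinearMap.ext fun m ↦ ?_)
    exact M.res_comp True.intro True.intro True.intro g.unop f.unop m

lemma isQCoh_toPMod (M : Family (σ := σ) ⊤) : isQCoh _ M.toPMod :=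
  fun _ _ f ↦ (M.isBC True.intro True.intro f.unop).isBaseChange

end Family

end GAction

end Conversion

/-! ### Invariants of representations of a linearly reductive group -/

section Exact

variable {k H A P P' : Type u} [Field k] [CommRing H] [HopfAlgebra k H] [CommRing A]
  [Algebra k A] [CommRing P] [Algebra k P] [CommRing P'] [Algebra k P'] {σ : GAction k H A}

open Coaction

namespace Pull

variable {θ : A →ₐ[k] P} {F F' : Type u} [AddCommGroup F] [Module A F] [Module k F]
  [IsScalarTower k A F] [AddCommGroup F'] [Module A F'] [Module k F'] [IsScalarTower k A F']
  (f : F →ₗ[A] F')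

variable (θ) in
lemma exists_lTensor : ∃ l : Pull θ F →ₗ[P] Pull θ F', ∀ m, l (of θ F m) = of θ F' (f m) := by
  obtain ⟨l, h1, h2⟩ := (isBC_of θ F).exists_lift (Module.toAddMonoidEnd P (Pull θ F'))
    ((of θ F').toAddMonoidHom.comp f.toAddMonoidHom) fun a m ↦ by
      change of θ F' (f (a • m)) = θ a • of θ F' (f m)
      rw [_root_.map_smul, of_smul]
  exact ⟨{ l with map_smul' := h1 }, h2⟩

variable (θ) in
/-- Functoriality of the pullback in the module. -/
def lTensor : Pull θ F →ₗ[P] Pull θ F' := (exists_lTensor θ f).choose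

lemma lTensor_of (m : F) : lTensor θ f (of θ F m) = of θ F' (f m) :=
  (exists_lTensor θ f).choose_spec m

lemma lTensor_surjective (hf : Function.Surjective f) : Function.Surjective (lTensor θ f) := by
  intro z
  induction z using induction_on with
  | zero => exact ⟨0, map_zero _⟩
  | add x y hx hy =>
    obtain ⟨x, rfl⟩ := hx
    obtain ⟨y, rfl⟩ := hy
    exact ⟨x + y, map_add _ _ _⟩
  | smul p m =>
    obtain ⟨m, rfl⟩ := hf m
    exact ⟨p • of θ F m, by rw [_root_.map_smul, lTensor_of]⟩

lemma lTensor_map {φ : P →ₐ[k] P'} {θ' : A →ₐ[k] P'} (h : φ.comp θ = θ') (z : Pull θ F) :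
    lTensor θ' f (map F φ h z) = map F' φ h (lTensor θ f z) := by
  induction z using induction_on with
  | zero => simp
  | add x y hx hy => simp only [map_add, hx, hy]
  | smul p m =>
    rw [map_smul, map_of, _root_.map_smul, lTensor_of, _root_.map_smul, lTensor_of, map_smul,
      map_of]

lemma isHom_lTensor {c : Coaction k H F} {c' : Coaction k H F'} (hc : c.IsEquivariant σ)
    (hc' : c'.IsEquivariant σ) {ρ : GAction k H P}
    (hθ : ρ.coact.comp θ = (Algebra.TensorProduct.map θ (AlgHom.id k H)).comp σ.coact)
    (hf : c.IsHom c' (f.restrictScalars k)) :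
    (coaction hc hθ).IsHom (coaction hc' hθ) ((lTensor θ f).restrictScalars k) := by
  refine isHom_of_isBC (φ := AlgHom.id k P) (by simp) (isEquivariant_coaction hc hθ) (isBC_of θ F)
    (isHom_of hc hθ) (isEquivariant_coaction hc' hθ) (lTensor θ f).map_smul ?_
  have h1 : (lTensor θ f).restrictScalars k ∘ₗ of θ F = of θ F' ∘ₗ f.restrictScalars k :=
    LinearMap.ext (lTensor_of f)
  rw [h1]
  intro m
  rw [LinearMap.comp_apply, isHom_of hc' hθ, hf, ← LinearMap.rTensor_comp_apply]

lemma map_congr {φ φ' : P →ₐ[k] P'} {θ' : A →ₐ[k] P'} (h : φ.comp θ = θ') (e : φ = φ')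
    (z : Pull θ F) : map F φ h z = map F φ' (e ▸ h) z := by
  subst e
  rfl

end Pull

namespace GAction

open AffinePoint

variable {F F' : Type u} [AddCommGroup F] [Module A F] [Module k F]
  [IsScalarTower k A F] [AddCommGroup F'] [Module A F'] [Module k F'] [IsScalarTower k A F']
  {c : Coaction k H F} {c' : Coaction k H F'} (hc : c.IsEquivariant σ) (hc' : c'.IsEquivariant σ)

/-- Functoriality of the associated module. -/
def assocMap {f : F →ₗ[A] F'} (hf : c.IsHom c' (f.restrictScalars k)) (ξ : σ.AffinePoint) :
    assoc hc ξ →ₗ[ξ.R] assoc hc' ξ :=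
  ((Pull.lTensor ξ.toP f).restrictScalars ξ.R).restrict fun z hz ↦ by
    have := Pull.isHom_lTensor f hc hc' ξ.equivariant hf z
    rw [show (Pull.coaction hc ξ.equivariant).coact z = z ⊗ₜ 1 from hz] at this
    exact this

lemma assocMap_surjective {f : F →ₗ[A] F'} (hf : c.IsHom c' (f.restrictScalars k))
    (hs : Function.Surjective f) (ξ : σ.AffinePoint) :
    Function.Surjective (assocMap hc hc' hf ξ) :=
  (IsBC.bijective_of_faithfullyFlat (isBC_assoc hc ξ) (isBC_assoc hc' ξ) ξ.faithfullyFlat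
    (l' := Pull.lTensor ξ.toP f) fun _ ↦ rfl).2 (Pull.lTensor_surjective f hs)

lemma isEquivariant_trivial {M : Type u} [AddCommGroup M] [Module k M] (c : Coaction k H M) :
    c.IsEquivariant (trivial k H) := fun a m ↦ by
  change c.coact (a • m) = tensorAct k k H M H (a ⊗ₜ 1) (c.coact m)
  rw [map_smul]
  generalize c.coact m = z
  induction z with
  | zero => simp
  | add x y hx hy => simp only [map_add, smul_add, hx, hy]
  | tmul m h => simp [smul_tmul']

end GAction

open GAction AffinePoint

/-- Linear reductivity, defined through global sections of quasi-coherent modules on `BG`, implies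
that taking invariants of representations is exact. -/
theorem IsCohomologicallyAffine.exactInvariants
    (h : IsCohomologicallyAffine (GAction.trivial k H).structureSheaf) : ExactInvariants k H := by
  intro M N _ _ _ _ c d f hf hs n hn
  have hc := isEquivariant_trivial c
  have hd := isEquivariant_trivial d
  let ΨM : QCoh (GAction.trivial k H).structureSheaf :=
    ⟨(associated hc).toPMod, Family.isQCoh_toPMod _⟩
  let ΨN : QCoh (GAction.trivial k H).structureSheaf :=
    ⟨(associated hd).toPMod, Family.isQCoh_toPMod _⟩
  let l : Family.Hom (associated hc) (associated hd) :=
    { app := fun ξ _ ↦ assocMap hc hd hf ξ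
      naturality := fun _ _ u m ↦ Subtype.ext (Pull.lTensor_map f (Hom.toP_comp u) m.1) }
  let g : ΨM ⟶ ΨN := ObjectProperty.homMk
    (Family.Hom.toPMod (hM' := ΨM.property) (hN' := ΨN.property) l)
  let s : ΨN.obj.sections := PresheafOfModules.sectionsMk
    (fun X ↦ (⟨Pull.of X.unop.toP N n, by
      change (Pull.coaction hd X.unop.equivariant).coact _ = _ ⊗ₜ 1
      rw [Pull.isHom_of hd X.unop.equivariant, show d.coact n = n ⊗ₜ 1 from hn,
        LinearMap.rTensor_tmul]⟩ : assoc hd X.unop))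
    fun X Y u ↦ Subtype.ext (Pull.map_of (Hom.toP_comp u.unop) n)
  obtain ⟨t, ht⟩ := h g (fun X ↦ assocMap_surjective hc hd hf hs X.unop) s
  -- the value of the section at the trivial torsor on `Spec k`
  let ξ : (GAction.trivial k H).AffinePoint := ofHom (AlgHom.id k k)
  let τ (η : (GAction.trivial k H).AffinePoint) : assoc hc η := t.1 (op η)
  have hτ {η ζ} (u : η ⟶ ζ) :
      Pull.map M (Hom.total u) (Hom.toP_comp u) (τ ζ).1 = (τ η).1 :=
    congrArg Subtype.val (PresheafOfModules.sections_property t u.op)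
  have hτ' : Pull.lTensor ξ.toP f (τ ξ).1 = Pull.of ξ.toP N n :=
    congrArg Subtype.val (congrArg (fun s : ΨN.obj.sections ↦ s.1 (op ξ)) ht)
  have hε : (unitSection k H k).comp ξ.toP = AlgHom.id k k := Subsingleton.elim _ _
  obtain ⟨m, hm⟩ : ∃ m, Pull.of (AlgHom.id k k) M m =
      Pull.map M (unitSection k H k) hε (τ ξ).1 := by
    induction Pull.map M (unitSection k H k) hε (τ ξ).1 using Pull.induction_on with
    | zero => exact ⟨0, map_zero _⟩
    | add x y hx hy =>
      obtain ⟨x, rfl⟩ := hx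
      obtain ⟨y, rfl⟩ := hy
      exact ⟨x + y, map_add _ _ _⟩
    | smul a m => exact ⟨a • m, Pull.of_smul a m⟩
  have hof (V : Type u) [AddCommGroup V] [Module k V] :
      Function.Injective (Pull.of (AlgHom.id k k) V) :=
    (Pull.isBC_of (AlgHom.id k k) V).injective (RingHom.FaithfullyFlat.of_bijective
      Function.bijective_id)
  have hof' : Function.Injective (Pull.of ξ.toP M) := fun a b hab ↦ hof M (by
    rw [← Pull.map_of hε, hab, Pull.map_of])
  have hτm : (τ ξ).1 = Pull.of ξ.toP M m := by
    let v : ξ.cover ⟶ ξ := mapHom ξ.toP (AlgHom.comp_id _)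
    let ψ : ξ.cover.P →ₐ[k] ξ.P := unitSection k H ξ.P
    have hψ : ψ.comp ξ.cover.toP = ξ.toP := Subsingleton.elim _ _
    have h1 := congrArg (Pull.map M ψ hψ) ((hτ (coverHom ξ)).trans (hτ v).symm)
    rw [Pull.map_map, Pull.map_map] at h1
    have h2 : ψ.comp (Hom.total (coverHom ξ)) = AlgHom.id k ξ.P := (GAction.free k H k).counit
    have h3 : ψ.comp (Hom.total v) = ξ.toP.comp (unitSection k H k) := by
      refine Algebra.TensorProduct.ext' fun a h ↦ ?_
      change unitSection k H ξ.P (ξ.toP a ⊗ₜ h) = ξ.toP (unitSection k H k (a ⊗ₜ h))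
      rw [unitSection_tmul, unitSection_tmul, _root_.map_smul]
    rw [Pull.map_congr _ h2, Pull.map_id, Pull.map_congr _ h3,
      ← Pull.map_map hε (AlgHom.comp_id _), ← hm, Pull.map_of] at h1
    exact h1
  refine ⟨m, ?_, hof N ?_⟩
  · have h1 := (τ ξ).2
    change (Pull.coaction hc ξ.equivariant).coact _ = _ ⊗ₜ 1 at h1
    rw [hτm, Pull.isHom_of hc ξ.equivariant] at h1
    exact Module.Flat.rTensor_preserves_injective_linearMap _ hof' h1
  · rw [← Pull.lTensor_of, hm, Pull.lTensor_map, hτ', Pull.map_of]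

end Exact

/-! ### Closed substacks and sections over closed subschemes of `Spec A` -/

namespace IsBC

variable {A R S : Type*} [CommRing A] [CommRing R] [CommRing S] {M N : Type*} [AddCommGroup M]
  [Module A M] [Module R M] [AddCommGroup N] [Module S N] {φ : R →+* S} {f : M →+ N}

omit [Module A M] in
lemma surjective (hf : IsBC φ f) (hφ : Function.Surjective φ) : Function.Surjective f := by
  intro n
  induction n using hf.induction_on with
  | zero => exact ⟨0, map_zero f⟩
  | add x y hx hy =>
    obtain ⟨x, rfl⟩ := hx
    obtain ⟨y, rfl⟩ := hy
    exact ⟨x + y, map_add f x y⟩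
  | smul s m =>
    obtain ⟨r, rfl⟩ := hφ s
    exact ⟨r • m, hf.map_smul r m⟩

/-- The base change of `M` along a surjection is the quotient of `M` by the submodule generated by
the kernel. For applications, the ring that acts on `M` may be replaced by one surjecting to it. -/
lemma eq_zero_iff (hf : IsBC φ f) (hφ : Function.Surjective φ) {α : A →+* R}
    (hα : Function.Surjective α) (hM : ∀ (a : A) (m : M), a • m = α a • m) {m : M} :
    f m = 0 ↔ m ∈ RingHom.ker (φ.comp α) • (⊤ : Submodule A M) := by
  constructor
  · intro hm
    let Q := M ⧸ (RingHom.ker (φ.comp α) • (⊤ : Submodule A M))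
    have hs : Function.Surjective (φ.comp α) := hφ.comp hα
    let act : S →+* AddMonoid.End Q := (φ.comp α).liftOfSurjective hs
      ⟨Module.toAddMonoidEnd A Q, fun a ha ↦ AddMonoidHom.ext fun q ↦ by
        obtain ⟨m, rfl⟩ := Submodule.mkQ_surjective _ q
        exact (Submodule.Quotient.mk_eq_zero _).mpr
          (Submodule.smul_mem_smul ha (Submodule.mem_top (x := m)))⟩
    have hact (a : A) (q : Q) : act (φ (α a)) q = a • q :=
      congrArg (fun g : AddMonoid.End Q ↦ g q)
        ((φ.comp α).liftOfRightInverse_comp_apply _ _ _ a)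
    obtain ⟨l, -, hl⟩ := hf.exists_lift act (Submodule.mkQ _).toAddMonoidHom fun r m ↦ by
      obtain ⟨a, rfl⟩ := hα r
      rw [← hM, hact]
      exact LinearMap.map_smul (Submodule.mkQ _) a m
    have h1 := hl m
    rw [hm, map_zero] at h1
    exact (Submodule.Quotient.mk_eq_zero _).mp h1.symm
  · intro hm
    refine Submodule.smul_induction_on hm (fun a ha m _ ↦ ?_) fun x y hx hy ↦ ?_
    · rw [hM, hf.map_smul, show φ (α a) = 0 from ha, zero_smul]
    · rw [map_add, hx, hy, add_zero]

omit [Module A M] in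
lemma of_surjective (hφ : Function.Surjective φ) (hf : ∀ r m, f (r • m) = φ r • f m)
    (hs : Function.Surjective f)
    (hker : ∀ m, f m = 0 → m ∈ RingHom.ker φ • (⊤ : Submodule R M)) : IsBC φ f := by
  let : Algebra R S := φ.toAlgebra
  let : Module R N := Module.compHom N φ
  have : IsScalarTower R S N := ⟨fun a b n ↦ mul_smul (φ a) b n⟩
  let f' : M →ₗ[R] N := { f with map_smul' := hf }
  let l : S ⊗[R] M →ₗ[S] N := (TensorProduct.isBaseChange R M S).lift f'
  have hl (m : M) : l (1 ⊗ₜ m) = f m := (TensorProduct.isBaseChange R M S).lift_eq f' m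
  let j : M →+ S ⊗[R] M := (TensorProduct.mk R S M 1).toAddMonoidHom
  have hj : IsBC φ j := (isBC_iff (fun _ ↦ rfl) _).mpr (TensorProduct.isBaseChange R M S)
  refine ⟨hf, .of_equiv (LinearEquiv.ofBijective l ⟨?_, fun n ↦ ?_⟩) hl⟩
  · rw [injective_iff_map_eq_zero]
    intro z hz
    obtain ⟨m, rfl⟩ := hj.surjective hφ z
    exact (hj.eq_zero_iff hφ (α := RingHom.id R) Function.surjective_id fun _ _ ↦ rfl).mpr
      (hker m ((hl m).symm.trans hz))
  · obtain ⟨m, rfl⟩ := hs n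
    exact ⟨_, hl m⟩

end IsBC

section Quotient

variable {k H A B : Type u} [Field k] [CommRing H] [HopfAlgebra k H] [CommRing A]
  [Algebra k A] [CommRing B] [Algebra k B] {σ : GAction k H A}

open Coaction

namespace GAction

/-- An action descends along a surjection of algebras if the coaction does. -/
def ofSurjective (α : A →ₐ[k] B) (hα : Function.Surjective α) (r : B →ₐ[k] B ⊗[k] H)
    (h : r.comp α = (Algebra.TensorProduct.map α (AlgHom.id k H)).comp σ.coact) :
    GAction k H B where
  coact := r
  coassoc := by
    rw [← AlgHom.cancel_right hα]
    have h1 : ((Algebra.TensorProduct.assoc k k k B H H).toAlgHom.comp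
        (Algebra.TensorProduct.map r (AlgHom.id k H))).comp
          (Algebra.TensorProduct.map α (AlgHom.id k H)) =
        (Algebra.TensorProduct.map α (AlgHom.id k (H ⊗[k] H))).comp
          ((Algebra.TensorProduct.assoc k k k A H H).toAlgHom.comp
            (Algebra.TensorProduct.map σ.coact (AlgHom.id k H))) := by
      refine Algebra.TensorProduct.ext' fun a g ↦ ?_
      have h2 : r (α a) = Algebra.TensorProduct.map α (AlgHom.id k H) (σ.coact a) :=
        DFunLike.congr_fun h a
      change TensorProduct.assoc k B H H (r (α a) ⊗ₜ g) =
        Algebra.TensorProduct.map α (AlgHom.id k (H ⊗[k] H))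
          (TensorProduct.assoc k A H H (σ.coact a ⊗ₜ g))
      rw [h2]
      generalize σ.coact a = z
      induction z with
      | zero => simp
      | add x y hx hy => simp only [map_add, add_tmul, hx, hy]
      | tmul b g' => rfl
    have h3 : (Algebra.TensorProduct.map (AlgHom.id k B) (Bialgebra.comulAlgHom k H)).comp
          (Algebra.TensorProduct.map α (AlgHom.id k H)) =
        (Algebra.TensorProduct.map α (AlgHom.id k (H ⊗[k] H))).comp
          (Algebra.TensorProduct.map (AlgHom.id k A) (Bialgebra.comulAlgHom k H)) := by
      rw [← Algebra.TensorProduct.map_comp, ← Algebra.TensorProduct.map_comp]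
      rfl
    rw [AlgHom.comp_assoc, h, ← AlgHom.comp_assoc, h1, AlgHom.comp_assoc, σ.coassoc,
      ← AlgHom.comp_assoc, ← h3, AlgHom.comp_assoc, ← h, AlgHom.comp_assoc]
  counit := by
    rw [← AlgHom.cancel_right hα]
    have h1 : ((Algebra.TensorProduct.rid k k B).toAlgHom.comp
        (Algebra.TensorProduct.map (AlgHom.id k B) (Bialgebra.counitAlgHom k H))).comp
          (Algebra.TensorProduct.map α (AlgHom.id k H)) =
        α.comp ((Algebra.TensorProduct.rid k k A).toAlgHom.comp
          (Algebra.TensorProduct.map (AlgHom.id k A) (Bialgebra.counitAlgHom k H))) :=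
      Algebra.TensorProduct.ext' fun a g ↦ by simp
    rw [AlgHom.comp_assoc, h, ← AlgHom.comp_assoc, h1, AlgHom.comp_assoc, σ.counit]
    rfl

lemma map_coact_eq_zero {I : Ideal A} (hI : σ.toCoaction.IsStable (I.restrictScalars k)) {a : A}
    (ha : a ∈ I) : Algebra.TensorProduct.map (Ideal.Quotient.mkₐ k I) (AlgHom.id k H)
      (σ.coact a) = 0 := by
  obtain ⟨z, hz⟩ := hI a ha
  replace hz : _ = σ.coact a := hz
  rw [← hz]
  clear hz
  induction z with
  | zero => simp
  | add x y hx hy => rw [map_add, map_add, hx, hy, add_zero]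
  | tmul b h =>
    have : Ideal.Quotient.mk I (b : A) = 0 := Ideal.Quotient.eq_zero_iff_mem.mpr b.2
    simp [this]

/-- The action of `G` on a closed subscheme defined by an invariant ideal. -/
def quotient {I : Ideal A} (hI : σ.toCoaction.IsStable (I.restrictScalars k)) :
    GAction k H (A ⧸ I) :=
  σ.ofSurjective (Ideal.Quotient.mkₐ k I) (Ideal.Quotient.mkₐ_surjective k I)
    (Ideal.Quotient.liftₐ I ((Algebra.TensorProduct.map (Ideal.Quotient.mkₐ k I)
      (AlgHom.id k H)).comp σ.coact) fun _ ↦ map_coact_eq_zero hI)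
    (Ideal.Quotient.liftₐ_comp _ _ _)

lemma quotient_coact {I : Ideal A} (hI : σ.toCoaction.IsStable (I.restrictScalars k)) :
    (quotient hI).coact.comp (Ideal.Quotient.mkₐ k I) =
      (Algebra.TensorProduct.map (Ideal.Quotient.mkₐ k I) (AlgHom.id k H)).comp σ.coact :=
  Ideal.Quotient.liftₐ_comp _ _ _

variable {x : A →ₐ[k] k}

variable (σ x) in
lemma infNbhd_of_hom (n : ℕ) ⦃ξ η : σ.AffinePoint⦄ (u : ξ ⟶ η) (h : σ.infNbhd x n η) :
    σ.infNbhd x n ξ := fun a ha ↦ by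
  rw [← AffinePoint.Hom.toP_comp u, AlgHom.comp_apply, h a ha, map_zero]

lemma infNbhd_ofHom (hx : σ.IsFixed x) {n N : ℕ} (h : N ≤ n) :
    σ.infNbhd x n (AffinePoint.ofHom (Ideal.Quotient.mkₐ k (RingHom.ker x ^ (N + 1)))) :=
  fun _ ha ↦ map_coact_eq_zero (isStable_pow (isStable_ker hx) _)
    (Ideal.pow_le_pow_right (by lia) ha)

lemma exists_comp_mk_eq_toP (n : ℕ) (ξ : σ.AffinePoint) (h : σ.infNbhd x n ξ) :
    ∃ b : A ⧸ RingHom.ker x ^ (n + 1) →ₐ[k] ξ.P,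
      b.comp (Ideal.Quotient.mkₐ k (RingHom.ker x ^ (n + 1))) = ξ.toP :=
  ⟨Ideal.Quotient.liftₐ _ ξ.toP h, Ideal.Quotient.liftₐ_comp _ _ _⟩

namespace Family

variable {Q : ObjectProperty σ.AffinePoint}

/-- The value of `M` at a morphism `Spec B → Spec A`, as an `A`-module. -/
def FiberAt (M : Family Q) (α : A →ₐ[k] B) (hα : Q (AffinePoint.ofHom α)) : Type u :=
  M.obj (AffinePoint.ofHom α) hα

namespace FiberAt

variable (M : Family Q) (α : A →ₐ[k] B) (hα : Q (AffinePoint.ofHom α))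

instance : AddCommGroup (FiberAt M α hα) :=
  inferInstanceAs (AddCommGroup (M.obj (AffinePoint.ofHom α) hα))

instance : Module k (FiberAt M α hα) :=
  inferInstanceAs (Module k (M.obj (AffinePoint.ofHom α) hα))

instance (priority := low) : Module B (FiberAt M α hα) :=
  inferInstanceAs (Module B (M.obj (AffinePoint.ofHom α) hα))

instance (priority := low) : IsScalarTower k B (FiberAt M α hα) :=
  inferInstanceAs (IsScalarTower k B (M.obj (AffinePoint.ofHom α) hα))

instance : Module A (FiberAt M α hα) := Module.compHom _ α.toRingHom

variable {M α hα}

lemma smul_def (a : A) (m : FiberAt M α hα) : a • m = α a • m := rfl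

instance : IsScalarTower k A (FiberAt M α hα) := .of_algebraMap_smul fun a m ↦ by
  rw [smul_def, AlgHom.commutes, algebraMap_smul]

variable (hQ : ∀ ⦃ξ η : σ.AffinePoint⦄, (ξ ⟶ η) → Q η → Q ξ) {τ : GAction k H B}
  (hτ : τ.coact.comp α = (Algebra.TensorProduct.map α (AlgHom.id k H)).comp σ.coact)

variable (M hα) in
/-- The coaction on the value at an equivariant morphism. -/
def coaction : Coaction k H (FiberAt M α hα) := Family.coaction (M := M) hQ hα hτ

lemma isEquivariant : (coaction M hα hQ hτ).IsEquivariant σ := fun a m ↦ by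
  have h1 := rTensor_tensorAct (H := H) (j := LinearMap.id (R := k) (M := FiberAt M α hα))
    (θ := α) (fun _ _ ↦ rfl) (σ.coact a) ((coaction M hα hQ hτ).coact m)
  rw [LinearMap.rTensor_id, LinearMap.id_apply, LinearMap.id_apply] at h1
  rw [h1]
  refine (isEquivariant_coaction (M := M) hQ hα hτ (α a) m).trans ?_
  exact congrArg (fun y ↦ tensorAct k B H (FiberAt M α hα) H y _) (DFunLike.congr_fun hτ a)

section Res

variable {C : Type u} [CommRing C] [Algebra k C] {β : A →ₐ[k] C}
  (hβ : Q (AffinePoint.ofHom β)) (φ : B →ₐ[k] C) (h : φ.comp α = β)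

variable (M hα) in
/-- The restriction maps between the values. -/
def res : FiberAt M α hα →ₗ[A] FiberAt M β hβ :=
  { M.res hβ hα (AffinePoint.mapHom φ h) with
    map_smul' := fun a m ↦ (res_mapHom_smul hα hβ φ h (α a) m).trans
      (congrArg (fun c : C ↦ c • (M.res hβ hα (AffinePoint.mapHom φ h) m : FiberAt M β hβ))
        (DFunLike.congr_fun h a)) }

lemma isBC_res : IsBC (M := FiberAt M α hα) (N := FiberAt M β hβ) φ.toRingHom
    (res M hα hβ φ h).toAddMonoidHom :=
  M.isBC hβ hα (AffinePoint.mapHom φ h)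

lemma isHom_res {τ' : GAction k H C}
    (hτ' : τ'.coact.comp β = (Algebra.TensorProduct.map β (AlgHom.id k H)).comp σ.coact)
    (hφ : τ'.coact.comp φ = (Algebra.TensorProduct.map φ (AlgHom.id k H)).comp τ.coact) :
    (coaction M hα hQ hτ).IsHom (coaction M hβ hQ hτ')
      ((res M hα hβ φ h).restrictScalars k) :=
  isHom_resₗ hQ hα hτ hβ hτ' φ h hφ

end Res

variable {N : Family Q} (f : Hom M N)

variable (hα) in
/-- The value of a morphism. -/
def map : FiberAt M α hα →ₗ[A] FiberAt N α hα :=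
  { f.app (AffinePoint.ofHom α) hα with
    map_smul' := fun a m ↦ (f.app (AffinePoint.ofHom α) hα).map_smul (α a) m }

lemma isHom_map : (coaction M hα hQ hτ).IsHom (coaction N hα hQ hτ)
    ((map hα f).restrictScalars k) :=
  f.isHom hQ hα hτ

end FiberAt

end Family

end GAction

end Quotient

/-! ### Faithfulness and fullness -/

section Completeness

variable {k H A B : Type u} [Field k] [CommRing H] [HopfAlgebra k H] [CommRing A]
  [Algebra k A] [CommRing B] [Algebra k B] {σ : GAction k H A} {x : A →ₐ[k] k}

open Coaction

lemma IsBC.of_bijective {R M N : Type*} [CommRing R] [AddCommGroup M] [Module R M]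
    [AddCommGroup N] [Module R N] {l : M →ₗ[R] N} (hl : Function.Bijective l) :
    IsBC (RingHom.id R) l.toAddMonoidHom :=
  .of_surjective Function.surjective_id l.map_smul hl.2 fun m hm ↦ by
    rw [hl.1 (hm.trans l.map_zero.symm)]
    exact zero_mem _

lemma Coaction.IsHom.comp {L M N : Type*} [AddCommGroup L] [Module k L] [AddCommGroup M]
    [Module k M] [AddCommGroup N] [Module k N] {b : Coaction k H L} {c : Coaction k H M} {d : Coaction k H N}
    {f : L →ₗ[k] M} {g : M →ₗ[k] N} (hg : c.IsHom d g) (hf : b.IsHom c f) : b.IsHom d (g ∘ₗ f) :=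
  fun m ↦ by rw [LinearMap.comp_apply, hg, hf, LinearMap.rTensor_comp_apply]

namespace GAction

open AffinePoint

namespace Family

variable {Q Q' : ObjectProperty σ.AffinePoint}

lemma Hom.exists_comp_inv {L M N : Family Q} (l : Hom L M)
    (hl : ∀ ξ h, Function.Bijective (l.app ξ h)) (g : Hom L N) :
    ∃ f : Hom M N, ∀ ξ h z, f.app ξ h (l.app ξ h z) = g.app ξ h z := by
  have h1 (ξ) (h : Q ξ) (z) :
      (LinearEquiv.ofBijective (l.app ξ h) (hl ξ h)).symm (l.app ξ h z) = z :=
    (LinearEquiv.ofBijective (l.app ξ h) (hl ξ h)).symm_apply_apply z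
  refine ⟨{ app := fun ξ h ↦ g.app ξ h ∘ₗ (LinearEquiv.ofBijective (l.app ξ h) (hl ξ h)).symm
            naturality := fun {ξ η} hξ hη u m ↦ ?_ }, fun ξ h z ↦ congrArg (g.app ξ h) (h1 ξ h z)⟩
  obtain ⟨z, rfl⟩ := (hl η hη).2 m
  rw [LinearMap.comp_apply, LinearMap.comp_apply, ← l.naturality hξ hη]
  refine (congrArg (g.app ξ hξ) (h1 ξ hξ _)).trans ((g.naturality hξ hη u z).trans ?_)
  exact congrArg (fun y ↦ N.res hξ hη u (g.app η hη y)) (h1 η hη z).symm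

end Family

lemma coact_comp_id (σ : GAction k H A) : σ.coact.comp (AlgHom.id k A) =
    (Algebra.TensorProduct.map (AlgHom.id k A) (AlgHom.id k H)).comp σ.coact := by
  rw [Algebra.TensorProduct.map_id, AlgHom.comp_id, AlgHom.id_comp]

lemma top_prop (ξ : σ.AffinePoint) : (⊤ : ObjectProperty σ.AffinePoint) ξ := True.intro

lemma top_of_hom ⦃ξ η : σ.AffinePoint⦄ (_ : ξ ⟶ η) (_ : (⊤ : ObjectProperty σ.AffinePoint) η) :
    (⊤ : ObjectProperty σ.AffinePoint) ξ := True.intro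

variable (x) in
/-- The projection from `A` to the coordinate ring of the `n`-th infinitesimal neighbourhood. -/
abbrev mkNbhd (n : ℕ) : A →ₐ[k] A ⧸ RingHom.ker x ^ (n + 1) :=
  Ideal.Quotient.mkₐ k (RingHom.ker x ^ (n + 1))

variable (x) in
/-- The projection from the coordinate ring of an infinitesimal neighbourhood to the previous
one. -/
abbrev factorNbhd (n : ℕ) : A ⧸ RingHom.ker x ^ (n + 1 + 1) →ₐ[k] A ⧸ RingHom.ker x ^ (n + 1) :=
  Ideal.Quotient.factorₐ k (Ideal.pow_le_pow_right (Nat.le_succ _))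

lemma factorNbhd_comp (n : ℕ) : (factorNbhd x n).comp (mkNbhd x (n + 1)) = mkNbhd x n := rfl

lemma mkNbhd_surjective (n : ℕ) : Function.Surjective (mkNbhd x n) :=
  Ideal.Quotient.mkₐ_surjective _ _

lemma ker_mkNbhd (n : ℕ) : RingHom.ker (mkNbhd x n).toRingHom = RingHom.ker x ^ (n + 1) :=
  Ideal.mk_ker

lemma factorNbhd_surjective (n : ℕ) : Function.Surjective (factorNbhd x n) :=
  .of_comp (g := mkNbhd x (n + 1)) (mkNbhd_surjective n)

lemma isStable_nbhd (hx : σ.IsFixed x) (n : ℕ) :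
    σ.toCoaction.IsStable ((RingHom.ker x ^ (n + 1)).restrictScalars k) :=
  isStable_pow (isStable_ker hx) _

namespace Family

/-- The module of sections over `Spec A`, for a module on `[Spec A / G]`. -/
abbrev OnCover (M : Family (σ := σ) ⊤) : Type u := FiberAt M (AlgHom.id k A) (top_prop _)

variable {M N : Family (σ := σ) ⊤}

/-- Restriction of the sections over `Spec A` to an infinitesimal neighbourhood. -/
abbrev OnCover.res (M : Family (σ := σ) ⊤) (x : A →ₐ[k] k) (n : ℕ) :
    M.OnCover →ₗ[A] FiberAt M (mkNbhd x n) (top_prop _) :=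
  FiberAt.res M (top_prop _) (top_prop _) (mkNbhd x n) (AlgHom.comp_id _)

lemma OnCover.res_eq_zero_iff (n : ℕ) (m : N.OnCover) :
    OnCover.res N x n m = 0 ↔ m ∈ (RingHom.ker x ^ (n + 1) • ⊤ : Submodule A N.OnCover) := by
  have := (FiberAt.isBC_res (M := N) (hα := top_prop _) (top_prop _) (mkNbhd x n)
    (AlgHom.comp_id _)).eq_zero_iff (mkNbhd_surjective n) (A := A) (α := RingHom.id A)
      Function.surjective_id (fun _ _ ↦ rfl) (m := m)
  refine this.trans ?_
  change m ∈ RingHom.ker (mkNbhd x n).toRingHom • (⊤ : Submodule A N.OnCover) ↔ _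
  rw [ker_mkNbhd]

/-- The sections over `Spec A` determine a module on `[Spec A / G]`. -/
lemma exists_hom_of_onCover {F : Type u} [AddCommGroup F] [Module A F] [Module k F]
    [IsScalarTower k A F] {c : Coaction k H F} (hc : c.IsEquivariant σ)
    {r : F →ₗ[A] N.OnCover} (hr : c.IsHom (FiberAt.coaction N (top_prop _) top_of_hom
      (coact_comp_id σ)) (r.restrictScalars k)) :
    ∃ l : Hom (associated hc) N,
      (∀ ξ (z : assoc hc ξ), N.res (top_prop _) (top_prop _) (coverHom ξ) (l.app ξ (top_prop _) z) =
        extend (N := N) (hα := top_prop _) (r := r.restrictScalars k) r.map_smul (top_prop _)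
          (AlgHom.comp_id ξ.toP) z.1) ∧
      (Function.Bijective r → ∀ ξ h, Function.Bijective (l.app ξ h)) := by
  obtain ⟨l, hl, hl'⟩ := exists_hom (N := N) (hα := top_prop _) top_of_hom hc
    (r := r.restrictScalars k) r.map_smul hr Function.surjective_id
    fun ξ _ ↦ ⟨ξ.toP, AlgHom.comp_id _⟩
  exact ⟨l, fun ξ z ↦ hl ξ (top_prop _) _ _ z, fun h ↦ hl' (IsBC.of_bijective h)⟩

variable [IsNoetherianRing A] [IsLocalRing σ.invariants]

/-- Faithfulness of completion: morphisms of coherent modules that agree on all infinitesimal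
neighbourhoods agree. -/
theorem Hom.app_eq_of_infNbhd (hH : ExactInvariants k H) (hx : σ.IsFixed x)
    [Module.Finite A N.OnCover] {f g : Hom M N}
    (h : ∀ n ξ, σ.infNbhd x n ξ → ∀ m, f.app ξ (top_prop _) m = g.app ξ (top_prop _) m)
    (ξ : σ.AffinePoint) (m : M.obj ξ (top_prop _)) :
    f.app ξ (top_prop _) m = g.app ξ (top_prop _) m := by
  have h0 (m) : f.app (ofHom (AlgHom.id k A)) (top_prop _) m =
      g.app (ofHom (AlgHom.id k A)) (top_prop _) m := by
    rw [← sub_eq_zero]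
    refine eq_zero_of_forall_mem_pow_smul hH hx (M := N.OnCover)
      (FiberAt.isEquivariant top_of_hom (coact_comp_id σ)) fun n ↦ ?_
    refine Submodule.smul_mono_left (Ideal.pow_le_pow_right (Nat.le_succ n))
      ((OnCover.res_eq_zero_iff n _).mp ?_)
    refine (map_sub _ _ _).trans (sub_eq_zero.mpr ?_)
    exact (f.naturality _ _ _ m).symm.trans (
      (h n _ (infNbhd_ofHom hx le_rfl) _).trans (g.naturality _ _ _ m))
  apply res_coverHom_injective (M := N) (ξ := ξ) (top_prop _) (top_prop _)
  rw [← f.naturality, ← g.naturality]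
  refine (M.isBC (top_prop _) (top_prop _) (mapHom ξ.toP (AlgHom.comp_id _) :
    ξ.cover ⟶ ofHom (AlgHom.id k A))).linear_ext (fun (p : ξ.P) n ↦ p • n)
    (l := (f.app ξ.cover (top_prop _)).toAddMonoidHom)
    (l' := (g.app ξ.cover (top_prop _)).toAddMonoidHom)
    (f.app ξ.cover (top_prop _)).map_smul (g.app ξ.cover (top_prop _)).map_smul (fun m ↦ ?_) _
  refine (f.naturality _ _ _ m).trans (Eq.trans ?_ (g.naturality _ _ _ m).symm)
  rw [h0]

variable [IsAdicComplete (IsLocalRing.maximalIdeal σ.invariants) σ.invariants]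

/-- Fullness of completion: compatible morphisms on the infinitesimal neighbourhoods come from a
morphism. On the sections over `Spec A` it is given by `exists_hom_of_compatible`; since the torsor
of an affine point maps to `Spec A`, it then extends to all affine points by descent. -/
theorem exists_hom_of_infNbhd (hH : ExactInvariants k H) (hx : σ.IsFixed x)
    [Module.Finite A N.OnCover]
    (h : ∀ n, Hom (M.restrict (le_top : σ.infNbhd x n ≤ ⊤)) (N.restrict (le_top : _ ≤ ⊤)))
    (hcomp : ∀ n ξ (hξ : σ.infNbhd x n ξ) m,
      (h n).app ξ hξ m = (h (n + 1)).app ξ (σ.infNbhd_le x n _ hξ) m) :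
    ∃ f : Hom M N, ∀ n ξ (hξ : σ.infNbhd x n ξ) m, f.app ξ (top_prop _) m = (h n).app ξ hξ m := by
  have hmem (n : ℕ) : σ.infNbhd x n (ofHom (mkNbhd x n)) := infNbhd_ofHom hx le_rfl
  have hτ (n : ℕ) := quotient_coact (isStable_nbhd hx n)
  let e (n : ℕ) := FiberAt.coaction N (top_prop _) top_of_hom (hτ n)
  have hres (L : Family (σ := σ) ⊤) (n : ℕ) :
      (FiberAt.coaction L (top_prop _) top_of_hom (coact_comp_id σ)).IsHom
        (FiberAt.coaction L (top_prop _) top_of_hom (hτ n))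
        ((OnCover.res L x n).restrictScalars k) :=
    FiberAt.isHom_res top_of_hom (coact_comp_id σ) _ _ _ (hτ n) (hτ n)
  let r (n : ℕ) : M.OnCover →ₗ[A] FiberAt N (mkNbhd x n) (top_prop _) :=
    FiberAt.map (M := M.restrict _) (hmem n) (h n) ∘ₗ OnCover.res M x n
  obtain ⟨f₀, hf₀, hf₀'⟩ := exists_hom_of_compatible (F := N.OnCover) (e := e) hH hx
    (FiberAt.isEquivariant top_of_hom (coact_comp_id σ)) (π := OnCover.res N x)
    (hres N) (fun n ↦ (FiberAt.isBC_res (M := N) (top_prop _) (mkNbhd x n)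
      (AlgHom.comp_id _)).surjective (mkNbhd_surjective n))
    (fun n ↦ Submodule.ext fun m ↦ OnCover.res_eq_zero_iff n m)
    (d := FiberAt.coaction M (top_prop _) top_of_hom (coact_comp_id σ)) (r := r)
    (fun n ↦ (FiberAt.isHom_map (infNbhd_of_hom σ x n) (hτ n) (h n)).comp (hres M n))
    (fun n w m hw ↦ by
      let s : (ofHom (mkNbhd x n) : σ.AffinePoint) ⟶ ofHom (mkNbhd x (n + 1)) :=
        mapHom (factorNbhd x n) (factorNbhd_comp n)
      have hs (L : Family (σ := σ) ⊤) (y : L.OnCover) : L.res (top_prop _) (top_prop _) s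
          (OnCover.res L x (n + 1) y) = OnCover.res L x n y := by
        refine (L.res_comp _ _ _ _ _ y).symm.trans ?_
        rw [mapHom_comp]
        rfl
      refine (hs N w).symm.trans ((congrArg (N.res (top_prop _) (top_prop _) s) hw).trans ?_)
      refine ((h (n + 1)).naturality (σ.infNbhd_le x n _ (hmem n)) (hmem (n + 1)) s _).symm.trans ?_
      refine (hcomp n _ (hmem n) _).symm.trans ?_
      exact congrArg ((h n).app _ (hmem n)) (hs M m))
  obtain ⟨l, hl, hl'⟩ := exists_hom_of_onCover (N := M)
    (FiberAt.isEquivariant top_of_hom (coact_comp_id σ)) (r := LinearMap.id) fun m ↦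
      (DFunLike.congr_fun (LinearMap.rTensor_id (R := k) H M.OnCover) _).symm
  obtain ⟨g, hg, -⟩ := exists_hom_of_onCover (N := N)
    (FiberAt.isEquivariant top_of_hom (coact_comp_id σ)) (r := f₀) hf₀
  obtain ⟨f, hf⟩ := l.exists_comp_inv (hl' Function.bijective_id) g
  refine ⟨f, fun n ξ hξ m ↦ ?_⟩
  obtain ⟨z, rfl⟩ := (hl' Function.bijective_id ξ (top_prop _)).2 m
  apply res_coverHom_injective (M := N) (ξ := ξ) (top_prop _) (top_prop _)
  have hξ' := infNbhd_of_hom σ x n (coverHom ξ) hξ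
  rw [hf, hg]
  refine Eq.trans ?_ ((h n).naturality hξ' hξ (coverHom ξ) _)
  refine Eq.trans ?_ (congrArg ((h n).app ξ.cover hξ') (hl ξ z).symm)
  obtain ⟨b, hb⟩ := exists_comp_mk_eq_toP n ξ hξ
  have hres' (L : Family (σ := σ) ⊤) (y : L.OnCover) : L.res (top_prop _) (top_prop _)
      (mapHom ξ.toP (AlgHom.comp_id _)) y =
      L.res (top_prop ξ.cover) (top_prop _) (mapHom b hb) (OnCover.res L x n y) := by
    refine Eq.trans ?_ (L.res_comp _ _ _ _ _ y)
    rw [mapHom_comp, mapHom_congr _ hb.symm]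
  generalize z.1 = z
  induction z using Pull.induction_on with
  | zero => simp only [map_zero]
  | add z z' h1 h2 => simp only [map_add, h1, h2]
  | smul p y =>
    rw [map_smul, map_smul]
    refine Eq.trans ?_ ((h n).app ξ.cover hξ' |>.map_smul p _).symm
    refine congrArg (p • ·) ((extend_of _ _ _ y).trans (Eq.trans ?_
      (congrArg ((h n).app ξ.cover hξ')
        (extend_of (N := M) (hα := top_prop _) _ (top_prop ξ.cover) _ y).symm)))
    refine (hres' N _).trans (Eq.trans ?_ (congrArg ((h n).app ξ.cover hξ') (hres' M y).symm))
    refine Eq.trans ?_ ((h n).naturality hξ' (hmem n) (mapHom b hb) _).symm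
    exact congrArg (N.res (top_prop _) (top_prop _) (mapHom b hb)) (hf₀' n y)

end Family

end GAction

end Completeness

/-! ### Essential surjectivity -/

section Existence

variable {k H A : Type u} [Field k] [CommRing H] [HopfAlgebra k H] [CommRing A]
  [Algebra k A] {σ : GAction k H A} {x : A →ₐ[k] k}

open Coaction

/-- A tower of equivariant modules over the quotients `A / 𝔪 ^ (n + 1)`, each of which is the base
change of the next, consists of the quotients of a finite equivariant `A`-module. -/
theorem Coaction.exists_limit [IsNoetherianRing A] [IsLocalRing σ.invariants]
    [IsAdicComplete (IsLocalRing.maximalIdeal σ.invariants) σ.invariants]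
    {E : ℕ → Type u} [∀ n, AddCommGroup (E n)] [∀ n, Module k (E n)] [∀ n, Module A (E n)]
    [∀ n, IsScalarTower k A (E n)] {e : ∀ n, Coaction k H (E n)}
    (he : ∀ n, (e n).IsEquivariant σ) {t : ∀ n, E (n + 1) →ₗ[A] E n}
    (ht : ∀ n, (e (n + 1)).IsHom (e n) ((t n).restrictScalars k))
    (hsurj : ∀ n, Function.Surjective (t n))
    (hker : ∀ n, LinearMap.ker (t n) = RingHom.ker x ^ (n + 1) • ⊤)
    (hzero : ∀ n, (RingHom.ker x ^ (n + 1) • ⊤ : Submodule A (E n)) = ⊥)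
    (hH : ExactInvariants k H) (hx : σ.IsFixed x) [Module.Finite A (E 0)] :
    ∃ (F : Type u) (_ : AddCommGroup F) (_ : Module k F) (_ : Module A F)
      (_ : IsScalarTower k A F) (c : Coaction k H F) (_ : c.IsEquivariant σ)
      (_ : Module.Finite A F) (π : ∀ n, F →ₗ[A] E n),
      (∀ n, c.IsHom (e n) ((π n).restrictScalars k)) ∧ (∀ n, Function.Surjective (π n)) ∧
      (∀ n, LinearMap.ker (π n) = RingHom.ker x ^ (n + 1) • ⊤) ∧
      ∀ n f, t n (π (n + 1) f) = π n f :=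
  ⟨equivariantLimit he t, inferInstance, inferInstance, inferInstance, inferInstance,
    equivariantLimit.coaction he ht, equivariantLimit.isEquivariant he ht,
    equivariantLimit.finite he ht hsurj hker hzero hH, equivariantLimit.proj he t,
    equivariantLimit.isHom_proj he ht, equivariantLimit.surjective_proj he ht hsurj hker hzero hH,
    equivariantLimit.ker_proj he ht hsurj hker hzero hH hx, equivariantLimit.t_proj he⟩

lemma IsBC.of_linearMap {R S M N : Type*} [CommRing R] [CommRing S] [AddCommGroup M] [Module R M]
    [AddCommGroup N] [Module R N] [Module S N] {φ : R →+* S} (hφ : Function.Surjective φ)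
    (hN : ∀ (r : R) (n : N), r • n = φ r • n) {f : M →ₗ[R] N} (hf : Function.Surjective f)
    (hker : LinearMap.ker f = RingHom.ker φ • ⊤) : IsBC φ f.toAddMonoidHom :=
  .of_surjective hφ (fun r m ↦ (f.map_smul r m).trans (hN _ _)) hf fun _ hm ↦
    hker ▸ LinearMap.mem_ker.mpr hm

namespace GAction

open AffinePoint

namespace Family

/-- Compatibility of `extend` with a morphism from the restriction of `Y` to a substack. -/
lemma Hom.app_extend {Q Q' : ObjectProperty σ.AffinePoint} {Y : Family Q'} {X : Family Q}
    {hle : Q ≤ Q'} (i : Hom (Y.restrict hle) X) {B B' : Type u} [CommRing B] [Algebra k B]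
    [CommRing B'] [Algebra k B'] {α : A →ₐ[k] B} {α' : A →ₐ[k] B'} {hα : Q (ofHom α)}
    {hα' : Q' (ofHom α')} {φ : B' →ₐ[k] B} (hφ : φ.comp α' = α) {F : Type u} [AddCommGroup F]
    [Module A F] [Module k F] [IsScalarTower k A F] {r : F →ₗ[k] X.obj (ofHom α) hα}
    {r' : F →ₗ[k] Y.obj (ofHom α') hα'} (hr : ∀ a f, r (a • f) = α a • r f)
    (hr' : ∀ a f, r' (a • f) = α' a • r' f)
    (h : ∀ f, i.app (ofHom α) hα (Y.res (hle _ hα) hα' (mapHom φ hφ) (r' f)) = r f)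
    {ξ : σ.AffinePoint} (hξ : Q ξ.cover) {b : B →ₐ[k] ξ.P} (hb : b.comp α = ξ.toP)
    (hb' : (b.comp φ).comp α' = ξ.toP) (z : Pull ξ.toP F) :
    i.app ξ.cover hξ (extend hr' (hle _ hξ) hb' z) = extend hr hξ hb z := by
  have h1 (m) : Y.res (hle _ hξ) hα' (mapHom (b.comp φ) hb') m =
      Y.res (hle _ hξ) (hle _ hα) (mapHom b hb) (Y.res (hle _ hα) hα' (mapHom φ hφ) m) := by
    rw [← Y.res_comp, mapHom_comp]
  induction z using Pull.induction_on with
  | zero => simp only [map_zero]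
  | add z z' h1 h2 => simp only [map_add, h1, h2]
  | smul p y =>
    simp only [map_smul, extend_of, h1, ← h]
    refine congrArg (p • ·) ?_
    exact i.naturality hξ hα (mapHom b hb) _

section Tower

lemma coact_mkNbhd (hx : σ.IsFixed x) (n : ℕ) : (quotient (isStable_nbhd hx n)).coact.comp
    (mkNbhd x n) = (Algebra.TensorProduct.map (mkNbhd x n) (AlgHom.id k H)).comp σ.coact :=
  quotient_coact _

lemma coact_factorNbhd (hx : σ.IsFixed x) (n : ℕ) : (quotient (isStable_nbhd hx n)).coact.comp
    (factorNbhd x n) = (Algebra.TensorProduct.map (factorNbhd x n) (AlgHom.id k H)).comp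
      (quotient (isStable_nbhd hx (n + 1))).coact := by
  rw [← AlgHom.cancel_right (mkNbhd_surjective (x := x) (n + 1)), AlgHom.comp_assoc,
    AlgHom.comp_assoc, coact_mkNbhd hx, factorNbhd_comp, coact_mkNbhd hx, ← AlgHom.comp_assoc,
    ← Algebra.TensorProduct.map_comp, AlgHom.comp_id, factorNbhd_comp]

variable (hx : σ.IsFixed x) (X : ∀ n, Family (σ.infNbhd x n))
  (i : ∀ n, Hom ((X (n + 1)).restrict (σ.infNbhd_le x n)) (X n))
  (hi : ∀ n ξ h, Function.Bijective ((i n).app ξ h))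

/-- The sections over the `n`-th infinitesimal neighbourhood in `Spec A` of the `n`-th member of a
system of modules on the infinitesimal neighbourhoods in `[Spec A / G]`. -/
abbrev OnNbhd (n : ℕ) : Type u := FiberAt (X n) (mkNbhd x n) (infNbhd_ofHom hx le_rfl)

/-- The coaction on the sections over the `n`-th infinitesimal neighbourhood. -/
def onNbhdCoaction (n : ℕ) : Coaction k H (OnNbhd hx X n) :=
  FiberAt.coaction (X n) (infNbhd_ofHom hx le_rfl) (infNbhd_of_hom σ x n)
    (coact_mkNbhd hx n)

lemma isEquivariant_onNbhdCoaction (n : ℕ) : (onNbhdCoaction hx X n).IsEquivariant σ :=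
  FiberAt.isEquivariant (infNbhd_of_hom σ x n) (coact_mkNbhd hx n)

variable {X}

/-- The transition maps between the sections over the infinitesimal neighbourhoods. -/
def onNbhdTransition (n : ℕ) : OnNbhd hx X (n + 1) →ₗ[A] OnNbhd hx X n :=
  FiberAt.map (M := (X (n + 1)).restrict _) (infNbhd_ofHom hx le_rfl) (i n) ∘ₗ
    FiberAt.res (X (n + 1)) (infNbhd_ofHom hx le_rfl)
      (σ.infNbhd_le x n _ (infNbhd_ofHom hx le_rfl)) (factorNbhd x n) (factorNbhd_comp n)

lemma onNbhdTransition_apply (n : ℕ) (m : OnNbhd hx X (n + 1)) : onNbhdTransition hx i n m =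
    (i n).app (ofHom (mkNbhd x n)) (infNbhd_ofHom hx le_rfl) ((X (n + 1)).res
      (σ.infNbhd_le x n _ (infNbhd_ofHom hx le_rfl)) (infNbhd_ofHom hx le_rfl)
      (mapHom (factorNbhd x n) (factorNbhd_comp n)) m) := rfl

lemma isHom_onNbhdTransition (n : ℕ) : (onNbhdCoaction hx X (n + 1)).IsHom
    (onNbhdCoaction hx X n) ((onNbhdTransition hx i n).restrictScalars k) :=
  IsHom.comp (FiberAt.isHom_map (infNbhd_of_hom σ x n) (coact_mkNbhd hx n) (i n))
    (FiberAt.isHom_res (infNbhd_of_hom σ x (n + 1)) (coact_mkNbhd hx (n + 1))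
      _ _ _ (coact_mkNbhd hx n) (coact_factorNbhd hx n))

lemma smul_top_onNbhd (n : ℕ) :
    (RingHom.ker x ^ (n + 1) • ⊤ : Submodule A (OnNbhd hx X n)) = ⊥ := by
  refine eq_bot_iff.mpr (Submodule.smul_le.mpr fun a ha m _ ↦ ?_)
  rw [← ker_mkNbhd] at ha
  rw [FiberAt.smul_def, show mkNbhd x n a = 0 from ha]
  exact zero_smul (A ⧸ RingHom.ker x ^ (n + 1)) m

include hi

lemma isBC_onNbhdTransition (n : ℕ) :
    IsBC (M := OnNbhd hx X (n + 1)) (N := OnNbhd hx X n) (factorNbhd x n).toRingHom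
      (onNbhdTransition hx i n).toAddMonoidHom :=
  (FiberAt.isBC_res (M := X (n + 1)) (hα := infNbhd_ofHom hx le_rfl)
    (σ.infNbhd_le x n _ (infNbhd_ofHom hx le_rfl))
    (factorNbhd x n) (factorNbhd_comp n)).comp
      (IsBC.of_bijective (hi n _ (infNbhd_ofHom hx le_rfl)))
    (fun _ ↦ rfl) fun _ ↦ rfl

lemma surjective_onNbhdTransition (n : ℕ) : Function.Surjective (onNbhdTransition hx i n) :=
  (isBC_onNbhdTransition hx i hi n).surjective (factorNbhd_surjective n)

lemma ker_onNbhdTransition (n : ℕ) :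
    LinearMap.ker (onNbhdTransition hx i n) = RingHom.ker x ^ (n + 1) • ⊤ :=
  Submodule.ext fun m ↦ ((isBC_onNbhdTransition hx i hi n).eq_zero_iff (factorNbhd_surjective n)
    (α := (mkNbhd x (n + 1)).toRingHom) (mkNbhd_surjective (n + 1))
    (fun _ _ ↦ rfl) (m := m)).trans (by
      change m ∈ RingHom.ker (mkNbhd x n).toRingHom • (⊤ : Submodule A (OnNbhd hx X (n + 1))) ↔ _
      rw [ker_mkNbhd])

omit hi

/-- An equivariant `A`-module whose quotients are the sections of `X n` over the infinitesimal
neighbourhoods in `Spec A` restricts to `X n` on the infinitesimal neighbourhoods in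
`[Spec A / G]`. -/
lemma exists_hom_onNbhd {F : Type u} [AddCommGroup F] [Module A F] [Module k F]
    [IsScalarTower k A F] {c : Coaction k H F} (hc : c.IsEquivariant σ)
    {π : ∀ n, F →ₗ[A] OnNbhd hx X n}
    (hπ : ∀ n, c.IsHom (onNbhdCoaction hx X n) ((π n).restrictScalars k))
    (hsurj : ∀ n, Function.Surjective (π n))
    (hker : ∀ n, LinearMap.ker (π n) = RingHom.ker x ^ (n + 1) • ⊤)
    (ht : ∀ n f, onNbhdTransition hx i n (π (n + 1) f) = π n f) :
    ∃ l : ∀ n, Hom ((associated hc).restrict (le_top : σ.infNbhd x n ≤ ⊤)) (X n),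
      (∀ n ξ h, Function.Bijective ((l n).app ξ h)) ∧
      ∀ n ξ (h : σ.infNbhd x n ξ) m,
        (i n).app ξ h ((l (n + 1)).app ξ (σ.infNbhd_le x n _ h) m) = (l n).app ξ h m := by
  have hBC (n : ℕ) := IsBC.of_linearMap (M := F) (N := OnNbhd hx X n)
    (φ := (mkNbhd x n).toRingHom) (f := π n) (mkNbhd_surjective n) (fun _ _ ↦ rfl) (hsurj n)
    ((hker n).trans (congrArg (· • ⊤) (ker_mkNbhd n).symm))
  have hl (n : ℕ) := exists_hom (N := X n) (hα := infNbhd_ofHom hx le_rfl) (infNbhd_of_hom σ x n)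
    hc (r := (π n).restrictScalars k) (π n).map_smul (hπ n)
    (mkNbhd_surjective n) (exists_comp_mk_eq_toP n)
  choose l hl hl' using hl
  refine ⟨l, fun n ↦ hl' n (hBC n), fun n ξ h z ↦ ?_⟩
  have h' := infNbhd_of_hom σ x n (coverHom ξ) h
  apply res_coverHom_injective h h'
  obtain ⟨b, hb⟩ := exists_comp_mk_eq_toP n ξ h
  have hb' : (b.comp (factorNbhd x n)).comp (mkNbhd x (n + 1)) = ξ.toP := by
    rw [AlgHom.comp_assoc, factorNbhd_comp, hb]
  rw [hl n ξ h b hb, ← (i n).naturality]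
  refine (congrArg ((i n).app ξ.cover h') (hl (n + 1) ξ _ (b.comp (factorNbhd x n)) hb' z)).trans ?_
  have ht' (f : F) := (onNbhdTransition_apply hx i n _).symm.trans (ht n f)
  exact (i n).app_extend (factorNbhd_comp n) (r := (π n).restrictScalars k)
    (r' := (π (n + 1)).restrictScalars k) (π n).map_smul (π (n + 1)).map_smul ht' h' hb hb' z.1

variable [IsNoetherianRing A] [IsLocalRing σ.invariants]
  [IsAdicComplete (IsLocalRing.maximalIdeal σ.invariants) σ.invariants]

include hi in
/-- Essential surjectivity of completion: a system of coherent modules on the infinitesimal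
neighbourhoods comes from a coherent module, the one associated with the limit of the sections over
the infinitesimal neighbourhoods in `Spec A`. -/
theorem exists_family_of_infNbhd (hH : ExactInvariants k H) [Module.Finite A (OnNbhd hx X 0)] :
    ∃ M : Family (σ := σ) ⊤, (∀ ξ, Module.Finite ξ.R (M.obj ξ (top_prop ξ))) ∧
      ∃ l : ∀ n, Hom (M.restrict (le_top : σ.infNbhd x n ≤ ⊤)) (X n),
        (∀ n ξ h, Function.Bijective ((l n).app ξ h)) ∧
        ∀ n ξ (h : σ.infNbhd x n ξ) m,
          (i n).app ξ h ((l (n + 1)).app ξ (σ.infNbhd_le x n _ h) m) = (l n).app ξ h m := by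
  obtain ⟨F, _, _, _, _, c, hc, _, π, hπ, hπsurj, hπker, htπ⟩ :=
    exists_limit (isEquivariant_onNbhdCoaction hx X) (isHom_onNbhdTransition hx i)
      (surjective_onNbhdTransition hx i hi) (ker_onNbhdTransition hx i hi)
      (smul_top_onNbhd hx) hH hx
  exact ⟨associated hc, finite_assoc hc, exists_hom_onNbhd hx i hc hπ hπsurj hπker htπ⟩

end Tower

end Family

end GAction

end Existence

/-! ### The completion functor -/

section Completion

/-- Isomorphisms of systems from compatible isomorphisms of their members. -/
def TowerLimit.isoMk {C : ℕ → Type u'} [∀ n, Category.{v'} (C n)] {F : ∀ n, C (n + 1) ⥤ C n}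
    {X Y : TowerLimit F} (e : ∀ n, X.obj n ≅ Y.obj n)
    (h : ∀ n, (F n).map (e (n + 1)).hom ≫ (Y.iso n).hom = (X.iso n).hom ≫ (e n).hom) : X ≅ Y where
  hom := TowerLimit.Hom.mk (fun n ↦ (e n).hom) h
  inv := TowerLimit.Hom.mk (fun n ↦ (e n).inv) fun n ↦ by
    rw [Iso.eq_comp_inv, Category.assoc, ← h, ← Category.assoc, ← Functor.map_comp,
      Iso.inv_hom_id, CategoryTheory.Functor.map_id, Category.id_comp]
  hom_inv_id := TowerLimit.Hom.ext (funext fun n ↦ (e n).hom_inv_id)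
  inv_hom_id := TowerLimit.Hom.ext (funext fun n ↦ (e n).inv_hom_id)

variable {k H A : Type u} [Field k] [CommRing H] [HopfAlgebra k H] [CommRing A]
  [Algebra k A] {σ : GAction k H A} {x : A →ₐ[k] k}

open Coaction

namespace GAction

open AffinePoint Family

/-- The family of modules underlying a coherent module on an infinitesimal neighbourhood. -/
abbrev cohFamily {n : ℕ} (M : Coh (σ.infNbhdSheaf x n)) : Family (σ.infNbhd x n) :=
  .ofPMod M.obj M.property.1

/-- The family of modules underlying a coherent module on `[Spec A / G]`. -/
abbrev cohFamilyTop (M : Coh σ.structureSheaf) : Family (σ := σ) ⊤ :=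
  .ofQCoh M.obj M.property.1

lemma finite_onCover (M : Coh σ.structureSheaf) : Module.Finite A (cohFamilyTop M).OnCover :=
  M.property.2 (op (ofHom (AlgHom.id k A)))

lemma finite_onNbhd (hx : σ.IsFixed x) (M : ∀ n, Coh (σ.infNbhdSheaf x n)) :
    Module.Finite A (OnNbhd hx (fun n ↦ cohFamily (M n)) 0) := by
  have h1 : Module.Finite (A ⧸ RingHom.ker x ^ (0 + 1)) (OnNbhd hx (fun n ↦ cohFamily (M n)) 0) :=
    (M 0).property.2 (op ⟨ofHom (mkNbhd x 0), infNbhd_ofHom hx le_rfl⟩)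
  have : IsScalarTower A (A ⧸ RingHom.ker x ^ (0 + 1)) (OnNbhd hx (fun n ↦ cohFamily (M n)) 0) :=
    .of_algebraMap_smul fun _ _ ↦ rfl
  exact .trans (A ⧸ RingHom.ker x ^ (0 + 1)) _

section Restrict

variable {M N : Coh σ.structureSheaf} {n : ℕ}

/-- The morphism of families underlying a morphism between restrictions of coherent modules. -/
def homRestrict (f : (σ.cohRestrict x n).obj M ⟶ (σ.cohRestrict x n).obj N) :
    Hom ((cohFamilyTop M).restrict (le_top : σ.infNbhd x n ≤ ⊤))
      ((cohFamilyTop N).restrict (le_top : σ.infNbhd x n ≤ ⊤)) :=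
  Hom.ofPMod (hM := ((σ.cohRestrict x n).obj M).property.1)
    (hN := ((σ.cohRestrict x n).obj N).property.1) f.hom

lemma map_homMk_toPMod {f : (σ.cohRestrict x n).obj M ⟶ (σ.cohRestrict x n).obj N}
    {g : Hom (cohFamilyTop M) (cohFamilyTop N)}
    (hg : ∀ ξ h m, g.app ξ (top_prop _) m = (homRestrict f).app ξ h m) :
    (σ.cohRestrict x n).map (ObjectProperty.homMk g.toPMod) = f := by
  refine ObjectProperty.hom_ext _ (PresheafOfModules.Hom.ext (funext fun X ↦ ?_))
  refine ModuleCat.hom_ext (LinearMap.ext fun m ↦ ?_)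
  exact hg X.unop.obj X.unop.property m

lemma homRestrict_app_eq {f : (σ.cohRestrict x (n + 1)).obj M ⟶ (σ.cohRestrict x (n + 1)).obj N}
    {g : (σ.cohRestrict x n).obj M ⟶ (σ.cohRestrict x n).obj N}
    (h : (σ.cohTransition x n).map f ≫ (((σ.cohCompletion x).obj N).iso n).hom =
      (((σ.cohCompletion x).obj M).iso n).hom ≫ g)
    (ξ) (hξ : σ.infNbhd x n ξ) (m : M.obj.obj (op ξ)) :
    (homRestrict g).app ξ hξ m = (homRestrict f).app ξ (σ.infNbhd_le x n _ hξ) m := by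
  have h1 : ((σ.cohTransition x n).map f ≫
      (((σ.cohCompletion x).obj N).iso n).hom).hom.app (op ⟨ξ, hξ⟩) m =
        (homRestrict f).app ξ (σ.infNbhd_le x n _ hξ) m := rfl
  rw [h] at h1
  exact h1

lemma app_eq_of_map_eq {f g : M ⟶ N} (h : (σ.cohRestrict x n).map f = (σ.cohRestrict x n).map g)
    (ξ) (hξ : σ.infNbhd x n ξ) (m : M.obj.obj (op ξ)) :
    f.hom.app (op ξ) m = g.hom.app (op ξ) m :=
  congrArg (fun l : (σ.cohRestrict x n).obj M ⟶ (σ.cohRestrict x n).obj N ↦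
    l.hom.app (op ⟨ξ, hξ⟩) m) h

end Restrict

section Transition

variable {n : ℕ}

lemma bijective_app_iso {M N : Coh (σ.infNbhdSheaf x n)} (e : M ≅ N)
    (X : (σ.infNbhd x n).FullSubcategoryᵒᵖ) : Function.Bijective (e.hom.hom.app X) := by
  refine Function.bijective_iff_has_inverse.mpr ⟨e.inv.hom.app X, fun m ↦ ?_, fun m ↦ ?_⟩
  · exact congrArg (fun f : M ⟶ M ↦ f.hom.app X m) e.hom_inv_id
  · exact congrArg (fun f : N ⟶ N ↦ f.hom.app X m) e.inv_hom_id

/-- The morphism of families underlying a morphism from the restriction of a coherent module to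
the previous infinitesimal neighbourhood. -/
def homTransition {M : Coh (σ.infNbhdSheaf x (n + 1))} {N : Coh (σ.infNbhdSheaf x n)}
    (f : (σ.cohTransition x n).obj M ⟶ N) :
    Hom ((cohFamily M).restrict (σ.infNbhd_le x n)) (cohFamily N) :=
  Hom.ofPMod (hM := ((σ.cohTransition x n).obj M).property.1) f.hom

lemma bijective_homTransition {M : Coh (σ.infNbhdSheaf x (n + 1))} {N : Coh (σ.infNbhdSheaf x n)}
    (e : (σ.cohTransition x n).obj M ≅ N) (ξ) (h : σ.infNbhd x n ξ) :
    Function.Bijective ((homTransition e.hom).app ξ h) :=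
  bijective_app_iso e (op ⟨ξ, h⟩)

/-- A family of finite modules as a coherent module. -/
def toCoh (M : Family (σ := σ) ⊤) (hM : ∀ ξ, Module.Finite ξ.R (M.obj ξ (top_prop ξ))) :
    Coh σ.structureSheaf :=
  ⟨M.toPMod, M.isQCoh_toPMod, fun X ↦ hM X.unop⟩

variable {M : Family (σ := σ) ⊤} {hM : ∀ ξ, Module.Finite ξ.R (M.obj ξ (top_prop ξ))}

/-- A bijective morphism of families from the restriction of a family of finite modules, as an
isomorphism of coherent modules. -/
def isoOfHom {N : Coh (σ.infNbhdSheaf x n)}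
    (l : Hom (M.restrict (le_top : σ.infNbhd x n ≤ ⊤)) (cohFamily N))
    (hl : ∀ ξ h, Function.Bijective (l.app ξ h)) : (σ.cohRestrict x n).obj (toCoh M hM) ≅ N :=
  ObjectProperty.isoMk _
    (Hom.toIso (hM := ((σ.cohRestrict x n).obj (toCoh M hM)).property.1) l hl)

lemma map_isoOfHom_comp {N : Coh (σ.infNbhdSheaf x n)} {N' : Coh (σ.infNbhdSheaf x (n + 1))}
    {l : Hom (M.restrict (le_top : σ.infNbhd x n ≤ ⊤)) (cohFamily N)}
    {hl : ∀ ξ h, Function.Bijective (l.app ξ h)}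
    {l' : Hom (M.restrict (le_top : σ.infNbhd x (n + 1) ≤ ⊤)) (cohFamily N')}
    {hl' : ∀ ξ h, Function.Bijective (l'.app ξ h)} {i : (σ.cohTransition x n).obj N' ⟶ N}
    (h : ∀ ξ (hξ : σ.infNbhd x n ξ) m,
      (homTransition i).app ξ hξ (l'.app ξ (σ.infNbhd_le x n _ hξ) m) = l.app ξ hξ m) :
    (σ.cohTransition x n).map (isoOfHom (hM := hM) l' hl').hom ≫ i =
      (((σ.cohCompletion x).obj (toCoh M hM)).iso n).hom ≫ (isoOfHom l hl).hom := by
  refine ObjectProperty.hom_ext _ (PresheafOfModules.Hom.ext (funext fun X ↦ ?_))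
  exact ModuleCat.hom_ext (LinearMap.ext fun m ↦ h X.unop.obj X.unop.property m)

end Transition

variable [IsNoetherianRing A] [IsLocalRing σ.invariants]

lemma faithful_cohCompletion (hH : ExactInvariants k H) (hx : σ.IsFixed x) :
    (σ.cohCompletion x).Faithful where
  map_injective {M N} f g h := by
    have := finite_onCover N
    have h (n : ℕ) : (σ.cohRestrict x n).map f = (σ.cohRestrict x n).map g :=
      congrFun (congrArg TowerLimit.Hom.app h) n
    have h1 := Hom.app_eq_of_infNbhd (M := cohFamilyTop M) (N := cohFamilyTop N) hH hx
      (f := homOfQCoh f.hom) (g := homOfQCoh g.hom) fun n ↦ app_eq_of_map_eq (h n)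
    refine ObjectProperty.hom_ext _ (PresheafOfModules.Hom.ext (funext fun X ↦ ?_))
    exact ModuleCat.hom_ext (LinearMap.ext fun m ↦ h1 X.unop m)

variable [IsAdicComplete (IsLocalRing.maximalIdeal σ.invariants) σ.invariants]

lemma full_cohCompletion (hH : ExactInvariants k H) (hx : σ.IsFixed x) :
    (σ.cohCompletion x).Full where
  map_surjective {M N} f := by
    have := finite_onCover N
    let f' (n : ℕ) : (σ.cohRestrict x n).obj M ⟶ (σ.cohRestrict x n).obj N :=
      TowerLimit.Hom.app f n
    obtain ⟨g, hg⟩ := exists_hom_of_infNbhd hH hx (fun n ↦ homRestrict (f' n))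
      fun n ↦ homRestrict_app_eq (TowerLimit.Hom.comm f n)
    exact ⟨ObjectProperty.homMk g.toPMod,
      TowerLimit.Hom.ext (funext fun n ↦ map_homMk_toPMod (hg n))⟩

lemma essSurj_cohCompletion (hH : ExactInvariants k H) (hx : σ.IsFixed x) :
    (σ.cohCompletion x).EssSurj where
  mem_essImage X := by
    have := finite_onNbhd hx X.obj
    obtain ⟨M, hM, l, hl, hli⟩ := exists_family_of_infNbhd hx
      (X := fun n ↦ cohFamily (X.obj n)) (fun n ↦ homTransition (X.iso n).hom)
      (fun n ↦ bijective_homTransition (X.iso n)) hH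
    exact ⟨toCoh M hM, ⟨TowerLimit.isoMk (fun n ↦ isoOfHom (l n) (hl n)) fun n ↦
      map_isoOfHom_comp (hli n)⟩⟩

end GAction

end Completion

end

theorem theorem1p3 (k : Type u) [Field k] [IsAlgClosed k]
    (H : Type u) [CommRing H] [HopfAlgebra k H] (hH : IsLinearlyReductive k H)
    (A : Type u) [CommRing A] [Algebra k A] [IsNoetherianRing A] (σ : GAction k H A)
    (x : A →ₐ[k] k) (hx : σ.IsFixed x)
    [IsLocalRing σ.invariants]
    [IsAdicComplete (IsLocalRing.maximalIdeal σ.invariants) σ.invariants] :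
    (σ.cohCompletion x).IsEquivalence := by
  have hH' := hH.cohomologicallyAffine.exactInvariants
  have := GAction.faithful_cohCompletion hH' hx
  have := GAction.full_cohCompletion hH' hx
  have := GAction.essSurj_cohCompletion hH' hx
  exact { }
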